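/- **Setting.** There are $K\ge 2$ arms; arm $k$ has a reward distribution supported in $[0,1]$ with mean $\mu_k$. Let $\Delta_m$ be the smallest difference between two consecutive values of $\mu_1,\dots,\mu_K$ sorted in decreasing order, and let $0<\epsilon<\Delta_m$. In each round $t$ of a horizon of $T$ rounds a given finite set of $N_t\le K$ players is in the game and each of them plays one arm. A player who is alone on her arm $k$ gets a reward drawn from the distribution of arm $k$; if several players play the same arm, each of them collides and gets nothing. All reward draws and all random choices of arms are independent. If player $j$ plays arm $I_{j,t}$ in round $t$ and $\eta_{j,t}\in\{0,1\}$ indicates whether she collides, the expected regret (for the realized choices of arms) and the number of collisions are $$R=\sum_{t=1}^T\sum_{k\in K^*_t}\mu_k-\sum_{t=1}^T\sum_{j}\mu_{I_{j,t}}(1-\eta_{j,t}),\qquad C=\sum_{t=1}^T\sum_j\eta_{j,t},$$ where $K^*_t$ is the set of the $N_t$ arms with the highest means and $j$ runs over the players in the game in round $t$. **Lengths.** For $\delta\in(0,1)$ let $$T_{rh}(\delta)=\left\lceil\frac{\log(\delta/K)}{\log(1-\frac1{4K})}\right\rceil,\qquad T_0(\delta)=T_{rh}(\delta/2)+\frac{2K}{\epsilon^2}\log\frac{4K^2}{\delta},\qquad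 T_{tr}=\frac{K^2}{2}+1 .$$ Let $x\ge1$ be an integer, and write $T_0:=T_0(\delta/T)$ and $T_{ep}:=\sqrt{TK(T_0+T_{tr})/(2x)}$. **Dynamic Trekking.** The algorithm restarts every $\lfloor T_{ep}\rfloor$ rounds, at the same time for all players. An epoch begins with $\lceil T_0\rceil$ rounds of learning: a player plays uniformly random arms until her first collision-free play, and from then on moves to the next arm (cyclically) in every round. For each arm she records the number $S_k$ of her plays and the sum $V_k$ of the rewards from her collision-free plays. At the end of learning she ranks the arms by $V_k/S_k$ and reserves the arm of her last learning round. Then she treks: while her reserved arm is the $i$-th in her ranking with $i\ge2$ and she is not locked, she plays the $(i-1)$-th. After $i-1$ collision-free rounds there she reserves that arm instead; if she collides there, she returns to her reserved arm and is locked, i.e. plays it up to the end of the epoch. She is also locked as soon as her reserved arm is the first in her ranking. A player who enters in the middle of an epoch joins the algorithm at the next restart; which arms she plays until then is arbitrary. **Claim.** Assume that the total number of entries and departures during the $T$ rounds (not counting the players who are there in the first round) is at most $x$; that no player enters during the learning and trekking phases, i.e. during the first $T_0+T_{tr}$ rounds, of an epoch (entering exactly at a restart is allowed); and that $T_0+T_{tr}\le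 T_{ep}\le T$. Then with probability at least $1-\delta$ both $$R<\frac{TK(T_0+T_{tr})}{T_{ep}}+2x(T_{ep}-T_0-T_{tr})$$ and $$C\le\frac{T}{T_{ep}}\Bigl(K\,T_{rh}\bigl(\tfrac{\delta}{2T}\bigr)+4K\Bigr)+2x(T_{ep}-T_0-T_{tr}).$$ -/

import Mathlib

open MeasureTheory ProbabilityTheory

noncomputable section

namespace DynTrek

/-! Arms are `Fin K`, rounds are numbered `0, 1, 2, …`, positions in a ranked list of arms are
numbered `0, …, K - 1` (position `0` is the best arm), players have names in a type `ι`. -/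

/-- The list of the arms in the order of decreasing `v`: `ranking v r` is the arm at position `r`
(equal values are listed by arm index). -/
def ranking {K : ℕ} (v : Fin K → ℝ) : Equiv.Perm (Fin K) :=
  Tuple.sort (fun k => - v k)

/-- The set of the `n` arms with the highest means. -/
def topArms {K : ℕ} (μ : Fin K → ℝ) (n : ℕ) : Finset (Fin K) :=
  Finset.univ.filter (fun k => ((ranking μ).symm k : ℕ) < n)

/-- The smallest gap between the means of two consecutively ranked arms. -/
def minGap {K : ℕ} (μ : Fin K → ℝ) : ℝ :=
  ⨅ i : Fin (K - 1),
    (μ (ranking μ ⟨i, by have := i.2; omega⟩) - μ (ranking μ ⟨i + 1, by have := i.2; omega⟩))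

/-! ### The lengths of the phases -/

/-- Length of the random hopping sub-phase, `⌈log (δ / K) / log (1 - 1 / (4 K))⌉`. -/
def Trh (K : ℕ) (δ : ℝ) : ℕ :=
  ⌈Real.log (δ / K) / Real.log (1 - 1 / (4 * K))⌉₊

/-- Length of the learning phase,
`⌈log (δ / (2 K)) / log (1 - 1 / (4 K))⌉ + (2 K / ε²) log (4 K² / δ)`. -/
def T0 (K : ℕ) (ε δ : ℝ) : ℝ :=
  Trh K (δ / 2) + 2 * K / ε ^ 2 * Real.log (4 * K ^ 2 / δ)

/-- Length of the trekking phase: the value of `(K² - (N - 1)²) / 2 + 1` at `N = 1`, the largest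
one over the possible numbers `N ≥ 1` of players. -/
def Ttr (K : ℕ) : ℝ := (K : ℝ) ^ 2 / 2 + 1

/-- Length of an epoch, `√(T K (T₀(δ / T) + T_tr) / (2 x))`. -/
def Tep (K T x : ℕ) (ε δ : ℝ) : ℝ :=
  Real.sqrt (T * K * (T0 K ε (δ / T) + Ttr K) / (2 * x))

/-! ### The algorithm, as run by one player -/

/-- Memory of a player in the learning phase. -/
structure LearnState (K : ℕ) where
  /-- `none` as long as every play collided (random hopping); after the first collision-free play
  (sequential hopping), the arm of the previous round. -/
  last : Option (Fin K)
  /-- sum of the rewards obtained on each arm -/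
  V : Fin K → ℝ
  /-- number of plays of each arm -/
  S : Fin K → ℕ

/-- Memory of a player in the trekking phase. -/
structure TrekState (K : ℕ) where
  /-- the list of the arms, best estimated mean first -/
  list : Equiv.Perm (Fin K)
  /-- position of the reserved arm -/
  J : Fin K
  /-- number of collision-free rounds spent so far on the arm just above the reserved one -/
  Y : ℕ
  /-- whether the player is locked on the reserved arm -/
  locked : Bool

/-- Memory of a player. -/
inductive PlayerState (K : ℕ) where
  | learn (ℓ : LearnState K) : PlayerState K
  | trek (τ : TrekState K) : PlayerState K

/-- Memory at the beginning of an epoch. -/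
def PlayerState.init (K : ℕ) : PlayerState K :=
  .learn { last := none, V := fun _ => 0, S := fun _ => 0 }

/-- Arm played in the learning phase; `u` is a uniform draw from the arms. -/
def LearnState.choose {K : ℕ} (ℓ : LearnState K) (u : Fin K) : Fin K :=
  match ℓ.last with
  | none => u
  | some k => finRotate K k

/-- Update after playing arm `k` in the learning phase; `c` tells whether a collision occurred and
`r` is the reward of the arm. -/
def LearnState.update {K : ℕ} (ℓ : LearnState K) (k : Fin K) (c : Bool) (r : ℝ) : LearnState K where
  last := if c = true ∧ ℓ.last = none then none else some k
  V := if c = true then ℓ.V else Function.update ℓ.V k (ℓ.V k + r)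
  S := Function.update ℓ.S k (ℓ.S k + 1)

/-- Estimated means of the arms. -/
def LearnState.estimate {K : ℕ} (ℓ : LearnState K) (k : Fin K) : ℝ := ℓ.V k / ℓ.S k

/-- Memory at the beginning of the trekking phase: the arm `k` played in the last round of the
learning phase is reserved, and the player is locked on it if it is the top arm of her list. -/
def TrekState.start {K : ℕ} (π : Equiv.Perm (Fin K)) (k : Fin K) : TrekState K where
  list := π
  J := π.symm k
  Y := 0
  locked := decide ((π.symm k : ℕ) = 0)

/-- Arm played in the trekking phase: the reserved arm if the player is locked on it, else the next
better arm. -/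
def TrekState.choose {K : ℕ} (τ : TrekState K) : Fin K :=
  if τ.locked = true then τ.list τ.J
  else τ.list ⟨(τ.J : ℕ) - 1, by have := τ.J.2; omega⟩

/-- Update in the trekking phase. A player who collides on the next better arm returns to her
reserved arm and is locked on it. A player whose reserved arm is the `i`-th best one (position
`i - 1`) and who has had `i - 1` collision-free rounds on the `(i - 1)`-th best one reserves the
latter, and is locked on it if it is the top arm. A locked player stays locked. -/
def TrekState.update {K : ℕ} (τ : TrekState K) (c : Bool) : TrekState K :=
  if τ.locked = true then τ
  else if c = true then { τ with locked := true }
  else if τ.Y + 1 < (τ.J : ℕ) then { τ with Y := τ.Y + 1 }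
  else { τ with
    J := ⟨(τ.J : ℕ) - 1, by have := τ.J.2; omega⟩
    Y := 0
    locked := decide ((τ.J : ℕ) - 1 = 0) }

/-- Arm played by a player who follows the algorithm. -/
def PlayerState.choose {K : ℕ} (st : PlayerState K) (u : Fin K) : Fin K :=
  match st with
  | .learn ℓ => ℓ.choose u
  | .trek τ => τ.choose

/-- Update of the memory after the round with number `s` in the current epoch; the learning phase
consists of the rounds `0, …, n - 1` of the epoch. -/
def PlayerState.update {K : ℕ} (n s : ℕ) (st : PlayerState K) (k : Fin K) (c : Bool) (r : ℝ) :
    PlayerState K :=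
  match st with
  | .learn ℓ =>
    if s + 1 < n then .learn (ℓ.update k c r)
    else .trek (TrekState.start (ranking (ℓ.update k c r).estimate) k)
  | .trek τ => .trek (τ.update c)

/-! ### The game -/

/-- The data that determine one run of the game. -/
structure Run (ι : Type*) (K : ℕ) where
  /-- number of rounds of the learning phase of each epoch -/
  learnLen : ℕ
  /-- number of rounds of each epoch -/
  epochLen : ℕ
  /-- players in the game in each round -/
  present : ℕ → Finset ι
  /-- the uniform draw of each player in each round -/
  draw : ι → ℕ → Fin K
  /-- the reward that each player gets in each round from each arm if she plays it alone -/
  reward : ι → ℕ → Fin K → ℝ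
  /-- the arms played by those who entered after the beginning of the current epoch -/
  free : ι → ℕ → Fin K

namespace Run

variable {ι : Type*} {K : ℕ} [DecidableEq ι] (G : Run ι K)

/-- Player `p` has been in the game from the beginning of the epoch of round `t` up to round `t`. -/
def FromStart (p : ι) (t : ℕ) : Prop :=
  ∀ s ∈ Finset.Icc (t - t % G.epochLen) t, p ∈ G.present s

instance (p : ι) (t : ℕ) : Decidable (G.FromStart p t) := by
  unfold FromStart; infer_instance

/-- The arm played by `p` in round `t`, given the memories of the players: those in the game since
the beginning of the epoch follow the algorithm. -/
def armOf (σ : ι → PlayerState K) (t : ℕ) (p : ι) : Fin K :=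
  if G.FromStart p t then (σ p).choose (G.draw p t) else G.free p t

/-- Whether `p` collides in round `t`: another player in the game plays the same arm. -/
def collidesOf (σ : ι → PlayerState K) (t : ℕ) (p : ι) : Bool :=
  decide (∃ q ∈ G.present t, q ≠ p ∧ G.armOf σ t q = G.armOf σ t p)

/-- The memories of the players just before round `t`; they are reset at the multiples of the epoch
length. -/
def state : ℕ → ι → PlayerState K
  | 0 => fun _ => PlayerState.init K
  | t + 1 => fun p =>
    if (t + 1) % G.epochLen = 0 then PlayerState.init K
    else (state t p).update G.learnLen (t % G.epochLen) (G.armOf (state t) t p)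
      (G.collidesOf (state t) t p) (G.reward p t (G.armOf (state t) t p))

/-- The arm played by `p` in round `t`. -/
def arm (t : ℕ) (p : ι) : Fin K := G.armOf (G.state t) t p

/-- Whether `p` collides in round `t`. -/
def collides (t : ℕ) (p : ι) : Bool := G.collidesOf (G.state t) t p

/-- The regret over `T` rounds, for the means `μ` of the arms:
`∑ₜ ∑_{k ∈ K*ₜ} μₖ - ∑ₜ ∑ⱼ μ_{I_{j,t}} (1 - η_{j,t})`. -/
def regret (μ : Fin K → ℝ) (T : ℕ) : ℝ :=
  (∑ t ∈ Finset.range T, ∑ k ∈ topArms μ (G.present t).card, μ k)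
    - ∑ t ∈ Finset.range T, ∑ p ∈ G.present t, μ (G.arm t p) * (1 - if G.collides t p then 1 else 0)

/-- The number of collisions over `T` rounds, summed over the players. -/
def collisions (T : ℕ) : ℕ :=
  ∑ t ∈ Finset.range T, ∑ p ∈ G.present t, if G.collides t p then 1 else 0

end Run

/-- The number of entries and departures (after the players of round `0` have joined) during the
rounds `0, …, T - 1`. -/
def moves {ι : Type*} [DecidableEq ι] (present : ℕ → Finset ι) (T : ℕ) : ℕ :=
  ∑ t ∈ Finset.range (T - 1),
    ((present (t + 1) \ present t).card + (present t \ present (t + 1)).card)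

/-- The law of the randomness of one player in one round: a uniform draw from the arms, and for
each arm `k` a reward of law `ν k`, all independent. -/
def roundLaw {K : ℕ} (ν : Fin K → Measure ℝ) : Measure (Fin K × (Fin K → ℝ)) :=
  (uniformOn (Set.univ : Set (Fin K))).prod (Measure.pi ν)

/-- Dynamic Trekking with inputs `K, δ, T, x` (and `ε`): every epoch has `⌊T_ep⌋` rounds and starts
with a learning phase of `⌈T₀(δ / T)⌉` rounds. `ξ p t` is the randomness of player `p` in round `t`
and `free` is what players do between their entry and the next restart. -/
def dynamicTrekking {ι : Type*} (K T x : ℕ) (ε δ : ℝ) (present : ℕ → Finset ι)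
    (ξ : ι → ℕ → Fin K × (Fin K → ℝ)) (free : ι → ℕ → Fin K) : Run ι K where
  learnLen := ⌈T0 K ε (δ / T)⌉₊
  epochLen := ⌊Tep K T x ε δ⌋₊
  present := present
  draw := fun p t => (ξ p t).1
  reward := fun p t => (ξ p t).2
  free := free

end DynTrek

end

/-! Call an epoch good (`GoodEpoch`) if nobody hops randomly after `H` rounds, where `H` is about a
quarter of the random hopping length, and every player who completes the learning phase ranks the
arms correctly. If all epochs are good, both bounds follow by counting; the probabilistic part shows
that all of them are good with probability at least `1 - δ`.

Hopping. Whatever the others play, a randomly hopping player finds a free arm with probability at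
least `1 / K`, so the mean number of random hoppers shrinks by `1 - 1 / K` per round. Since `1 - 1 /
K ≤ (1 - 1 / (4 K)) ^ 4`, a quarter of the prescribed length suffices. Settled players sit on
distinct arms and rotate without colliding.

Estimates. A collision counts as a play but yields no reward, so `V / S` is biased downwards. In a
comparison of two arms only the `c` collisions on the better arm do harm, and they cost at most `c /
(m + c)`, where `m` is the number of full cycles after settling. Arms played during learning depend
on the draws and not on the rewards, so Hoeffding's inequality applies for fixed draws
(`measure_draws_rewards_le`) and gives `exp (-m (ε - c / (m + c))²) ≤ exp (-(8/13) m ε²) (3/2) ^ c`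
(`exp_deviation_le`). A supermartingale (`hitPotential_step`) bounds the mean of `(3/2) ^ c` by `2
(1 + 2 K)`. An epoch then fails with probability at most `(K + 1) δ / T`, and epochs are long enough
for `E + 1 ≤ T / (K + 1)`, so a union bound gives `δ`.

Trekking. With correct rankings all players climb the same list. By the invariants `TrekInv`
reserved arms stay distinct, everybody is locked after `K (K - 1) / 2` rounds, and a locked player
has locked players on all better positions. Every collision locks a climber, so there are at most `2
K` of them per epoch.

Counting. A round costs at most half of `K` plus its collisions (`round_regret_le`). The factor one
half pays for random hopping, for rounding and for the incomplete last epoch (`EpochSplit.cost_lt`).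
After trekking, regret and collisions of a round are at most twice the number of entries and
departures since the restart (`late_round_le`), which gives the term in `x`. -/

noncomputable section
namespace DynTrek

/-! ### Averages over sequences of draws -/

/-- A finite sequence, continued by a constant. -/
def extendSeq {D : Type*} (z : D) {n : ℕ} (d : Fin n → D) (i : ℕ) : D :=
  if h : i < n then d ⟨i, h⟩ else z

lemma extendSeq_snoc {D : Type*} (z : D) {n : ℕ} (d : Fin n → D) (u : D) :
    extendSeq z (Fin.snoc (α := fun _ => D) d u) = Function.update (extendSeq z d) n u := by
  funext i
  rcases lt_trichotomy i n with h | h | h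
  · have h1 : i < n + 1 := by omega
    simp [extendSeq, Function.update_of_ne h.ne, h, h1, Fin.snoc]
  · subst h
    simp [extendSeq, Fin.snoc]
  · have h1 : ¬ i < n + 1 := by omega
    have h2 : ¬ i < n := by omega
    simp [extendSeq, Function.update_of_ne h.ne', h1, h2]

/-- A quantity whose average over the next draw never increases has, after `n` draws, an average
that is at most its initial value. -/
theorem sum_extendSeq_le {D : Type*} [Fintype D] (z : D) (F : ℕ → (ℕ → D) → ℝ) (n : ℕ)
    (hF : ∀ s < n, ∀ d : ℕ → D,
      ∑ u, F (s + 1) (Function.update d s u) ≤ Fintype.card D * F s d) :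
    ∑ d : Fin n → D, F n (extendSeq z d) ≤ (Fintype.card D : ℝ) ^ n * F 0 (fun _ => z) := by
  induction n with
  | zero =>
    have : (extendSeq z : (Fin 0 → D) → ℕ → D) = fun _ _ => z := by
      funext d i; simp [extendSeq]
    simp [this]
  | succ n ih =>
    -- The last draw becomes the inner sum, taken for fixed earlier draws.
    rw [← Equiv.sum_comp (Fin.snocEquiv fun _ => D), Fintype.sum_prod_type_right]
    have h1 : ∀ d : Fin n → D, ∑ u, F (n + 1) (extendSeq z (Fin.snocEquiv (fun _ => D) (u, d)))
        ≤ Fintype.card D * F n (extendSeq z d) := by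
      intro d
      refine le_trans (le_of_eq ?_) (hF n (by omega) (extendSeq z d))
      refine Finset.sum_congr rfl fun u _ => ?_
      rw [← extendSeq_snoc]; rfl
    calc _ ≤ ∑ d : Fin n → D, Fintype.card D * F n (extendSeq z d) :=
          Finset.sum_le_sum fun d _ => h1 d
      _ = Fintype.card D * ∑ d : Fin n → D, F n (extendSeq z d) := by rw [Finset.mul_sum]
      _ ≤ Fintype.card D * ((Fintype.card D : ℝ) ^ n * F 0 (fun _ => z)) := by
          gcongr
          exact ih fun s hs d => hF s (by omega) d
      _ = _ := by ring

/-- Redrawing one coordinate does not change an average. -/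
lemma sum_sum_update {α D : Type*} [Fintype α] [DecidableEq α] [Fintype D] (f : (α → D) → ℝ)
    (q : α) : ∑ u, ∑ k, f (Function.update u q k) = Fintype.card D * ∑ u, f u := by
  -- Exchanging coordinate `q` with the fresh value only permutes the pairs `(u, k)`.
  have hinv : Function.Involutive
      (fun x : (α → D) × D => (Function.update x.1 q x.2, x.1 q)) := by
    rintro ⟨u, k⟩
    simp
  have h := Equiv.sum_comp hinv.toPerm (fun x : (α → D) × D => f x.1)
  rw [Fintype.sum_prod_type, Fintype.sum_prod_type] at h
  simp only [Function.Involutive.coe_toPerm] at h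
  rw [h]
  simp [Finset.mul_sum]

/-! ### The hopping process: random hopping, then sequential hopping -/

section Hopping

variable {α : Type*} {K : ℕ}

/-- Arm played by `p`, given the previous arms `σ` of the players (`none` for those who still hop
randomly) and their draws `u`. -/
def hopArm (σ : α → Option (Fin K)) (u : α → Fin K) (p : α) : Fin K :=
  (σ p).elim (u p) (finRotate K)

/-- Player `p` collides with another player in `A`. -/
def hopColl (A : Finset α) (σ : α → Option (Fin K)) (u : α → Fin K) (p : α) : Prop :=
  ∃ q ∈ A, q ≠ p ∧ hopArm σ u q = hopArm σ u p

open Classical in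
/-- One round of the hopping process. -/
def hopStep (A : Finset α) (σ : α → Option (Fin K)) (u : α → Fin K) (p : α) : Option (Fin K) :=
  if hopColl A σ u p ∧ σ p = none then none else some (hopArm σ u p)

/-- The hopping process with draws `d`, where `A s` are the players in round `s`. -/
def hop (A : ℕ → Finset α) (d : ℕ → α → Fin K) : ℕ → α → Option (Fin K)
  | 0 => fun _ => none
  | s + 1 => hopStep (A s) (hop A d s) (d s)

lemma hop_congr (A : ℕ → Finset α) {d d' : ℕ → α → Fin K} {s : ℕ} (h : ∀ i < s, d i = d' i) :
    hop A d s = hop A d' s := by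
  induction s with
  | zero => rfl
  | succ s ih =>
    simp only [hop]
    rw [ih fun i hi => h i (by omega), h s (by omega)]

/-- The memory before round `s` ignores the draws of round `s`, which allows averaging over these
alone. -/
lemma hop_update (A : ℕ → Finset α) (d : ℕ → α → Fin K) (s : ℕ) (u : α → Fin K) {i : ℕ}
    (hi : i ≤ s) : hop A (Function.update d s u) i = hop A d i :=
  hop_congr A fun j hj => Function.update_of_ne (by omega) _ _

lemma hopArm_of_none {σ : α → Option (Fin K)} {p : α} (h : σ p = none) (u : α → Fin K) :
    hopArm σ u p = u p := by simp [hopArm, h]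

lemma hopArm_of_some {σ : α → Option (Fin K)} {p : α} {j : Fin K} (h : σ p = some j)
    (u : α → Fin K) : hopArm σ u p = finRotate K j := by simp [hopArm, h]

lemma hopStep_of_some (A : Finset α) {σ : α → Option (Fin K)} {p : α} {j : Fin K}
    (h : σ p = some j) (u : α → Fin K) : hopStep A σ u p = some (finRotate K j) := by
  simp [hopStep, h, hopArm]

lemma hopStep_eq_none_iff (A : Finset α) (σ : α → Option (Fin K)) (p : α) (u : α → Fin K) :
    hopStep A σ u p = none ↔ hopColl A σ u p ∧ σ p = none := by
  unfold hopStep; split_ifs with h <;> simp [h]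

lemma hop_ne_none_of_le (A : ℕ → Finset α) (d : ℕ → α → Fin K) {p : α} {s s' : ℕ} (hs : s ≤ s')
    (h : hop A d s p ≠ none) : hop A d s' p ≠ none := by
  induction s', hs using Nat.le_induction with
  | base => exact h
  | succ s' _ ih =>
    simp only [hop, ne_eq, hopStep_eq_none_iff]
    tauto

/-- Players who hop sequentially were on distinct arms. -/
lemma hop_injOn {A : ℕ → Finset α} (hA : Antitone A) (d : ℕ → α → Fin K) (s : ℕ) {p q : α}
    (hp : p ∈ A s) (hq : q ∈ A s) {j : Fin K} (h1 : hop A d s p = some j)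
    (h2 : hop A d s q = some j) : p = q := by
  induction s generalizing j with
  | zero => simp [hop] at h1
  | succ s ih =>
    by_contra hne
    have hp' := hA (Nat.le_succ s) hp
    have hq' := hA (Nat.le_succ s) hq
    simp only [hop, hopStep] at h1 h2
    split_ifs at h1 h2 with c1 c2
    simp only [Option.some.injEq] at h1 h2
    -- Two players on the same arm collide, so neither can have settled in this round: both were
    -- already rotating, and rotation is injective.
    have e1 : hop A d s p ≠ none := fun h => c1 ⟨⟨q, hq', Ne.symm hne, h2.trans h1.symm⟩, h⟩
    have e2 : hop A d s q ≠ none := fun h => c2 ⟨⟨p, hp', hne, h1.trans h2.symm⟩, h⟩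
    obtain ⟨a, ha⟩ := Option.ne_none_iff_exists'.1 e1
    obtain ⟨b, hb⟩ := Option.ne_none_iff_exists'.1 e2
    rw [hopArm_of_some ha] at h1
    rw [hopArm_of_some hb] at h2
    have hab : a = b := (finRotate K).injective (h1.trans h2.symm)
    subst hab
    exact hne (ih hp' hq' ha hb)

/-- Once all players hop sequentially, nobody collides. -/
lemma not_hopColl {A : ℕ → Finset α} (hA : Antitone A) (d : ℕ → α → Fin K) (s : ℕ)
    (h : ∀ p ∈ A s, hop A d s p ≠ none) {p : α} (hp : p ∈ A s) (u : α → Fin K) :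
    ¬ hopColl (A s) (hop A d s) u p := by
  rintro ⟨q, hq, hne, he⟩
  obtain ⟨a, ha⟩ := Option.ne_none_iff_exists'.1 (h p hp)
  obtain ⟨b, hb⟩ := Option.ne_none_iff_exists'.1 (h q hq)
  rw [hopArm_of_some ha, hopArm_of_some hb] at he
  have := (finRotate K).injective he
  subst this
  exact hne (hop_injOn hA d s hq hp hb ha)

/-- Number of players in `A` who still hop randomly. -/
def numRandom (A : Finset α) (σ : α → Option (Fin K)) : ℕ := (A.filter fun q => σ q = none).card

lemma numRandom_hopStep_le {A A' : Finset α} (hAA : A' ⊆ A) (σ : α → Option (Fin K))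
    (u : α → Fin K) : numRandom A' (hopStep A σ u) ≤ numRandom A σ := by
  refine Finset.card_le_card fun q hq => ?_
  simp only [Finset.mem_filter, hopStep_eq_none_iff] at hq ⊢
  exact ⟨hAA hq.1, hq.2.2⟩

variable [DecidableEq α]

open Classical in
/-- A randomly hopping player settles with probability at least `1 / K`: whatever the others do,
some arm is left for her. -/
lemma sum_hopColl_le [Fintype α] {A : Finset α} (hAK : A.card ≤ K) {σ : α → Option (Fin K)} {q : α}
    (hqA : q ∈ A) (hq : σ q = none) :
    (K : ℝ) * ∑ u : α → Fin K, (if hopColl A σ u q then (1 : ℝ) else 0)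
      ≤ (K - 1) * Fintype.card (α → Fin K) := by
  -- Redrawing only the arm of `q` leaves the other arms fixed; at most `K - 1` of the `K` values
  -- can then collide.
  have h0 := sum_sum_update (fun u : α → Fin K => if hopColl A σ u q then (1 : ℝ) else 0) q
  rw [Fintype.card_fin] at h0
  rw [← h0, mul_comm, ← nsmul_eq_mul, ← Finset.card_univ, ← Finset.sum_const]
  refine Finset.sum_le_sum fun u _ => ?_
  have harm : ∀ k : Fin K, ∀ r ≠ q, hopArm σ (Function.update u q k) r = hopArm σ u r := by
    intro k r hr
    simp [hopArm, Function.update_of_ne hr]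
  have hc : ((A.erase q).image (hopArm σ u)).card < (Finset.univ : Finset (Fin K)).card := by
    rw [Finset.card_univ, Fintype.card_fin]
    refine lt_of_le_of_lt Finset.card_image_le ?_
    rw [Finset.card_erase_of_mem hqA]
    have := Finset.card_pos.2 ⟨q, hqA⟩
    omega
  obtain ⟨k, -, hk⟩ := Finset.exists_mem_notMem_of_card_lt_card hc
  have hk' : ¬ hopColl A σ (Function.update u q k) q := by
    rintro ⟨r, hr, hne, he⟩
    rw [harm k r hne, hopArm_of_none hq, Function.update_self] at he
    exact hk (Finset.mem_image.2 ⟨r, Finset.mem_erase.2 ⟨hne, hr⟩, he⟩)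
  rw [← Finset.add_sum_erase _ _ (Finset.mem_univ k), if_neg hk', zero_add]
  calc _ ≤ ∑ _j ∈ Finset.univ.erase k, (1 : ℝ) :=
        Finset.sum_le_sum fun j _ => by split_ifs <;> norm_num
    _ = K - 1 := by
        rw [Finset.sum_const, Finset.card_erase_of_mem (Finset.mem_univ k), Finset.card_univ,
          Fintype.card_fin, nsmul_eq_mul, mul_one, Nat.cast_pred (Fin.pos k)]

/-- The mean number of randomly hopping players shrinks by the factor `1 - 1 / K`. -/
lemma sum_numRandom_le [Fintype α] {A A' : Finset α} (hAA : A' ⊆ A) (hAK : A.card ≤ K)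
    (hK : 0 < K) (σ : α → Option (Fin K)) :
    ∑ u : α → Fin K, (numRandom A' (hopStep A σ u) : ℝ)
      ≤ Fintype.card (α → Fin K) * ((1 - 1 / K) * numRandom A σ) := by
  classical
  have hK' : (0 : ℝ) < K := by exact_mod_cast hK
  have h1 : ∀ u : α → Fin K, (numRandom A' (hopStep A σ u) : ℝ)
      ≤ ∑ q ∈ A.filter (fun q => σ q = none), if hopColl A σ u q then (1 : ℝ) else 0 := by
    intro u
    rw [← Finset.sum_filter, Finset.sum_const, nsmul_eq_mul, mul_one, Nat.cast_le]
    refine Finset.card_le_card fun q hq => ?_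
    simp only [Finset.mem_filter, hopStep_eq_none_iff] at hq ⊢
    exact ⟨⟨hAA hq.1, hq.2.2⟩, hq.2.1⟩
  calc _ ≤ ∑ u : α → Fin K, ∑ q ∈ A.filter (fun q => σ q = none),
          (if hopColl A σ u q then (1 : ℝ) else 0) := Finset.sum_le_sum fun u _ => h1 u
    _ = ∑ q ∈ A.filter (fun q => σ q = none), ∑ u : α → Fin K,
          (if hopColl A σ u q then (1 : ℝ) else 0) := Finset.sum_comm
    _ ≤ ∑ _q ∈ A.filter (fun q => σ q = none), ((1 - 1 / K) * Fintype.card (α → Fin K) : ℝ) := by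
        refine Finset.sum_le_sum fun q hq => ?_
        rw [Finset.mem_filter] at hq
        have := sum_hopColl_le hAK hq.1 hq.2
        rw [← le_div_iff₀' hK'] at this
        refine this.trans (le_of_eq ?_)
        field_simp
    _ = _ := by rw [Finset.sum_const, nsmul_eq_mul, numRandom]; ring

/-- The mean number of randomly hopping players after `n` rounds. -/
theorem sum_numRandom_hop_le [Fintype α] {A : ℕ → Finset α} (hA : Antitone A)
    (hAK : (A 0).card ≤ K) (hK : 0 < K) (z : α → Fin K) (n : ℕ) :
    ∑ d : Fin n → α → Fin K, (numRandom (A n) (hop A (extendSeq z d) n) : ℝ)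
      ≤ (Fintype.card (α → Fin K) : ℝ) ^ n * (K * (1 - 1 / K) ^ n) := by
  have hK' : (1 : ℝ) ≤ K := by exact_mod_cast hK
  have hν : (0 : ℝ) ≤ 1 - 1 / K := by
    rw [sub_nonneg, div_le_one (by linarith)]; exact hK'
  -- The weight `(1 - 1 / K) ^ (n - s)` compensates the decay and turns it into a quantity whose
  -- average does not increase.
  have key := sum_extendSeq_le z (fun s d => (numRandom (A s) (hop A d s) : ℝ)
    * (1 - 1 / K) ^ (n - s)) n ?_
  · simp only [Nat.sub_self, pow_zero, mul_one, Nat.sub_zero] at key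
    refine key.trans ?_
    gcongr
    refine (Finset.card_filter_le _ _).trans hAK
  · intro s hs d
    simp only [hop, hop_update A d s _ le_rfl, Function.update_self]
    rw [← Finset.sum_mul]
    calc _ ≤ Fintype.card (α → Fin K) * ((1 - 1 / K) * numRandom (A s) (hop A d s))
            * (1 - 1 / K : ℝ) ^ (n - (s + 1)) := by
          gcongr
          exact sum_numRandom_le (hA (Nat.le_succ s))
            ((Finset.card_le_card (hA (Nat.zero_le s))).trans hAK) hK _
      _ = _ := by
          rw [show n - s = (n - (s + 1)) + 1 by omega, pow_succ]
          ring

end Hopping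
end DynTrek
end

noncomputable section
namespace DynTrek

/-! ### Exponential moment of the number of collisions on an arm -/

section HoppingMoment

variable {α : Type*} {K : ℕ}

open Classical in
/-- Rounds before round `n` in which player `p` collides on arm `k`. -/
def hopHits (A : ℕ → Finset α) (d : ℕ → α → Fin K) (p : α) (k : Fin K) (n : ℕ) : Finset ℕ :=
  (Finset.range n).filter fun s =>
    hopColl (A s) (hop A d s) (d s) p ∧ hopArm (hop A d s) (d s) p = k

/-- Bernoulli's inequality for the inverse: `(1 + 1 / (K - 1)) ^ K ≥ 1 + K / (K - 1) ≥ 2`. -/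
lemma one_sub_inv_pow_le_half {K : ℕ} (hK : 2 ≤ K) : (1 - 1 / K : ℝ) ^ K ≤ 1 / 2 := by
  have h2 : (2 : ℝ) ≤ K := by exact_mod_cast hK
  have h1 : (0 : ℝ) < 1 - 1 / K := by
    rw [sub_pos, div_lt_one (by linarith)]; linarith
  have hb := one_add_mul_le_pow (a := 1 / ((K : ℝ) - 1)) (by
    have : (0 : ℝ) ≤ 1 / ((K : ℝ) - 1) := div_nonneg zero_le_one (by linarith)
    linarith) K
  have he : (1 - 1 / K : ℝ) = (1 + 1 / ((K : ℝ) - 1))⁻¹ := by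
    have h3 : (K : ℝ) - 1 ≠ 0 := by linarith
    have h4 : (K : ℝ) ≠ 0 := by linarith
    refine eq_inv_of_mul_eq_one_left ?_
    field_simp
    ring
  have h3 : (1 : ℝ) ≤ K * (1 / ((K : ℝ) - 1)) := by
    rw [mul_one_div, le_div_iff₀ (by linarith)]; linarith
  have h4 : (2 : ℝ) ≤ (1 + 1 / ((K : ℝ) - 1)) ^ K := by linarith
  rw [he, inv_pow, one_div (2 : ℝ)]
  exact inv_anti₀ (by norm_num) h4

variable [NeZero K]

/-- The potential of a player with memory `o` when `h` players hop randomly; `k` is the arm on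
which her collisions are counted. -/
def hitPotential (k : Fin K) (o : Option (Fin K)) (h : ℝ) : ℝ :=
  o.elim (2 * (1 + 2 * h)) fun j => 1 + 2 * h * (1 - 1 / K) ^ ((k - finRotate K j : Fin K) : ℕ)

/-- The waiting time until a rotating player is on arm `k` goes down by one per round and restarts
at `K - 1` after `k`. -/
lemma val_sub_finRotate (k j : Fin K) : ((k - finRotate K j : Fin K) : ℕ)
    = if k = j then K - 1 else ((k - j : Fin K) : ℕ) - 1 := by
  obtain ⟨m, rfl⟩ : ∃ m, K = m + 1 := ⟨K - 1, by have := NeZero.ne K; omega⟩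
  rw [finRotate_apply, sub_add_eq_sub_sub]
  split_ifs with h
  · subst h
    simp
  · have : k - j ≠ 0 := sub_ne_zero.2 h
    rw [Fin.val_sub_one_of_ne_zero this]

variable [DecidableEq α] [Fintype α]

-- The supermartingale behind the exponential moment. A rotating player can collide on `k` only when
-- she comes to `k`, in `m` rounds; by then the mean number of random hoppers has fallen from `h` to
-- `h (1 - 1 / K) ^ m`, hence the form of the potential. A full cycle halves it, by
-- `one_sub_inv_pow_le_half`, which makes up for the factor `3 / 2` of a possible collision. The
-- doubled value before settling covers the collisions during random hopping.
open Classical in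
lemma hitPotential_step {A A' : Finset α} (hAA : A' ⊆ A) (hAK : A.card ≤ K) (hK : 2 ≤ K)
    {σ : α → Option (Fin K)}
    (hσ : ∀ u, (∀ q ∈ A, σ q ≠ none) → ∀ q ∈ A, ¬ hopColl A σ u q) {p : α} (hp : p ∈ A)
    (k : Fin K) :
    ∑ u : α → Fin K, (if hopColl A σ u p ∧ hopArm σ u p = k then (3 / 2 : ℝ) else 1)
        * hitPotential k (hopStep A σ u p) (numRandom A' (hopStep A σ u))
      ≤ Fintype.card (α → Fin K) * hitPotential k (σ p) (numRandom A σ) := by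
  have h2 : (2 : ℝ) ≤ K := by exact_mod_cast hK
  have hν : (0 : ℝ) ≤ 1 - 1 / K := by
    rw [sub_nonneg, div_le_one (by linarith)]; linarith
  have hν1 : (1 - 1 / K : ℝ) ≤ 1 := by
    have : (0 : ℝ) ≤ 1 / K := by positivity
    linarith
  have hpow : ∀ m : ℕ, (1 - 1 / K : ℝ) ^ m ≤ 1 := fun m => pow_le_one₀ hν hν1
  have hpow0 : ∀ m : ℕ, 0 ≤ (1 - 1 / K : ℝ) ^ m := fun m => pow_nonneg hν m
  set N : ℝ := ((Fintype.card (α → Fin K) : ℕ) : ℝ) with hN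
  have hN0 : 0 ≤ N := Nat.cast_nonneg _
  set h : ℝ := ((numRandom A σ : ℕ) : ℝ) with hh
  have hh0 : 0 ≤ h := Nat.cast_nonneg _
  set h' : (α → Fin K) → ℝ := fun u => ((numRandom A' (hopStep A σ u) : ℕ) : ℝ) with hh'
  have hle : ∀ u, h' u ≤ h := fun u => by
    simp only [hh', hh]; exact_mod_cast numRandom_hopStep_le hAA σ u
  have h0' : ∀ u, 0 ≤ h' u := fun u => Nat.cast_nonneg _
  have hsum : ∑ u, h' u ≤ N * ((1 - 1 / K) * h) := sum_numRandom_le hAA hAK (by omega) σ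
  have hone : ∑ _u : α → Fin K, (1 : ℝ) = N := by simp [hN]
  rcases hpσ : σ p with _ | j
  · -- random hopping
    have hs := sum_hopColl_le hAK hp hpσ
    have hk : (K : ℝ) * ∑ u : α → Fin K, (if u p = k then (1 : ℝ) else 0) = N := by
      have := sum_sum_update (fun u : α → Fin K => if u p = k then (1 : ℝ) else 0) p
      rw [Fintype.card_fin] at this
      rw [← this]
      simp [hN]
    -- The three summands have means at most `1`, `1 - 1 / K` and `1 / K`, so their sum is at most
    -- `2`, exactly the factor in the potential of a random hopper.
    have hterm : ∀ u : α → Fin K,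
        (if hopColl A σ u p ∧ hopArm σ u p = k then (3 / 2 : ℝ) else 1)
          * hitPotential k (hopStep A σ u p) (h' u)
        ≤ (1 + 2 * h) * (1 + (if hopColl A σ u p then (1 : ℝ) else 0)
            + (if u p = k then (1 : ℝ) else 0)) := by
      intro u
      have hk0 : (0 : ℝ) ≤ if u p = k then (1 : ℝ) else 0 := by split_ifs <;> norm_num
      by_cases hc : hopColl A σ u p
      · have : hopStep A σ u p = none := (hopStep_eq_none_iff _ _ _ _).2 ⟨hc, hpσ⟩
        simp only [this, hopArm_of_none hpσ]
        simp only [hc, true_and, if_true, hitPotential, Option.elim]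
        have := hle u
        split_ifs <;> nlinarith
      · have : hopStep A σ u p = some (u p) := by
          simp [hopStep, hc, hopArm_of_none hpσ]
        rw [this]
        simp only [hc, false_and, if_false, hitPotential, Option.elim]
        have h1 := hpow ((k - finRotate K (u p) : Fin K) : ℕ)
        have h2 := hpow0 ((k - finRotate K (u p) : Fin K) : ℕ)
        have h3 := hle u
        have h4 := h0' u
        have h5 : h' u * (1 - 1 / K : ℝ) ^ ((k - finRotate K (u p) : Fin K) : ℕ) ≤ h * 1 :=
          mul_le_mul h3 h1 h2 hh0
        nlinarith
    refine (Finset.sum_le_sum fun u _ => hterm u).trans ?_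
    rw [← Finset.mul_sum, Finset.sum_add_distrib, Finset.sum_add_distrib, hone]
    simp only [hitPotential, Option.elim]
    have hK0 : (0 : ℝ) < K := by linarith
    have key : N + ∑ u : α → Fin K, (if hopColl A σ u p then (1 : ℝ) else 0)
        + ∑ u : α → Fin K, (if u p = k then (1 : ℝ) else 0) ≤ 2 * N := by
      refine le_of_mul_le_mul_left ?_ hK0
      nlinarith
    nlinarith
  · -- sequential hopping
    have hstep : ∀ u, hopStep A σ u p = some (finRotate K j) := hopStep_of_some A hpσ
    simp only [hstep, hopArm_of_some hpσ]
    simp only [hitPotential, Option.elim, val_sub_finRotate k (finRotate K j)]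
    by_cases hkj : k = finRotate K j
    · simp only [hkj, if_true, sub_self, and_true]
      have hz : ((0 : Fin K) : ℕ) = 0 := rfl
      rw [hz, pow_zero, mul_one]
      -- Without random hoppers there is no collision and the factor `3 / 2` does not occur;
      -- otherwise `h ≥ 1`.
      rcases Nat.eq_zero_or_pos (numRandom A σ) with h00 | h00
      · have hall : ∀ q ∈ A, σ q ≠ none := by
          intro q hq hn
          have : q ∈ A.filter (fun q => σ q = none) := Finset.mem_filter.2 ⟨hq, hn⟩
          rw [Finset.card_eq_zero.1 h00] at this
          simp at this
        have h000 : h = 0 := by rw [hh, h00]; simp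
        have h'0 : ∀ u, h' u = 0 := fun u => le_antisymm (h000 ▸ hle u) (h0' u)
        have : ∀ u, ¬ hopColl A σ u p := fun u => hσ u hall p hp
        simp only [this, if_false]
        change ∑ u, 1 * (1 + 2 * h' u * _) ≤ _
        simp [h'0, h000, hN]
      · have hh1 : 1 ≤ h := by rw [hh]; exact_mod_cast h00
        have hpK := one_sub_inv_pow_le_half hK
        have hKK : (1 - 1 / K : ℝ) ^ K = (1 - 1 / K) * (1 - 1 / K) ^ (K - 1) := by
          conv_lhs => rw [show K = (K - 1) + 1 by omega]
          rw [pow_succ]; push_cast [Nat.cast_pred (show 0 < K by omega)]; ring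
        set c := (1 - 1 / K : ℝ) ^ (K - 1) with hc
        have hc0 : 0 ≤ c := hpow0 _
        calc _ ≤ ∑ u, (3 / 2) * (1 + 2 * h' u * c) := by
              refine Finset.sum_le_sum fun u _ => ?_
              have : 0 ≤ h' u * c := mul_nonneg (h0' u) hc0
              split_ifs <;> nlinarith
          _ = (3 / 2) * (N + 2 * c * ∑ u, h' u) := by
              rw [← Finset.mul_sum, Finset.sum_add_distrib, hone, Finset.mul_sum]
              congr 2
              exact Finset.sum_congr rfl fun u _ => by ring
          _ ≤ (3 / 2) * (N + 2 * c * (N * ((1 - 1 / K) * h))) := by gcongr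
          _ = (3 / 2) * N * (1 + 2 * ((1 - 1 / K) * c) * h) := by ring
          _ ≤ (3 / 2) * N * (1 + 2 * (1 / 2) * h) := by
              rw [hKK] at hpK
              gcongr
          -- This is `(3 / 2) (1 + h) ≤ 1 + 2 h`, true because `h ≥ 1`.
          _ ≤ N * (1 + 2 * h) := by nlinarith
    · have hkj' : ¬ finRotate K j = k := fun hc => hkj hc.symm
      simp only [hkj, hkj', and_false, if_false, one_mul]
      have hd : ((k - finRotate K j : Fin K) : ℕ) ≠ 0 := by
        intro h0
        apply hkj
        have : k - finRotate K j = 0 := Fin.ext (by simpa using h0)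
        exact sub_eq_zero.1 this
      set m := ((k - finRotate K j : Fin K) : ℕ)
      change ∑ u, (1 + 2 * h' u * (1 - 1 / K : ℝ) ^ (m - 1)) ≤ _
      rw [Finset.sum_add_distrib, hone, ← Finset.sum_mul, ← Finset.mul_sum]
      -- The waiting time drops by one, which costs a factor `1 - 1 / K`; the mean decay of the
      -- random hoppers supplies it.
      calc _ ≤ N + 2 * (N * ((1 - 1 / K) * h)) * (1 - 1 / K : ℝ) ^ (m - 1) := by
            have := hpow0 (m - 1)
            gcongr
        _ = _ := by
            rw [show m = (m - 1) + 1 by omega, pow_succ]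
            simp
            ring

open Classical in
/-- Exponential moment of the number of collisions of one player on one arm. -/
theorem sum_pow_hopHits_le {A : ℕ → Finset α} (hA : Antitone A) (hAK : (A 0).card ≤ K)
    (hK : 2 ≤ K) (z : α → Fin K) (n : ℕ) {p : α} (hp : ∀ s < n, p ∈ A s) (k : Fin K) :
    ∑ d : Fin n → α → Fin K, (3 / 2 : ℝ) ^ (hopHits A (extendSeq z d) p k n).card
      ≤ (Fintype.card (α → Fin K) : ℝ) ^ n * (2 * (1 + 2 * K)) := by
  have h2 : (2 : ℝ) ≤ K := by exact_mod_cast hK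
  have hν : (0 : ℝ) ≤ 1 - 1 / K := by
    rw [sub_nonneg, div_le_one (by linarith)]; linarith
  -- The potential can be dropped at the end because it is at least `1`; at the start it is at most
  -- `2 (1 + 2 K)`.
  have hge : ∀ (o : Option (Fin K)) (h : ℕ), 1 ≤ hitPotential k o h := by
    intro o h
    have h0 : (0 : ℝ) ≤ h := Nat.cast_nonneg _
    rcases o with _ | j <;> simp only [hitPotential, Option.elim]
    · nlinarith
    · have := mul_nonneg h0 (pow_nonneg hν ((k - finRotate K j : Fin K) : ℕ))
      nlinarith
  have key := sum_extendSeq_le z (fun s d => (3 / 2 : ℝ) ^ (hopHits A d p k s).card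
    * hitPotential k (hop A d s p) (numRandom (A s) (hop A d s))) n ?_
  · refine (Finset.sum_le_sum fun d _ => ?_).trans (key.trans ?_)
    · exact le_mul_of_one_le_right (by positivity) (hge _ _)
    · refine mul_le_mul_of_nonneg_left ?_ (by positivity)
      have h1 : (numRandom (A 0) (hop A (fun _ => z) 0) : ℝ) ≤ K := by
        exact_mod_cast (Finset.card_filter_le _ _).trans hAK
      simp only [hopHits, Finset.range_zero, Finset.filter_empty, Finset.card_empty, pow_zero,
        one_mul, hop, hitPotential, Option.elim] at h1 ⊢
      linarith
  · intro s hs d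
    have hhits : ∀ u : α → Fin K, (hopHits A (Function.update d s u) p k (s + 1)).card
        = (hopHits A d p k s).card
          + if hopColl (A s) (hop A d s) u p ∧ hopArm (hop A d s) u p = k then 1 else 0 := by
      intro u
      unfold hopHits
      rw [Finset.range_add_one, Finset.filter_insert]
      have hf : (Finset.range s).filter (fun i => hopColl (A i) (hop A (Function.update d s u) i)
            (Function.update d s u i) p ∧ hopArm (hop A (Function.update d s u) i)
            (Function.update d s u i) p = k)
          = (Finset.range s).filter (fun i => hopColl (A i) (hop A d i) (d i) p
            ∧ hopArm (hop A d i) (d i) p = k) := by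
        refine Finset.filter_congr fun i hi => ?_
        rw [Finset.mem_range] at hi
        rw [hop_update A d s u hi.le, Function.update_of_ne hi.ne]
      rw [hf, hop_update A d s u le_rfl, Function.update_self]
      split_ifs with hc
      · rw [Finset.card_insert_of_notMem (by simp)]
      · rfl
    have hstep := hitPotential_step (hA (Nat.le_succ s))
      ((Finset.card_le_card (hA (Nat.zero_le s))).trans hAK) hK
      (σ := hop A d s) (fun u hall q hq => not_hopColl hA d s hall hq u) (hp s hs) k
    calc _ = (3 / 2 : ℝ) ^ (hopHits A d p k s).card * ∑ u : α → Fin K,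
          (if hopColl (A s) (hop A d s) u p ∧ hopArm (hop A d s) u p = k then (3 / 2 : ℝ) else 1)
          * hitPotential k (hopStep (A s) (hop A d s) u p)
            (numRandom (A (s + 1)) (hopStep (A s) (hop A d s) u)) := by
          rw [Finset.mul_sum]
          refine Finset.sum_congr rfl fun u _ => ?_
          simp only [hop, hop_update A d s _ le_rfl, Function.update_self]
          rw [hhits u, pow_add, mul_assoc]
          congr 2
          split_ifs <;> simp
      _ ≤ (3 / 2 : ℝ) ^ (hopHits A d p k s).card * (Fintype.card (α → Fin K)
            * hitPotential k (hop A d s p) (numRandom (A s) (hop A d s))) := by gcongr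
      _ = _ := by ring

end HoppingMoment
end DynTrek
end

noncomputable section
namespace DynTrek

/-! ### Transfer to the probability space, and concentration of the rewards -/

section Transfer

lemma pi_uniformOn_singleton {I : Type*} [Fintype I] {K : ℕ} (hK : 0 < K) (d : I → Fin K) :
    (Measure.pi fun _ : I => uniformOn (Set.univ : Set (Fin K))) {d}
      = ENNReal.ofReal (1 / (K : ℝ) ^ Fintype.card I) := by
  have : Nonempty (Fin K) := ⟨⟨0, hK⟩⟩
  have h1 : ∀ k : Fin K, uniformOn (Set.univ : Set (Fin K)) {k} = ENNReal.ofReal (1 / K) := by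
    intro k
    rw [uniformOn_univ, Measure.count_singleton, Fintype.card_fin, one_div, one_div,
      ENNReal.ofReal_inv_of_pos (by exact_mod_cast hK), ENNReal.ofReal_natCast]
  rw [← Set.univ_pi_singleton, Measure.pi_pi]
  simp only [h1]
  rw [Finset.prod_const, Finset.card_univ, ← ENNReal.ofReal_pow (by positivity), one_div_pow]

variable {Ω : Type*} [MeasurableSpace Ω] {P : Measure Ω} [IsProbabilityMeasure P]
  {ι : Type*} {K : ℕ} {ν : Fin K → Measure ℝ} [∀ k, IsProbabilityMeasure (ν k)]
  {ξ : ι → ℕ → Ω → Fin K × (Fin K → ℝ)}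

/-- A family of reward events indexed by the draws: its probability is at most the average over
the draws of the probabilities of the reward events. -/
theorem measure_draws_rewards_le (hK : 0 < K) (hξm : ∀ p t, Measurable (ξ p t))
    (hξlaw : ∀ p t, P.map (ξ p t) = roundLaw ν)
    (hξind : iIndepFun (fun i : ι × ℕ => ξ i.1 i.2) P)
    {α : Type*} [Fintype α] [DecidableEq α] (f : α → ι) (hf : f.Injective) (t₀ n : ℕ)
    (F : (Fin n → α → Fin K) → Set (Fin n × α → Fin K → ℝ)) (g : (Fin n → α → Fin K) → ℝ)
    (hg0 : ∀ d, 0 ≤ g d)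
    (hg : ∀ d, (Measure.pi fun _ : Fin n × α => Measure.pi ν) (F d) ≤ ENNReal.ofReal (g d))
    {c : ℝ} (hc : ∑ d, g d ≤ (Fintype.card (α → Fin K) : ℝ) ^ n * c) :
    P {ω | (fun i : Fin n × α => (ξ (f i.2) (t₀ + i.1) ω).2)
        ∈ F fun s q => (ξ (f q) (t₀ + s) ω).1} ≤ ENNReal.ofReal c := by
  have : Nonempty (Fin K) := ⟨⟨0, hK⟩⟩
  have : IsProbabilityMeasure (uniformOn (Set.univ : Set (Fin K))) :=
    isProbabilityMeasure_uniformOn Set.finite_univ Set.univ_nonempty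
  set X : Fin n × α → Ω → Fin K × (Fin K → ℝ) := fun i => ξ (f i.2) (t₀ + i.1) with hX
  have hXm : Measurable fun ω i => X i ω := measurable_pi_iff.2 fun i => hξm _ _
  have hind : iIndepFun X P := by
    refine hξind.precomp (g := fun i : Fin n × α => (f i.2, t₀ + (i.1 : ℕ))) ?_
    rintro ⟨s, p⟩ ⟨s', p'⟩ h
    simp only [Prod.mk.injEq] at h
    exact Prod.ext (Fin.ext (by have := h.2; simpa using this)) (hf h.1)
  have hmap : P.map (fun ω i => X i ω) = Measure.pi fun _ : Fin n × α => roundLaw ν := by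
    rw [(iIndepFun_iff_map_fun_eq_pi_map fun i => (hξm _ _).aemeasurable).1 hind]
    congr 1
    funext i
    exact hξlaw _ _
  have hmp := measurePreserving_arrowProdEquivProdArrow (Fin K) (Fin K → ℝ) (Fin n × α)
    (fun _ => uniformOn (Set.univ : Set (Fin K))) (fun _ => Measure.pi ν)
  -- The event is cut into slices, one for each value of the draws; on a slice only the rewards are
  -- random.
  set S : Set ((Fin n × α → Fin K) × (Fin n × α → Fin K → ℝ)) :=
    ⋃ d : Fin n × α → Fin K, {d} ×ˢ F (Function.curry d) with hS
  have hsub : {ω | (fun i : Fin n × α => (ξ (f i.2) (t₀ + i.1) ω).2)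
        ∈ F fun s q => (ξ (f q) (t₀ + s) ω).1}
      ⊆ (fun ω => MeasurableEquiv.arrowProdEquivProdArrow (Fin K) (Fin K → ℝ) (Fin n × α)
          (fun i => X i ω)) ⁻¹' S := by
    intro ω hω
    simp only [hS, Set.preimage_iUnion, Set.mem_iUnion]
    exact ⟨fun i => (X i ω).1, rfl, hω⟩
  have hlaw : P.map (fun ω => MeasurableEquiv.arrowProdEquivProdArrow (Fin K) (Fin K → ℝ)
        (Fin n × α) (fun i => X i ω))
      = (Measure.pi fun _ : Fin n × α => uniformOn (Set.univ : Set (Fin K))).prod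
        (Measure.pi fun _ : Fin n × α => Measure.pi ν) := by
    rw [← hmp.map_eq]
    change _ = Measure.map _ (Measure.pi fun _ : Fin n × α => roundLaw ν)
    rw [← hmap, Measure.map_map (MeasurableEquiv.measurable _) hXm]
    rfl
  have hcardI : (Fintype.card (α → Fin K) : ℝ) ^ n = (K : ℝ) ^ Fintype.card (Fin n × α) := by
    rw [Fintype.card_fun, Fintype.card_prod, Fintype.card_fin, Fintype.card_fin]
    push_cast
    rw [← pow_mul, mul_comm]
  have hKpos : (0 : ℝ) < (K : ℝ) ^ Fintype.card (Fin n × α) := by positivity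
  calc _ ≤ P ((fun ω => MeasurableEquiv.arrowProdEquivProdArrow (Fin K) (Fin K → ℝ) (Fin n × α)
          (fun i => X i ω)) ⁻¹' S) := measure_mono hsub
    -- This inequality holds for all sets, so `F` need not be measurable.
    _ ≤ _ := Measure.le_map_apply ((MeasurableEquiv.measurable _).comp hXm).aemeasurable S
    _ ≤ ∑ d : Fin n × α → Fin K, ((Measure.pi fun _ : Fin n × α =>
          uniformOn (Set.univ : Set (Fin K))).prod (Measure.pi fun _ : Fin n × α => Measure.pi ν))
          ({d} ×ˢ F (Function.curry d)) := by
        have h2 := measure_iUnion_fintype_le ((Measure.pi fun _ : Fin n × α =>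
          uniformOn (Set.univ : Set (Fin K))).prod (Measure.pi fun _ : Fin n × α => Measure.pi ν))
          fun d : Fin n × α → Fin K => {d} ×ˢ F (Function.curry d)
        rw [← hlaw] at h2 ⊢
        exact h2
    _ ≤ ∑ d : Fin n × α → Fin K, ENNReal.ofReal
          (1 / (K : ℝ) ^ Fintype.card (Fin n × α) * g (Function.curry d)) := by
        refine Finset.sum_le_sum fun d _ => ?_
        rw [Measure.prod_prod, pi_uniformOn_singleton hK, ENNReal.ofReal_mul (by positivity)]
        gcongr
        exact hg _
    _ = ENNReal.ofReal (∑ d : Fin n × α → Fin K,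
          1 / (K : ℝ) ^ Fintype.card (Fin n × α) * g (Function.curry d)) := by
        rw [ENNReal.ofReal_sum_of_nonneg fun d _ => mul_nonneg (by positivity) (hg0 _)]
    _ ≤ ENNReal.ofReal c := by
        refine ENNReal.ofReal_le_ofReal ?_
        rw [← Finset.mul_sum]
        have : ∑ d : Fin n × α → Fin K, g (Function.curry d) = ∑ d, g d :=
          Equiv.sum_comp (Equiv.curry (Fin n) α (Fin K)) g
        rw [this, one_div, inv_mul_le_iff₀ hKpos, ← hcardI]
        exact hc

variable {μ : Fin K → ℝ}

lemma ae_reward_mem_Icc (hν : ∀ k, ∀ᵐ r ∂(ν k), r ∈ Set.Icc (0 : ℝ) 1) {I : Type*} [Fintype I] :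
    ∀ᵐ r ∂(Measure.pi fun _ : I => Measure.pi ν), ∀ i k, r i k ∈ Set.Icc (0 : ℝ) 1 := by
  rw [ae_all_iff]; intro i
  rw [ae_all_iff]; intro k
  have h1 : ∀ᵐ r ∂(Measure.pi ν), r k ∈ Set.Icc (0 : ℝ) 1 :=
    (Measure.quasiMeasurePreserving_eval ν k).ae (hν k)
  exact (Measure.quasiMeasurePreserving_eval (fun _ : I => Measure.pi ν) i).ae h1

/-- Hoeffding's inequality for a weighted sum of rewards, one from each of finitely many rounds. -/
theorem measure_weighted_rewards_le (hν : ∀ k, ∀ᵐ r ∂(ν k), r ∈ Set.Icc (0 : ℝ) 1)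
    (hμ : ∀ k, μ k = ∫ r, r ∂(ν k)) {n : ℕ} {α : Type*} [Fintype α] (p : α) (a : Fin n → Fin K)
    (w : Fin n → ℝ) {m D : ℝ} (hm : 0 < m) (hD : 0 ≤ D) (hw0 : 0 < ∑ s, w s ^ 2)
    (hw : ∑ s, w s ^ 2 ≤ 2 / m) :
    (Measure.pi fun _ : Fin n × α => Measure.pi ν)
        {r | D ≤ ∑ s, w s * (r (s, p) (a s) - μ (a s))}
      ≤ ENNReal.ofReal (Real.exp (-m * D ^ 2)) := by
  set R := Measure.pi fun _ : Fin n × α => Measure.pi ν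
  have hind0 : iIndepFun (fun (i : Fin n × α) (r : Fin n × α → Fin K → ℝ) =>
      (fun x : Fin K → ℝ => w i.1 * (x (a i.1) - μ (a i.1))) (r i)) R :=
    iIndepFun_pi (X := fun (i : Fin n × α) (x : Fin K → ℝ) => w i.1 * (x (a i.1) - μ (a i.1)))
      fun i => (((measurable_pi_apply _).sub_const _).const_mul _).aemeasurable
  have hind : iIndepFun (fun (s : Fin n) (r : Fin n × α → Fin K → ℝ) =>
      w s * (r (s, p) (a s) - μ (a s))) R :=
    hind0.precomp (g := fun s : Fin n => (s, p)) fun s s' h => by simpa using h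
  -- A reward in `[0, 1]` is sub-Gaussian with parameter `1 / 4`; the weight multiplies it by `w s ^
  -- 2`.
  have hsub : ∀ s : Fin n, HasSubgaussianMGF (fun r : Fin n × α → Fin K → ℝ =>
      w s * (r (s, p) (a s) - μ (a s))) (⟨w s ^ 2, sq_nonneg _⟩ * (‖(1 : ℝ) - 0‖₊ / 2) ^ 2) R := by
    intro s
    have h1 := hasSubgaussianMGF_of_mem_Icc (μ := R)
      (X := fun r : Fin n × α → Fin K → ℝ => r (s, p) (a s)) (a := 0) (b := 1)
      ((measurable_pi_apply _).comp (measurable_pi_apply _)).aemeasurable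
      ((ae_reward_mem_Icc hν).mono fun r hr => hr _ _)
    have h2 : ∫ r : Fin n × α → Fin K → ℝ, r (s, p) (a s) ∂(R) = μ (a s) := by
      rw [hμ]
      have e1 : ∫ r : Fin n × α → Fin K → ℝ, r (s, p) (a s) ∂(R) = ∫ x, x (a s) ∂(Measure.pi ν) :=
        integral_comp_eval (μ := fun _ : Fin n × α => Measure.pi ν) (i := (s, p))
          (f := fun x : Fin K → ℝ => x (a s)) (measurable_pi_apply _).aestronglyMeasurable
      rw [e1]
      exact integral_comp_eval (μ := ν) (i := a s) (f := fun x : ℝ => x) (by fun_prop)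
    rw [h2] at h1
    exact h1.const_mul (w s)
  have key := HasSubgaussianMGF.measure_sum_ge_le_of_iIndepFun hind (s := Finset.univ)
    (fun s _ => hsub s) hD
  rw [← ofReal_measureReal]
  refine ENNReal.ofReal_le_ofReal (key.trans (Real.exp_le_exp.2 ?_))
  have hv : ((∑ s : Fin n, (⟨w s ^ 2, sq_nonneg _⟩ * (‖(1 : ℝ) - 0‖₊ / 2) ^ 2 : NNReal) : NNReal) : ℝ)
      = (∑ s, w s ^ 2) / 4 := by
    push_cast
    rw [Finset.sum_div]
    refine Finset.sum_congr rfl fun s _ => ?_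
    change w s ^ 2 * _ = _
    simp
    ring
  rw [hv, neg_div, neg_mul, neg_le_neg_iff, le_div_iff₀ (by positivity)]
  rw [le_div_iff₀ hm] at hw
  nlinarith [mul_le_mul_of_nonneg_left hw (sq_nonneg D)]

end Transfer
end DynTrek
end

noncomputable section
namespace DynTrek

/-! ### Estimated means after the hopping process -/

section Estimates

variable {α : Type*} {K : ℕ}

/-- Arm played by `p` in round `s` of the hopping process. -/
def hopPlay (A : ℕ → Finset α) (d : ℕ → α → Fin K) (p : α) (s : ℕ) : Fin K :=
  hopArm (hop A d s) (d s) p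

/-- Number of plays of arm `k` by `p` before round `n`. -/
def hopCount (A : ℕ → Finset α) (d : ℕ → α → Fin K) (p : α) (k : Fin K) (n : ℕ) : ℕ :=
  ((Finset.range n).filter fun s => hopPlay A d p s = k).card

open Classical in
/-- Sum of the rewards `x` from the collision-free plays of arm `k` by `p` before round `n`. -/
def hopSum (A : ℕ → Finset α) (d : ℕ → α → Fin K) (p : α) (x : ℕ → Fin K → ℝ) (k : Fin K)
    (n : ℕ) : ℝ :=
  ∑ s ∈ Finset.range n,
    if hopPlay A d p s = k ∧ ¬ hopColl (A s) (hop A d s) (d s) p then x s k else 0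

lemma hopPlay_congr (A : ℕ → Finset α) {d d' : ℕ → α → Fin K} {n : ℕ} (h : ∀ i < n, d i = d' i)
    (p : α) {s : ℕ} (hs : s < n) : hopPlay A d p s = hopPlay A d' p s := by
  unfold hopPlay
  rw [hop_congr A (s := s) fun i hi => h i (by omega), h s hs]

lemma hopCount_congr (A : ℕ → Finset α) {d d' : ℕ → α → Fin K} {n : ℕ} (h : ∀ i < n, d i = d' i)
    (p : α) (k : Fin K) : hopCount A d p k n = hopCount A d' p k n := by
  unfold hopCount
  refine congrArg _ (Finset.filter_congr fun s hs => ?_)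
  rw [hopPlay_congr A h p (Finset.mem_range.1 hs)]

lemma hopSum_congr (A : ℕ → Finset α) {d d' : ℕ → α → Fin K} {n : ℕ} (h : ∀ i < n, d i = d' i)
    (p : α) {x x' : ℕ → Fin K → ℝ} (k : Fin K) (hx : ∀ s < n, x s k = x' s k) :
    hopSum A d p x k n = hopSum A d' p x' k n := by
  unfold hopSum
  refine Finset.sum_congr rfl fun s hs => ?_
  have hs := Finset.mem_range.1 hs
  rw [hopPlay_congr A h p hs, hop_congr A (s := s) fun i hi => h i (by omega), h s hs, hx s hs]

/-- A player who hops sequentially moves to the next arm. -/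
lemma hopPlay_add (A : ℕ → Finset α) (d : ℕ → α → Fin K) (p : α) {s : ℕ}
    (h : hop A d s p ≠ none) [NeZero K] (j : ℕ) :
    hopPlay A d p (s + j) = hopPlay A d p s + Fin.ofNat K j := by
  induction j with
  | zero => simp
  | succ j ih =>
    have h1 : hop A d (s + j) p ≠ none := hop_ne_none_of_le A d (Nat.le_add_right s j) h
    obtain ⟨a, ha⟩ := Option.ne_none_iff_exists'.1 h1
    have h2 : hop A d (s + j + 1) p = some (finRotate K a) := hopStep_of_some _ ha _
    have h3 : hopPlay A d p (s + j + 1) = finRotate K (hopPlay A d p (s + j)) := by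
      unfold hopPlay
      rw [hopArm_of_some h2, hopArm_of_some ha]
    rw [← add_assoc, h3, ih, finRotate_apply, add_assoc]
    congr 1
    ext
    simp [Fin.val_add]

/-- Sequential hopping plays every arm once in `K` rounds: lower bound on the number of plays. -/
lemma add_card_hopHits_le_hopCount {A : ℕ → Finset α} (hA : Antitone A) (d : ℕ → α → Fin K)
    [NeZero K] {H n : ℕ} (hsettled : ∀ q ∈ A H, hop A d H q ≠ none) {p : α}
    (hp : ∀ s < n, p ∈ A s) (hHn : H < n) (k : Fin K) :
    (n - H) / K + (hopHits A d p k n).card ≤ hopCount A d p k n := by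
  classical
  have hK : 0 < K := Nat.pos_of_ne_zero (NeZero.ne K)
  have hsp := hsettled p (hp H hHn)
  -- `v i` is the round of the `i`-th block of `K` rounds after `H` in which arm `k` is played.
  set v : ℕ → ℕ := fun i => H + i * K + ((k - hopPlay A d p (H + i * K) : Fin K) : ℕ) with hv
  have hvK : ∀ i, ((k - hopPlay A d p (H + i * K) : Fin K) : ℕ) < K := fun i => Fin.isLt _
  have hvplay : ∀ i, hopPlay A d p (v i) = k := by
    intro i
    rw [hv]
    simp only
    rw [hopPlay_add A d p (hop_ne_none_of_le A d (Nat.le_add_right H (i * K)) hsp)]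
    simp
  have hvinj : Function.Injective v := by
    intro i j hij
    simp only [hv] at hij
    have h1 := hvK i
    have h2 := hvK j
    rcases lt_trichotomy i j with h | h | h
    · have : (i + 1) * K ≤ j * K := Nat.mul_le_mul_right _ h
      rw [add_mul] at this; omega
    · exact h
    · have : (j + 1) * K ≤ i * K := Nat.mul_le_mul_right _ h
      rw [add_mul] at this; omega
  have hcard : ((Finset.range ((n - H) / K)).image v).card = (n - H) / K := by
    rw [Finset.card_image_of_injective _ hvinj, Finset.card_range]
  rw [← hcard, ← Finset.card_union_of_disjoint]
  · refine Finset.card_le_card fun s hs => ?_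
    rcases Finset.mem_union.1 hs with hs | hs
    · obtain ⟨i, hi, rfl⟩ := Finset.mem_image.1 hs
      rw [Finset.mem_filter, Finset.mem_range]
      refine ⟨?_, hvplay i⟩
      have h1 : (i + 1) * K ≤ (n - H) / K * K :=
        Nat.mul_le_mul_right _ (Finset.mem_range.1 hi)
      have h2 := Nat.div_mul_le_self (n - H) K
      have h3 := hvK i
      rw [add_mul] at h1
      simp only [hv]
      omega
    · unfold hopHits at hs
      simp only [Finset.mem_filter] at hs ⊢
      exact ⟨hs.1, hs.2.2⟩
  · rw [Finset.disjoint_left]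
    rintro s hs hs'
    obtain ⟨i, hi, rfl⟩ := Finset.mem_image.1 hs
    unfold hopHits at hs'
    simp only [Finset.mem_filter, Finset.mem_range] at hs'
    have hHv : H ≤ v i := by simp only [hv]; omega
    -- The rounds `v i` come after settling and are free of collisions, so the collisions on `k` are
    -- additional plays.
    exact not_hopColl hA d (v i) (fun q hq => hop_ne_none_of_le A d hHv
      (hsettled q (hA hHv hq))) (hp _ hs'.1) _ hs'.2.1

end Estimates

/-- Equivalent to `e² ≤ (3 / 2) ^ 5`. -/
lemma two_fifths_le_log_three_halves : (2 / 5 : ℝ) ≤ Real.log (3 / 2) := by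
  rw [Real.le_log_iff_exp_le (by norm_num)]
  have h1 : Real.exp (2 / 5) ^ 5 = Real.exp 1 ^ 2 := by
    rw [← Real.exp_nat_mul, ← Real.exp_nat_mul]; norm_num
  have h2 := Real.exp_one_lt_d9
  have h3 : Real.exp (2 / 5) ^ 5 ≤ (3 / 2) ^ 5 := by
    rw [h1]
    have h4 := Real.exp_pos 1
    nlinarith
  exact le_of_pow_le_pow_left₀ (by norm_num) (by norm_num) h3

/-- The loss in the exponent that is due to `c` collisions is made up for by the rarity of
collisions. -/
lemma exp_deviation_le {m c ε : ℝ} (hm : 0 < m) (hc : 0 ≤ c) (hε : 0 < ε) :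
    (c / (m + c) ≤ ε → Real.exp (-m * (ε - c / (m + c)) ^ 2)
        ≤ Real.exp (-(8 / 13) * m * ε ^ 2) * Real.exp (c * Real.log (3 / 2)))
    ∧ (ε ≤ c / (m + c) →
        1 ≤ Real.exp (-(8 / 13) * m * ε ^ 2) * Real.exp (c * Real.log (3 / 2))) := by
  have hlog := two_fifths_le_log_three_halves
  have hmc : 0 < m + c := by linarith
  set u := c / (m + c) with hu
  have hu0 : 0 ≤ u := by positivity
  -- From `4 m c ≤ (m + c)²`.
  have huc : 4 * m * u ^ 2 ≤ c := by
    rw [hu, div_pow, mul_div_assoc', div_le_iff₀ (by positivity)]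
    nlinarith [mul_nonneg hc (sq_nonneg (m - c))]
  have hcl : c * (2 / 5) ≤ c * Real.log (3 / 2) := mul_le_mul_of_nonneg_left hlog hc
  rw [← Real.exp_add]
  constructor
  · intro _
    rw [Real.exp_le_exp]
    -- Now `c log (3 / 2) ≥ (8 / 5) m u²`, and `8 / 13` is the minimum of `(1 - y)² + (8 / 5) y²`,
    -- attained where `5 (1 - y) = 8 y`; hence this square.
    nlinarith [mul_nonneg hm.le (sq_nonneg (5 * (ε - u) - 8 * u))]
  · intro h
    rw [Real.one_le_exp_iff]
    have h1 : ε ^ 2 ≤ u ^ 2 := by gcongr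
    nlinarith [mul_le_mul_of_nonneg_left h1 hm.le]

section EstimateProbability

variable {Ω : Type*} [MeasurableSpace Ω] {P : Measure Ω} [IsProbabilityMeasure P]
  {ι : Type*} {K : ℕ} {ν : Fin K → Measure ℝ} [∀ k, IsProbabilityMeasure (ν k)]
  {μ : Fin K → ℝ} {ξ : ι → ℕ → Ω → Fin K × (Fin K → ℝ)}

open Classical in
/-- For given draws: probability that two arms are ranked wrongly. -/
lemma measure_hopSum_le (hν : ∀ k, ∀ᵐ r ∂(ν k), r ∈ Set.Icc (0 : ℝ) 1)
    (hμ : ∀ k, μ k = ∫ r, r ∂(ν k)) {α : Type*} [Fintype α] (A : ℕ → Finset α)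
    (d : ℕ → α → Fin K) (p : α) (n m : ℕ) (hm : 0 < m) {ε : ℝ} (hε : 0 < ε) {k₁ k₂ : Fin K}
    (hk : ε ≤ μ k₁ - μ k₂) (h1 : m + (hopHits A d p k₁ n).card ≤ hopCount A d p k₁ n)
    (h2 : m ≤ hopCount A d p k₂ n) :
    (Measure.pi fun _ : Fin n × α => Measure.pi ν)
      {r | hopSum A d p (fun s k => if h : s < n then r (⟨s, h⟩, p) k else 0) k₁ n
          / hopCount A d p k₁ n
        ≤ hopSum A d p (fun s k => if h : s < n then r (⟨s, h⟩, p) k else 0) k₂ n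
          / hopCount A d p k₂ n}
      ≤ ENNReal.ofReal (Real.exp (-(8 / 13) * m * ε ^ 2)
        * (3 / 2) ^ (hopHits A d p k₁ n).card) := by
  set c : ℕ := (hopHits A d p k₁ n).card with hc
  set S₁ : ℕ := hopCount A d p k₁ n with hS₁
  set S₂ : ℕ := hopCount A d p k₂ n with hS₂
  have hm' : (0 : ℝ) < m := by exact_mod_cast hm
  have hpow : Real.exp (c * Real.log (3 / 2)) = (3 / 2) ^ c := by
    rw [Real.exp_nat_mul, Real.exp_log (by norm_num)]
  obtain ⟨hdev1, hdev2⟩ := exp_deviation_le hm' (Nat.cast_nonneg c) hε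
  rw [hpow] at hdev1 hdev2
  -- If the collisions can eat up the whole gap, the claimed bound is at least `1`.
  rcases le_total ε ((c : ℝ) / (m + c)) with hcase | hcase
  · refine prob_le_one.trans ?_
    rw [← ENNReal.ofReal_one]
    exact ENNReal.ofReal_le_ofReal (hdev2 hcase)
  have hne : k₁ ≠ k₂ := by rintro rfl; rw [sub_self] at hk; linarith
  have hS1m : (m : ℝ) + c ≤ S₁ := by exact_mod_cast h1
  have hS2m : (m : ℝ) ≤ S₂ := by exact_mod_cast h2
  have hc0 : (0 : ℝ) ≤ c := Nat.cast_nonneg c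
  have hS1 : (0 : ℝ) < S₁ := by linarith
  have hS2 : (0 : ℝ) < S₂ := by linarith
  set a : Fin n → Fin K := fun s => hopPlay A d p s with ha
  -- With these weights the sum in Hoeffding's inequality is the error of the difference of the two
  -- empirical means.
  set w : Fin n → ℝ := fun s => if a s = k₂ then 1 / S₂ else if a s = k₁ then -(1 / S₁) else 0
    with hw
  have hcount : ∀ k, ∑ s : Fin n, (if a s = k then (1 : ℝ) else 0) = hopCount A d p k n := by
    intro k
    rw [Fin.sum_univ_eq_sum_range (fun s => if hopPlay A d p s = k then (1 : ℝ) else 0),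
      ← Finset.sum_filter, Finset.sum_const, nsmul_eq_mul, mul_one, hopCount]
  have hw2 : ∑ s, w s ^ 2 = 1 / S₂ + 1 / S₁ := by
    have : ∀ s, w s ^ 2 = (1 / S₂) ^ 2 * (if a s = k₂ then (1 : ℝ) else 0)
        + (1 / S₁) ^ 2 * (if a s = k₁ then (1 : ℝ) else 0) := by
      intro s
      simp only [hw]
      by_cases h2 : a s = k₂
      · have : a s ≠ k₁ := fun h => hne (h.symm.trans h2)
        simp [h2, hne.symm]
      · by_cases h1 : a s = k₁ <;> simp [h1, h2, hne]
    rw [Finset.sum_congr rfl fun s _ => this s, Finset.sum_add_distrib, ← Finset.mul_sum,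
      ← Finset.mul_sum, hcount, hcount, ← hS₁, ← hS₂]
    field_simp
  have hmono : ∀ y : ℝ, (m : ℝ) ≤ y → 1 / y ≤ 1 / m := fun y hy =>
    one_div_le_one_div_of_le hm' hy
  have hwpos : 0 < ∑ s, w s ^ 2 := by rw [hw2]; positivity
  have hwle : ∑ s, w s ^ 2 ≤ 2 / m := by
    rw [hw2, show (2 : ℝ) / m = 1 / m + 1 / m by ring]
    exact add_le_add (hmono _ hS2m) (hmono _ (by linarith))
  have key := measure_weighted_rewards_le hν hμ p a w hm' (sub_nonneg.2 hcase) hwpos hwle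
  refine (measure_mono_ae ?_).trans (key.trans (ENNReal.ofReal_le_ofReal (hdev1 hcase)))
  filter_upwards [ae_reward_mem_Icc (ν := ν) hν (I := Fin n × α)] with r hr hmem
  change _ ≤ _ at hmem
  change _ ≤ _
  set V : Fin K → ℝ := fun k => hopSum A d p (fun s k => if h : s < n then r (⟨s, h⟩, p) k else 0) k n
    with hV
  -- `W` also counts the rewards missed in collisions, so Hoeffding's inequality applies to it.
  -- Rewards missed on the worse arm `k₂` only help; on `k₁` at most `c` are missed.
  set W : Fin K → ℝ := fun k => ∑ s : Fin n, if a s = k then r (s, p) k else 0 with hW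
  have hVeq : ∀ k, V k = ∑ s : Fin n,
      if a s = k ∧ ¬ hopColl (A s) (hop A d s) (d s) p then r (s, p) k else 0 := by
    intro k
    simp only [hV, hopSum]
    rw [Finset.sum_range]
    refine Finset.sum_congr rfl fun s _ => ?_
    simp [ha]
  have hVW2 : V k₂ ≤ W k₂ := by
    rw [hVeq]
    refine Finset.sum_le_sum fun s _ => ?_
    have := (hr (s, p) k₂).1
    split_ifs with h1 h2 h2
    · exact le_rfl
    · exact absurd h1.1 h2
    · exact this
    · exact le_rfl
  have hVW1 : W k₁ ≤ V k₁ + c := by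
    have hcc : (c : ℝ) = ∑ s : Fin n,
        if hopColl (A s) (hop A d s) (d s) p ∧ a s = k₁ then (1 : ℝ) else 0 := by
      rw [Fin.sum_univ_eq_sum_range (fun s => if hopColl (A s) (hop A d s) (d s) p
        ∧ hopPlay A d p s = k₁ then (1 : ℝ) else 0), ← Finset.sum_filter, Finset.sum_const,
        nsmul_eq_mul, mul_one, hc]
      rfl
    rw [hVeq, hcc, ← Finset.sum_add_distrib]
    refine Finset.sum_le_sum fun s _ => ?_
    have := (hr (s, p) k₁).2
    by_cases h1 : a s = k₁ <;> by_cases h2 : hopColl (A s) (hop A d s) (d s) p <;>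
      simp [h1, h2, this]
  have hZ : ∑ s, w s * (r (s, p) (a s) - μ (a s))
      = (W k₂ / S₂ - μ k₂) - (W k₁ / S₁ - μ k₁) := by
    have hterm : ∀ s, w s * (r (s, p) (a s) - μ (a s))
        = (1 / S₂) * (if a s = k₂ then r (s, p) k₂ else 0)
          - (1 / S₂) * μ k₂ * (if a s = k₂ then (1 : ℝ) else 0)
          - ((1 / S₁) * (if a s = k₁ then r (s, p) k₁ else 0)
          - (1 / S₁) * μ k₁ * (if a s = k₁ then (1 : ℝ) else 0)) := by
      intro s
      simp only [hw]
      by_cases h2 : a s = k₂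
      · simp [h2, hne.symm]; ring
      · by_cases h1 : a s = k₁
        · simp [h1, hne]; ring
        · simp [h1, h2]
    rw [Finset.sum_congr rfl fun s _ => hterm s, Finset.sum_sub_distrib, Finset.sum_sub_distrib,
      Finset.sum_sub_distrib, ← Finset.mul_sum, ← Finset.mul_sum, ← Finset.mul_sum,
      ← Finset.mul_sum, hcount, hcount, ← hS₁, ← hS₂]
    simp only [hW]
    field_simp
  rw [hZ]
  -- The colliding plays themselves are among the plays of `k₁`: `S₁ ≥ m + c`.
  have e1 : W k₁ / S₁ ≤ V k₁ / S₁ + c / (m + c) := by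
    calc W k₁ / S₁ ≤ (V k₁ + c) / S₁ := by gcongr
      _ = V k₁ / S₁ + c / S₁ := add_div _ _ _
      _ ≤ _ := by gcongr
  have e2 : V k₂ / S₂ ≤ W k₂ / S₂ := by gcongr
  have hmem' : V k₁ / S₁ ≤ V k₂ / S₂ := hmem
  linarith

/-- Probability that somebody hops randomly after `H` rounds. -/
theorem measure_exists_random_le (hK : 0 < K) (hξm : ∀ p t, Measurable (ξ p t))
    (hξlaw : ∀ p t, P.map (ξ p t) = roundLaw ν)
    (hξind : iIndepFun (fun i : ι × ℕ => ξ i.1 i.2) P)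
    {α : Type*} [Fintype α] [DecidableEq α] (f : α → ι) (hf : f.Injective) (t₀ H : ℕ)
    {A : ℕ → Finset α} (hA : Antitone A) (hAK : (A 0).card ≤ K) :
    P {ω | ∃ q ∈ A H, hop A (fun s q => (ξ (f q) (t₀ + s) ω).1) H q = none}
      ≤ ENNReal.ofReal (K * (1 - 1 / K) ^ H) := by
  classical
  have key := measure_draws_rewards_le hK hξm hξlaw hξind f hf t₀ H
    (fun d => {_r | ∃ q ∈ A H, hop A (extendSeq (fun _ => ⟨0, hK⟩) d) H q = none})
    (fun d => (numRandom (A H) (hop A (extendSeq (fun _ => ⟨0, hK⟩) d) H) : ℝ))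
    (fun d => Nat.cast_nonneg _) ?_
    (sum_numRandom_hop_le hA hAK hK _ H)
  · refine (measure_mono fun ω hω => ?_).trans key
    obtain ⟨q, hq, hn⟩ := hω
    refine ⟨q, hq, ?_⟩
    rw [← hn]
    refine congrFun (hop_congr A fun i hi => ?_) q
    simp [extendSeq, hi]
  · intro d
    -- Markov's inequality: the indicator of a random hopper is at most their number.
    by_cases h : ∃ q ∈ A H, hop A (extendSeq (fun _ => ⟨0, hK⟩) d) H q = none
    · refine prob_le_one.trans ?_
      rw [← ENNReal.ofReal_one]
      refine ENNReal.ofReal_le_ofReal ?_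
      obtain ⟨q, hq, hn⟩ := h
      exact_mod_cast Finset.card_pos.2 ⟨q, Finset.mem_filter.2 ⟨hq, hn⟩⟩
    · simp [h]

open Classical in
/-- Probability that nobody hops randomly after `H` rounds and yet two arms are ranked wrongly. -/
theorem measure_misranked_le (hK : 2 ≤ K) (hν : ∀ k, ∀ᵐ r ∂(ν k), r ∈ Set.Icc (0 : ℝ) 1)
    (hμ : ∀ k, μ k = ∫ r, r ∂(ν k)) (hξm : ∀ p t, Measurable (ξ p t))
    (hξlaw : ∀ p t, P.map (ξ p t) = roundLaw ν)
    (hξind : iIndepFun (fun i : ι × ℕ => ξ i.1 i.2) P)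
    {α : Type*} [Fintype α] (f : α → ι) (hf : f.Injective) (t₀ : ℕ)
    {A : ℕ → Finset α} (hA : Antitone A) (hAK : (A 0).card ≤ K) {H n : ℕ} (hHn : H < n)
    (hm : 0 < (n - H) / K) {p : α} (hp : ∀ s < n, p ∈ A s) {ε : ℝ} (hε : 0 < ε) {k₁ k₂ : Fin K}
    (hk : ε ≤ μ k₁ - μ k₂) :
    P {ω | (∀ q ∈ A H, hop A (fun s q => (ξ (f q) (t₀ + s) ω).1) H q ≠ none) ∧
        hopSum A (fun s q => (ξ (f q) (t₀ + s) ω).1) p (fun s => (ξ (f p) (t₀ + s) ω).2) k₁ n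
          / hopCount A (fun s q => (ξ (f q) (t₀ + s) ω).1) p k₁ n
        ≤ hopSum A (fun s q => (ξ (f q) (t₀ + s) ω).1) p (fun s => (ξ (f p) (t₀ + s) ω).2) k₂ n
          / hopCount A (fun s q => (ξ (f q) (t₀ + s) ω).1) p k₂ n}
      ≤ ENNReal.ofReal (Real.exp (-(8 / 13) * ((n - H) / K : ℕ) * ε ^ 2) * (2 * (1 + 2 * K))) := by
  have : NeZero K := ⟨by omega⟩
  set z : α → Fin K := fun _ => 0
  have key := measure_draws_rewards_le (by omega : 0 < K) hξm hξlaw hξind f hf t₀ n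
    (fun d => {r | (∀ q ∈ A H, hop A (extendSeq z d) H q ≠ none) ∧
        hopSum A (extendSeq z d) p (fun s k => if h : s < n then r (⟨s, h⟩, p) k else 0) k₁ n
          / hopCount A (extendSeq z d) p k₁ n
        ≤ hopSum A (extendSeq z d) p (fun s k => if h : s < n then r (⟨s, h⟩, p) k else 0) k₂ n
          / hopCount A (extendSeq z d) p k₂ n})
    (fun d => Real.exp (-(8 / 13) * ((n - H) / K : ℕ) * ε ^ 2)
      * (3 / 2) ^ (hopHits A (extendSeq z d) p k₁ n).card) (fun d => by positivity) ?_
    (c := Real.exp (-(8 / 13) * ((n - H) / K : ℕ) * ε ^ 2) * (2 * (1 + 2 * K))) ?_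
  · refine (measure_mono fun ω hω => ?_).trans key
    obtain ⟨h1, h2⟩ := hω
    have hd : ∀ i < n, (fun q => (ξ (f q) (t₀ + i) ω).1)
        = extendSeq z (fun (s : Fin n) q => (ξ (f q) (t₀ + s) ω).1) i := by
      intro i hi
      simp [extendSeq, hi]
    refine ⟨fun q hq => ?_, ?_⟩
    · rw [← hop_congr A fun i hi => hd i (by omega)]
      exact h1 q hq
    · rw [← hopCount_congr A hd, ← hopCount_congr A hd]
      convert h2 using 2
      · exact (hopSum_congr A hd p _ fun s hs => by simp [hs]).symm
      · exact (hopSum_congr A hd p _ fun s hs => by simp [hs]).symm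
  · intro d
    by_cases h : ∀ q ∈ A H, hop A (extendSeq z d) H q ≠ none
    · have h1 := add_card_hopHits_le_hopCount hA (extendSeq z d) h hp hHn k₁
      have h2 := add_card_hopHits_le_hopCount hA (extendSeq z d) h hp hHn k₂
      refine (measure_mono fun r hr => hr.2).trans (measure_hopSum_le hν hμ A (extendSeq z d) p n
        ((n - H) / K) hm hε hk h1 (by omega))
    -- For draws that do not settle everybody in time the event is empty.
    · rw [show {r : Fin n × α → Fin K → ℝ | (∀ q ∈ A H, hop A (extendSeq z d) H q ≠ none) ∧ _} = ∅
        from Set.eq_empty_of_forall_notMem fun r hr => h hr.1]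
      simp
  · rw [← Finset.mul_sum]
    have := sum_pow_hopHits_le hA hAK hK z n hp k₁
    calc _ ≤ Real.exp (-(8 / 13) * ((n - H) / K : ℕ) * ε ^ 2)
          * ((Fintype.card (α → Fin K) : ℝ) ^ n * (2 * (1 + 2 * K))) := by gcongr
      _ = _ := by ring

end EstimateProbability
end DynTrek
end

noncomputable section
namespace DynTrek

/-! ### The trekking phase -/

namespace TrekState

variable {K : ℕ} {τ : TrekState K}

lemma update_of_locked (h : τ.locked = true) (c : Bool) : τ.update c = τ := by
  simp [TrekState.update, h]

lemma update_of_collision (h : τ.locked = false) : τ.update true = { τ with locked := true } := by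
  simp [TrekState.update, h]

lemma update_of_wait (h : τ.locked = false) (hY : τ.Y + 1 < (τ.J : ℕ)) :
    τ.update false = { τ with Y := τ.Y + 1 } := by
  simp [TrekState.update, h, hY]

lemma update_of_advance (h : τ.locked = false) (hY : ¬ τ.Y + 1 < (τ.J : ℕ)) :
    τ.update false = { τ with
      J := ⟨(τ.J : ℕ) - 1, by have := τ.J.2; omega⟩
      Y := 0
      locked := decide ((τ.J : ℕ) - 1 = 0) } := by
  simp [TrekState.update, h, hY]

lemma choose_of_locked (h : τ.locked = true) : τ.choose = τ.list τ.J := by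
  simp [TrekState.choose, h]

lemma choose_of_not_locked (h : τ.locked = false) :
    τ.choose = τ.list ⟨(τ.J : ℕ) - 1, by have := τ.J.2; omega⟩ := by
  simp [TrekState.choose, h]

end TrekState

section Trekking

variable {ι : Type*} {K : ℕ}

/-- A trekking phase with common ranking `π`: `A r` are the remaining players, `c r p` tells
whether `p` collides in round `r`. Collisions in the first `M` rounds are only among `A r`. -/
structure TrekPhase (π : Equiv.Perm (Fin K)) (A : ℕ → Finset ι) (c : ℕ → ι → Bool)
    (σ : ℕ → ι → TrekState K) (M R : ℕ) : Prop where
  anti : Antitone A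
  start : ∃ k : ι → Fin K, Set.InjOn k (A 0) ∧ ∀ p ∈ A 0, σ 0 p = TrekState.start π (k p)
  step : ∀ r < R, ∀ p, σ (r + 1) p = (σ r p).update (c r p)
  coll : ∀ r < M, ∀ p ∈ A r,
    (c r p = true ↔ ∃ q ∈ A r, q ≠ p ∧ (σ r q).choose = (σ r p).choose)
  len : K * (K - 1) ≤ 2 * M

/-- Invariants of the trekking phase after `r` rounds. -/
structure TrekInv (π : Equiv.Perm (Fin K)) (A₀ A : Finset ι) (σ : ι → TrekState K) (r : ℕ) :
    Prop where
  list : ∀ p ∈ A, (σ p).list = π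
  lt : ∀ p ∈ A, (σ p).locked = false → (σ p).Y < (σ p).J
  pot : ∀ p ∈ A, (σ p).locked = false →
    2 * r + (σ p).J * ((σ p).J + 1) ≤ K * (K - 1) + 2 * (σ p).Y
  inj : ∀ p ∈ A, ∀ q ∈ A, ((σ p).J : ℕ) = (σ q).J → p = q
  order : ∀ p ∈ A, ∀ q ∈ A, (σ p).locked = false → (σ q).locked = false →
    ((σ q).J : ℕ) = (σ p).J + 1 → (σ q).Y ≤ (σ p).Y
  below : ∀ p ∈ A, (σ p).locked = true → ∀ i ≤ ((σ p).J : ℕ),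
    ∃ q ∈ A₀, (σ q).locked = true ∧ ((σ q).J : ℕ) = i

variable {π : Equiv.Perm (Fin K)} {A : ℕ → Finset ι} {c : ℕ → ι → Bool}
  {σ : ℕ → ι → TrekState K} {M R : ℕ}

/-- In a collision of a player who is not locked, the other player is locked on the arm. -/
lemma TrekInv.locked_of_choose_eq {A₀ A : Finset ι} {σ : ι → TrekState K} {r : ℕ}
    (h : TrekInv π A₀ A σ r) {p q : ι} (hp : p ∈ A) (hq : q ∈ A) (hne : q ≠ p)
    (hl : (σ p).locked = false) (he : (σ q).choose = (σ p).choose) :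
    (σ q).locked = true ∧ ((σ q).J : ℕ) + 1 = (σ p).J := by
  have hlt := h.lt p hp hl
  rw [TrekState.choose_of_not_locked hl, h.list p hp] at he
  rcases hlq : (σ q).locked with _ | _
  · exfalso
    have hltq := h.lt q hq hlq
    rw [TrekState.choose_of_not_locked hlq, h.list q hq] at he
    have := congrArg Fin.val (π.injective he)
    simp only at this
    exact hne (h.inj q hq p hp (by omega))
  · rw [TrekState.choose_of_locked hlq, h.list q hq] at he
    have := congrArg Fin.val (π.injective he)
    simp only at this
    exact ⟨rfl, by omega⟩

/-- Two colliding players are not both locked. -/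
lemma TrekInv.not_locked_of_choose_eq {A₀ A : Finset ι} {σ : ι → TrekState K} {r : ℕ}
    (h : TrekInv π A₀ A σ r) {p q : ι} (hp : p ∈ A) (hq : q ∈ A) (hne : q ≠ p)
    (hl : (σ p).locked = true) (he : (σ q).choose = (σ p).choose) : (σ q).locked = false := by
  rcases hlq : (σ q).locked with _ | _
  · rfl
  · exfalso
    rw [TrekState.choose_of_locked hlq, h.list q hq, TrekState.choose_of_locked hl,
      h.list p hp] at he
    exact hne (h.inj q hq p hp (congrArg Fin.val (π.injective he)))

namespace TrekPhase

lemma inv_zero (h : TrekPhase π A c σ M R) : TrekInv π (A 0) (A 0) (σ 0) 0 := by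
  obtain ⟨k, hk, hst⟩ := h.start
  refine ⟨?_, ?_, ?_, ?_, ?_, ?_⟩
  · intro p hp; rw [hst p hp]; rfl
  · intro p hp hl
    rw [hst p hp] at hl ⊢
    simp only [TrekState.start, decide_eq_false_iff_not] at hl ⊢
    omega
  · intro p hp _
    rw [hst p hp]
    simp only [TrekState.start]
    have h1 : ((π.symm (k p) : Fin K) : ℕ) + 1 ≤ K := (π.symm (k p)).2
    have h2 : ((π.symm (k p) : Fin K) : ℕ) ≤ K - 1 := by omega
    nlinarith [Nat.mul_le_mul h2 h1]
  · intro p hp q hq he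
    rw [hst p hp, hst q hq] at he
    exact hk hp hq (π.symm.injective (Fin.ext he))
  · intro p hp q hq _ _ _
    rw [hst p hp, hst q hq]
    simp [TrekState.start]
  · intro p hp hl i hi
    have hl' := hl
    rw [hst p hp] at hl hi
    simp only [TrekState.start, decide_eq_true_eq] at hl hi
    refine ⟨p, hp, hl', ?_⟩
    rw [hst p hp]
    simp only [TrekState.start]
    omega

/-- From position `J` a climber needs at most `J + (J - 1) + ⋯ + 1` collision-free rounds, of which
`Y` are done. The invariant `pot` says that rounds elapsed plus rounds needed stay within `K (K - 1)
/ 2`, and `Y < J` leaves at least one to go. -/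
lemma lt_of_pot {A₀ A' : Finset ι} {τ : ι → TrekState K} {r : ℕ} (hi : TrekInv π A₀ A' τ r)
    {p : ι} (hp : p ∈ A') (hl : (τ p).locked = false) : 2 * r < K * (K - 1) := by
  have h1 := hi.pot p hp hl
  have h2 := hi.lt p hp hl
  nlinarith

/-- The possible changes of a player's memory in one round. -/
lemma step_cases (h : TrekPhase π A c σ M R) {r : ℕ} (hr : r < R)
    (hi : TrekInv π (A 0) (A r) (σ r) r) {p : ι} (hp : p ∈ A r) :
    ((σ r p).locked = true ∧ σ (r + 1) p = σ r p) ∨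
    ((σ r p).locked = false ∧ c r p = true ∧ (σ (r + 1) p).locked = true
      ∧ (σ (r + 1) p).list = (σ r p).list
      ∧ (σ (r + 1) p).J = (σ r p).J ∧ ∃ q ∈ A r, (σ r q).locked = true
        ∧ ((σ r q).J : ℕ) + 1 = (σ r p).J) ∨
    ((σ r p).locked = false ∧ (σ (r + 1) p).locked = false
      ∧ (σ (r + 1) p).list = (σ r p).list ∧ (σ (r + 1) p).J = (σ r p).J
      ∧ (σ (r + 1) p).Y = (σ r p).Y + 1 ∧ (σ r p).Y + 1 < (σ r p).J) ∨
    ((σ r p).locked = false ∧ (σ (r + 1) p).list = (σ r p).list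
      ∧ ((σ (r + 1) p).J : ℕ) + 1 = (σ r p).J ∧ (σ (r + 1) p).Y = 0
      ∧ ((σ (r + 1) p).locked = true ↔ ((σ (r + 1) p).J : ℕ) = 0)
      ∧ (σ r p).Y + 1 = (σ r p).J
      ∧ ∀ q ∈ A r, ((σ r q).J : ℕ) + 1 ≠ (σ r p).J) := by
  rcases hl : (σ r p).locked with _ | _
  · right
    have hlt := hi.lt p hp hl
    -- Later collisions may involve entrants, but by then nobody is unlocked.
    have hrM : r < M := by have := lt_of_pot hi hp hl; have := h.len; omega
    have hcoll := h.coll r hrM p hp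
    rcases hc : c r p with _ | _
    · right
      have hst := h.step r hr p
      rw [hc] at hst
      by_cases hY : (σ r p).Y + 1 < ((σ r p).J : ℕ)
      · left
        rw [TrekState.update_of_wait hl hY] at hst
        rw [hst]
        exact ⟨rfl, hl, rfl, rfl, rfl, hY⟩
      · right
        rw [TrekState.update_of_advance hl hY] at hst
        rw [hst]
        refine ⟨rfl, rfl, ?_, rfl, ?_, by omega, ?_⟩
        · simp only; omega
        · simp
        · intro q hq hqJ
          rcases hlq : (σ r q).locked with _ | _
          -- An unlocked `q` just above has at least as many rounds `Y` to her credit but needs one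
          -- fewer, so she would have moved on already.
          · have h1 := hi.order q hq p hp hlq hl hqJ.symm
            have h2 := hi.lt q hq hlq
            omega
          · have : c r p = true := by
              rw [hcoll]
              refine ⟨q, hq, ?_, ?_⟩
              · rintro rfl; omega
              · rw [TrekState.choose_of_locked hlq, TrekState.choose_of_not_locked hl,
                  hi.list q hq, hi.list p hp]
                congr 1
                ext
                simp only
                omega
            rw [hc] at this
            exact absurd this (by simp)
    · left
      have hst := h.step r hr p
      rw [hc, TrekState.update_of_collision hl] at hst
      obtain ⟨q, hq, hne, he⟩ := hcoll.1 hc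
      have := hi.locked_of_choose_eq hp hq hne hl he
      rw [hst]
      exact ⟨rfl, rfl, rfl, rfl, rfl, q, hq, this.1, this.2⟩
  · left
    have hst := h.step r hr p
    rw [TrekState.update_of_locked hl] at hst
    exact ⟨rfl, hst⟩

lemma locked_step (h : TrekPhase π A c σ M R) {r : ℕ} (hr : r < R) {p : ι}
    (hl : (σ r p).locked = true) : σ (r + 1) p = σ r p := by
  rw [h.step r hr p, TrekState.update_of_locked hl]

/-- The waiting time at a position equals its index, so a player just above an advancing climber is
gone in time unless she is locked, in which case the climber collides and is locked below her. This
keeps reserved arms distinct and stacks the locked players without gaps. -/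
lemma inv_succ (h : TrekPhase π A c σ M R) {r : ℕ} (hr : r < R)
    (hi : TrekInv π (A 0) (A r) (σ r) r) :
    TrekInv π (A 0) (A (r + 1)) (σ (r + 1)) (r + 1) := by
  have hsub : ∀ {p}, p ∈ A (r + 1) → p ∈ A r := fun hp => h.anti (Nat.le_succ r) hp
  refine ⟨?_, ?_, ?_, ?_, ?_, ?_⟩
  · intro p hp
    have hl := hi.list p (hsub hp)
    rcases h.step_cases hr hi (hsub hp) with a | a | a | a
    · rw [a.2, hl]
    · rw [a.2.2.2.1, hl]
    · rw [a.2.2.1, hl]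
    · rw [a.2.1, hl]
  · intro p hp hu
    rcases h.step_cases hr hi (hsub hp) with a | a | a | a
    · rw [a.2, a.1] at hu; simp at hu
    · rw [a.2.2.1] at hu; simp at hu
    · rw [a.2.2.2.1, a.2.2.2.2.1]; exact a.2.2.2.2.2
    · rw [a.2.2.2.1]
      by_contra hz
      have := a.2.2.2.2.1.2 (by omega)
      rw [hu] at this; simp at this
  · intro p hp hu
    have hpot := hi.pot p (hsub hp)
    rcases h.step_cases hr hi (hsub hp) with a | a | a | a
    · rw [a.2, a.1] at hu; simp at hu
    · rw [a.2.2.1] at hu; simp at hu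
    · have := hpot a.1
      rw [a.2.2.2.1, a.2.2.2.2.1]
      omega
    -- On an advance `Y + 1 = J`, so passing from `J (J + 1)` to `(J - 1) J` pays exactly for the
    -- round and for the reset of `Y`.
    · have h1 := hpot a.1
      have h2 := a.2.2.1
      have h3 := a.2.2.2.2.2.1
      rw [a.2.2.2.1]
      rw [← h2] at h1 h3
      nlinarith
  · intro p hp q hq he
    have hinj := hi.inj p (hsub hp) q (hsub hq)
    have hnext : ∀ {p q}, p ∈ A (r + 1) → q ∈ A (r + 1) → ((σ (r + 1) p).J : ℕ) = (σ r p).J →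
        ((σ (r + 1) q).J : ℕ) + 1 = (σ r q).J →
        (∀ q' ∈ A r, ((σ r q').J : ℕ) + 1 ≠ (σ r q).J) →
        ((σ (r + 1) p).J : ℕ) ≠ (σ (r + 1) q).J := by
      intro p q hp hq h1 h2 h3 h4
      exact h3 p (hsub hp) (by omega)
    have hJ : ∀ {p}, p ∈ A (r + 1) → ((σ (r + 1) p).J : ℕ) = (σ r p).J ∨
        (((σ (r + 1) p).J : ℕ) + 1 = (σ r p).J ∧
          ∀ q' ∈ A r, ((σ r q').J : ℕ) + 1 ≠ (σ r p).J) := by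
      intro p hp
      rcases h.step_cases hr hi (hsub hp) with a | a | a | a
      · left; rw [a.2]
      · left; rw [a.2.2.2.2.1]
      · left; rw [a.2.2.2.1]
      · right; exact ⟨a.2.2.1, a.2.2.2.2.2.2⟩
    rcases hJ hp with a | a <;> rcases hJ hq with b | b
    · exact hinj (by omega)
    · exact absurd he (hnext hp hq a b.1 b.2)
    · exact absurd he.symm (hnext hq hp b a.1 a.2)
    · exact hinj (by omega)
  · intro p hp q hq hup huq hJ
    have hord := hi.order p (hsub hp) q (hsub hq)
    rcases h.step_cases hr hi (hsub hq) with b | b | b | b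
    · rw [b.2, b.1] at huq; simp at huq
    · rw [b.2.2.1] at huq; simp at huq
    · rcases h.step_cases hr hi (hsub hp) with a | a | a | a
      · rw [a.2, a.1] at hup; simp at hup
      · rw [a.2.2.1] at hup; simp at hup
      · rw [a.2.2.2.1, b.2.2.2.1] at hJ
        have := hord a.1 b.1 hJ
        rw [a.2.2.2.2.1, b.2.2.2.2.1]
        omega
      · exfalso
        rw [b.2.2.2.1] at hJ
        have hqp := hi.inj q (hsub hq) p (hsub hp) (by have := a.2.2.1; omega)
        subst hqp
        have := a.2.2.2.1
        have := b.2.2.2.2.1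
        omega
    · rw [b.2.2.2.1]; exact Nat.zero_le _
  · intro p hp hl i hle
    -- The witnesses are sought in `A 0`, since a locked player may leave; her recorded memory stays
    -- locked.
    have hpers : ∀ {i}, (∃ q ∈ A 0, (σ r q).locked = true ∧ ((σ r q).J : ℕ) = i) →
        ∃ q ∈ A 0, (σ (r + 1) q).locked = true ∧ ((σ (r + 1) q).J : ℕ) = i := by
      rintro i ⟨q, hq, hlq, hJ⟩
      have := h.locked_step hr hlq
      exact ⟨q, hq, by rw [this]; exact hlq, by rw [this]; exact hJ⟩
    have hp0 : p ∈ A 0 := h.anti (Nat.zero_le _) hp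
    by_cases hiJ : i = ((σ (r + 1) p).J : ℕ)
    · exact ⟨p, hp0, hl, hiJ.symm⟩
    rcases h.step_cases hr hi (hsub hp) with a | a | a | a
    · rw [a.2] at hle
      exact hpers (hi.below p (hsub hp) a.1 i hle)
    · obtain ⟨q, hq, hlq, hJ⟩ := a.2.2.2.2.2
      have := a.2.2.2.2.1
      rw [this] at hle hiJ
      exact hpers (hi.below q hq hlq i (by omega))
    · rw [a.2.1] at hl; simp at hl
    · have := a.2.2.2.2.1.1 hl
      omega

theorem inv (h : TrekPhase π A c σ M R) {r : ℕ} (hr : r ≤ R) :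
    TrekInv π (A 0) (A r) (σ r) r := by
  induction r with
  | zero => exact h.inv_zero
  | succ r ih => exact h.inv_succ (by omega) (ih (by omega))

/-- Everybody is locked after `K (K - 1) / 2` rounds. -/
theorem locked (h : TrekPhase π A c σ M R) {r : ℕ} (hr : r ≤ R) (hKr : K * (K - 1) ≤ 2 * r)
    {p : ι} (hp : p ∈ A r) : (σ r p).locked = true := by
  rcases hl : (σ r p).locked with _ | _
  · have := lt_of_pot (h.inv hr) hp hl
    omega
  · rfl

/-- Players get locked on the first positions. -/
theorem J_lt_card (h : TrekPhase π A c σ M R) {r : ℕ} (hr : r ≤ R) {p : ι} (hp : p ∈ A r)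
    (hl : (σ r p).locked = true) : ((σ r p).J : ℕ) < (A 0).card := by
  classical
  -- Each of the positions `0, …, J` is held by a player of `A 0`, and a player holds one position.
  have hb := (h.inv hr).below p hp hl
  have : Finset.range ((σ r p).J + 1) ⊆ (A 0).image fun q => ((σ r q).J : ℕ) := by
    intro i hi
    obtain ⟨q, hq, -, hJ⟩ := hb i (by rw [Finset.mem_range] at hi; omega)
    exact Finset.mem_image.2 ⟨q, hq, hJ⟩
  have h1 := (Finset.card_le_card this).trans Finset.card_image_le
  rw [Finset.card_range] at h1
  omega

/-- The collisions of a round are at most twice the players who get locked in it. -/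
lemma card_coll_add_le [DecidableEq ι] (h : TrekPhase π A c σ M R) {r : ℕ} (hrM : r < M)
    (hr : r < R) :
    ((A r).filter fun p => c r p = true).card
        + 2 * ((A 0).filter fun p => (σ r p).locked = true).card
      ≤ 2 * ((A 0).filter fun p => (σ (r + 1) p).locked = true).card := by
  have hi := h.inv hr.le
  set U := (A r).filter fun p => c r p = true ∧ (σ r p).locked = false with hU
  set W := (A r).filter fun p => c r p = true ∧ (σ r p).locked = true with hW
  have hsplit : ((A r).filter fun p => c r p = true) = U ∪ W := by
    ext p
    simp only [hU, hW, Finset.mem_filter, Finset.mem_union]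
    rcases (σ r p).locked with _ | _ <;> simp
  have hWU : W.card ≤ U.card := by
    -- A locked collider is hit by the climber reserving the next position. Positions are distinct,
    -- so this pairing is injective, and every climber in `U` gets locked.
    have hex : ∀ p ∈ W, ∃ q ∈ U, ((σ r p).J : ℕ) + 1 = (σ r q).J := by
      intro p hp
      rw [hW, Finset.mem_filter] at hp
      obtain ⟨hpA, hc, hl⟩ := hp
      obtain ⟨q, hq, hne, he⟩ := (h.coll r hrM p hpA).1 hc
      have hlq := hi.not_locked_of_choose_eq hpA hq hne hl he
      have hcq : c r q = true := (h.coll r hrM q hq).2 ⟨p, hpA, hne.symm, he.symm⟩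
      exact ⟨q, Finset.mem_filter.2 ⟨hq, hcq, hlq⟩,
        (hi.locked_of_choose_eq hq hpA hne.symm hlq he.symm).2⟩
    choose! g hgU hgJ using hex
    refine Finset.card_le_card_of_injOn g (fun p hp => hgU p hp) ?_
    intro p hp q hq he
    have h1 := hgJ p hp
    have h2 := hgJ q hq
    rw [he] at h1
    exact hi.inj p (Finset.mem_filter.1 hp).1 q (Finset.mem_filter.1 hq).1 (by omega)
  have hlock : ((A 0).filter fun p => (σ r p).locked = true).card + U.card
      ≤ ((A 0).filter fun p => (σ (r + 1) p).locked = true).card := by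
    rw [← Finset.card_union_of_disjoint]
    · refine Finset.card_le_card fun p hp => ?_
      rw [Finset.mem_union, Finset.mem_filter, hU, Finset.mem_filter] at hp
      rw [Finset.mem_filter]
      rcases hp with hp | hp
      · exact ⟨hp.1, by rw [h.locked_step hr hp.2]; exact hp.2⟩
      · refine ⟨h.anti (Nat.zero_le r) hp.1, ?_⟩
        rw [h.step r hr p, hp.2.1, TrekState.update_of_collision hp.2.2]
    · rw [Finset.disjoint_left]
      intro p hp hp'
      rw [Finset.mem_filter] at hp
      rw [hU, Finset.mem_filter] at hp'
      rw [hp.2] at hp'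
      simp at hp'
  rw [hsplit]
  have := Finset.card_union_le U W
  omega

/-- Total number of collisions in the trekking phase. -/
theorem sum_card_coll_le [DecidableEq ι] (h : TrekPhase π A c σ M R) {N : ℕ} (hNM : N ≤ M)
    (hNR : N ≤ R) :
    ∑ r ∈ Finset.range N, ((A r).filter fun p => c r p = true).card ≤ 2 * (A 0).card := by
  have key : ∑ r ∈ Finset.range N, ((A r).filter fun p => c r p = true).card
      ≤ 2 * ((A 0).filter fun p => (σ N p).locked = true).card := by
    induction N with
    | zero => simp
    | succ N ih =>
      rw [Finset.sum_range_succ]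
      have h1 := ih (by omega) (by omega)
      have h2 := h.card_coll_add_le (r := N) (by omega) (by omega)
      omega
  exact key.trans (Nat.mul_le_mul_left _ (Finset.card_filter_le _ _))

end TrekPhase

end Trekking
end DynTrek
end

noncomputable section
namespace DynTrek

/-! ### Regret and collisions of one round -/

section Round

variable {ι : Type*} [DecidableEq ι] {K : ℕ} {μ : Fin K → ℝ} {S F : Finset ι} {a : ι → Fin K}
  {c : ι → Bool}

lemma card_topArms_le (μ : Fin K → ℝ) (n : ℕ) : (topArms μ n).card ≤ n := by
  have : (topArms μ n).image (fun k => ((ranking μ).symm k : ℕ)) ⊆ Finset.range n := by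
    intro i hi
    obtain ⟨k, hk, rfl⟩ := Finset.mem_image.1 hi
    exact Finset.mem_range.2 (Finset.mem_filter.1 hk).2
  have h := Finset.card_le_card this
  rwa [Finset.card_range, Finset.card_image_of_injective] at h
  intro k k' h
  exact (ranking μ).symm.injective (Fin.ext h)

lemma topArms_mono (μ : Fin K → ℝ) {m n : ℕ} (h : m ≤ n) : topArms μ m ⊆ topArms μ n := by
  intro k hk
  simp only [topArms, Finset.mem_filter] at hk ⊢
  exact ⟨hk.1, by omega⟩

/-- Means lie in `[0, 1]`: a missed arm costs at most `1` and additional arms do no harm. All regret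
bounds thereby reduce to counting missed arms. -/
lemma sum_sub_sum_le_card (hμ : ∀ k, μ k ∈ Set.Icc (0 : ℝ) 1) (X Y : Finset (Fin K)) :
    ∑ k ∈ X, μ k - ∑ k ∈ Y, μ k ≤ (X \ Y).card := by
  have h1 : ∑ k ∈ X, μ k = ∑ k ∈ X \ Y, μ k + ∑ k ∈ X ∩ Y, μ k := by
    rw [add_comm, Finset.sum_inter_add_sum_sdiff]
  have h2 : ∑ k ∈ X ∩ Y, μ k ≤ ∑ k ∈ Y, μ k :=
    Finset.sum_le_sum_of_subset_of_nonneg Finset.inter_subset_right fun k _ _ => (hμ k).1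
  have h3 : ∑ k ∈ X \ Y, μ k ≤ ∑ _k ∈ X \ Y, (1 : ℝ) := Finset.sum_le_sum fun k _ => (hμ k).2
  rw [Finset.sum_const, nsmul_eq_mul, mul_one] at h3
  linarith

/-- The arms on which a reward is obtained. -/
def goodArms (S : Finset ι) (a : ι → Fin K) (c : ι → Bool) : Finset (Fin K) :=
  (S.filter fun p => c p = false).image a

lemma injOn_of_not_coll (hc : ∀ p ∈ S, (c p = true ↔ ∃ q ∈ S, q ≠ p ∧ a q = a p)) :
    Set.InjOn a (S.filter fun p => c p = false : Finset ι) := by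
  intro p hp q hq he
  simp only [Finset.coe_filter, Set.mem_ofPred_eq] at hp hq
  by_contra hne
  have := (hc p hp.1).2 ⟨q, hq.1, fun h => hne h.symm, he.symm⟩
  rw [hp.2] at this
  simp at this

lemma card_goodArms (hc : ∀ p ∈ S, (c p = true ↔ ∃ q ∈ S, q ≠ p ∧ a q = a p)) :
    (goodArms S a c).card + (S.filter fun p => c p = true).card = S.card := by
  rw [goodArms, Finset.card_image_of_injOn (injOn_of_not_coll hc), add_comm]
  have := Finset.card_filter_add_card_filter_not (s := S) (fun p => c p = true)
  simpa using this

lemma sum_reward_eq (hc : ∀ p ∈ S, (c p = true ↔ ∃ q ∈ S, q ≠ p ∧ a q = a p)) :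
    ∑ p ∈ S, μ (a p) * (1 - if c p then 1 else 0) = ∑ k ∈ goodArms S a c, μ k := by
  rw [goodArms, Finset.sum_image (injOn_of_not_coll hc), Finset.sum_filter]
  refine Finset.sum_congr rfl fun p _ => ?_
  rcases c p with _ | _ <;> simp

/-- Players who collide occupy few arms, the others are on distinct arms: the regret of a round is
at most half of the number of arms plus half of the number of collisions. -/
theorem round_regret_le (hμ : ∀ k, μ k ∈ Set.Icc (0 : ℝ) 1)
    (hc : ∀ p ∈ S, (c p = true ↔ ∃ q ∈ S, q ≠ p ∧ a q = a p)) :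
    ∑ k ∈ topArms μ S.card, μ k - ∑ p ∈ S, μ (a p) * (1 - if c p then 1 else 0)
      ≤ ((K : ℝ) + (S.filter fun p => c p = true).card) / 2 := by
  rw [sum_reward_eq hc]
  refine (sum_sub_sum_le_card hμ _ _).trans ?_
  -- The number of missed arms is at most `S.card`, and at most `K` minus the number of good arms.
  -- The average of the two bounds does not contain `S.card`.
  have h1 : (topArms μ S.card \ goodArms S a c).card ≤ S.card :=
    (Finset.card_le_card Finset.sdiff_subset).trans (card_topArms_le μ _)
  have h2 : (topArms μ S.card \ goodArms S a c).card + (goodArms S a c).card ≤ K := by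
    rw [← Finset.card_union_of_disjoint Finset.sdiff_disjoint]
    exact (Finset.card_le_univ _).trans (Fintype.card_fin K).le
  have h3 := card_goodArms hc
  rw [le_div_iff₀ (by norm_num)]
  have : (topArms μ S.card \ goodArms S a c).card * 2
      ≤ K + (S.filter fun p => c p = true).card := by omega
  exact_mod_cast this

/-- If the players in `F` are on distinct arms, only as many of them collide as there are other
players. -/
lemma card_coll_filter_le (hFS : F ⊆ S)
    (hc : ∀ p ∈ S, (c p = true ↔ ∃ q ∈ S, q ≠ p ∧ a q = a p)) (hF : Set.InjOn a F) :
    (F.filter fun p => c p = true).card ≤ (S \ F).card := by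
  have hex : ∀ p ∈ F.filter fun p => c p = true, ∃ q ∈ S \ F, a q = a p := by
    intro p hp
    rw [Finset.mem_filter] at hp
    obtain ⟨q, hq, hne, he⟩ := (hc p (hFS hp.1)).1 hp.2
    exact ⟨q, Finset.mem_sdiff.2 ⟨hq, fun hqF => hne (hF hqF hp.1 he)⟩, he⟩
  choose! g hgS hga using hex
  refine Finset.card_le_card_of_injOn g (fun p hp => hgS p hp) ?_
  intro p hp q hq he
  have h1 := hga p hp
  rw [he, hga q hq] at h1
  exact hF (Finset.mem_filter.1 hp).1 (Finset.mem_filter.1 hq).1 h1.symm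

/-- Number of collisions when the players in `F` are on distinct arms. -/
theorem round_coll_le (hFS : F ⊆ S)
    (hc : ∀ p ∈ S, (c p = true ↔ ∃ q ∈ S, q ≠ p ∧ a q = a p)) (hF : Set.InjOn a F) :
    (S.filter fun p => c p = true).card ≤ 2 * (S \ F).card := by
  have h1 := card_coll_filter_le hFS hc hF
  have h2 : (S.filter fun p => c p = true) ⊆ (F.filter fun p => c p = true) ∪ (S \ F) := by
    intro p hp
    rw [Finset.mem_filter] at hp
    rw [Finset.mem_union, Finset.mem_filter, Finset.mem_sdiff]
    by_cases hpF : p ∈ F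
    · exact Or.inl ⟨hpF, hp.2⟩
    · exact Or.inr ⟨hp.1, hpF⟩
  have h3 := (Finset.card_le_card h2).trans (Finset.card_union_le _ _)
  omega

/-- Regret of a round when the players in `F` are on distinct arms among the `m` best ones. -/
theorem round_regret_le_of_topArms (hμ : ∀ k, μ k ∈ Set.Icc (0 : ℝ) 1) (hFS : F ⊆ S)
    (hc : ∀ p ∈ S, (c p = true ↔ ∃ q ∈ S, q ≠ p ∧ a q = a p)) (hF : Set.InjOn a F) {m : ℕ}
    (hFm : ∀ p ∈ F, a p ∈ topArms μ m) :
    ∑ k ∈ topArms μ S.card, μ k - ∑ p ∈ S, μ (a p) * (1 - if c p then 1 else 0)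
      ≤ 2 * (((m - F.card : ℕ) : ℝ) + (S \ F).card) := by
  rw [sum_reward_eq hc]
  refine (sum_sub_sum_le_card hμ _ _).trans ?_
  have h1 := card_coll_filter_le hFS hc hF
  set G := (F.filter fun p => c p = false).image a with hG
  have hGcard : G.card + (F.filter fun p => c p = true).card = F.card := by
    rw [hG, Finset.card_image_of_injOn (hF.mono (Finset.coe_subset.2 (Finset.filter_subset _ _))), add_comm]
    have := Finset.card_filter_add_card_filter_not (s := F) (fun p => c p = true)
    simpa using this
  have hGgood : G ⊆ goodArms S a c :=
    Finset.image_subset_image (Finset.filter_subset_filter _ hFS)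
  -- Both the current optimal arms and the arms of `F` lie among the best `max S.card m`, where the
  -- missed ones can be counted.
  have hGtop : G ⊆ topArms μ (max S.card m) := by
    intro k hk
    obtain ⟨p, hp, rfl⟩ := Finset.mem_image.1 hk
    exact topArms_mono μ (le_max_right _ _) (hFm p (Finset.mem_filter.1 hp).1)
  have h2 : (topArms μ S.card \ goodArms S a c).card ≤ (topArms μ (max S.card m) \ G).card :=
    Finset.card_le_card (Finset.sdiff_subset_sdiff (topArms_mono μ (le_max_left _ _)) hGgood)
  have h3 : (topArms μ (max S.card m) \ G).card + G.card ≤ max S.card m := by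
    rw [Finset.card_sdiff_add_card_eq_card hGtop]
    exact card_topArms_le μ _
  have h4 : (S \ F).card + F.card = S.card := Finset.card_sdiff_add_card_eq_card hFS
  have : (topArms μ S.card \ goodArms S a c).card ≤ 2 * ((m - F.card) + (S \ F).card) := by
    rcases le_total S.card m with h | h
    · rw [max_eq_right h] at h2 h3; omega
    · rw [max_eq_left h] at h2 h3; omega
  exact_mod_cast this

end Round

/-! ### One epoch of a run -/

namespace Run

variable {ι : Type*} {K : ℕ} [DecidableEq ι] (G : Run ι K)

/-- Players who have been in the game from round `t₀` to round `t₀ + s`. -/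
def stay (t₀ s : ℕ) : Finset ι :=
  (G.present t₀).filter fun p => ∀ s' ≤ s, p ∈ G.present (t₀ + s')

lemma mem_stay {t₀ s : ℕ} {p : ι} : p ∈ G.stay t₀ s ↔ ∀ s' ≤ s, p ∈ G.present (t₀ + s') := by
  rw [stay, Finset.mem_filter]
  exact ⟨fun h => h.2, fun h => ⟨h 0 (Nat.zero_le _), h⟩⟩

lemma stay_zero (t₀ : ℕ) : G.stay t₀ 0 = G.present t₀ := by
  ext p; simp [mem_stay]

lemma stay_anti (t₀ : ℕ) : Antitone (G.stay t₀) := by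
  intro s s' h p hp
  rw [mem_stay] at hp ⊢
  exact fun i hi => hp i (hi.trans h)

lemma stay_subset (t₀ s : ℕ) : G.stay t₀ s ⊆ G.present (t₀ + s) :=
  fun _ hp => (G.mem_stay.1 hp) s le_rfl

lemma stay_succ (t₀ s : ℕ) : G.stay t₀ (s + 1) = G.stay t₀ s ∩ G.present (t₀ + (s + 1)) := by
  ext p
  rw [Finset.mem_inter, mem_stay, mem_stay]
  constructor
  · exact fun h => ⟨fun i hi => h i (by omega), h _ le_rfl⟩
  · rintro ⟨h1, h2⟩ i hi
    rcases Nat.lt_or_ge i (s + 1) with h | h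
    · exact h1 i (by omega)
    · rwa [show i = s + 1 by omega]

/-- Without entries, the present players have been in the game from the beginning. -/
lemma present_eq_stay {t₀ s : ℕ}
    (h : ∀ i, 0 < i → i ≤ s → G.present (t₀ + i) ⊆ G.present (t₀ + i - 1)) :
    G.present (t₀ + s) = G.stay t₀ s := by
  induction s with
  | zero => rw [stay_zero]; rfl
  | succ s ih =>
    rw [stay_succ, ← ih fun i h1 h2 => h i h1 (by omega)]
    refine (Finset.inter_eq_right.2 ?_).symm
    exact h (s + 1) (by omega) le_rfl

/-- Number of entries and departures between rounds `t` and `t + 1`. -/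
def movesAt (present : ℕ → Finset ι) (t : ℕ) : ℕ :=
  (present (t + 1) \ present t).card + (present t \ present (t + 1)).card

/-- Players who have left or entered since round `t₀` account for as many moves. -/
lemma departed_add_entered_le (t₀ s : ℕ) :
    ((G.present t₀).card - (G.stay t₀ s).card) + (G.present (t₀ + s) \ G.stay t₀ s).card
      ≤ ∑ i ∈ Finset.range s, movesAt G.present (t₀ + i) := by
  induction s with
  | zero => simp [stay_zero]
  | succ s ih =>
    rw [Finset.sum_range_succ]
    have h1 : (G.stay t₀ s).card ≤ (G.stay t₀ (s + 1)).card
        + (G.present (t₀ + s) \ G.present (t₀ + s + 1)).card := by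
      refine le_trans (Finset.card_le_card fun p hp => ?_) (Finset.card_union_le _ _)
      rw [Finset.mem_union, stay_succ, Finset.mem_inter, Finset.mem_sdiff]
      by_cases h : p ∈ G.present (t₀ + s + 1)
      · exact Or.inl ⟨hp, h⟩
      · exact Or.inr ⟨G.stay_subset t₀ s hp, h⟩
    have h2 : (G.present (t₀ + (s + 1)) \ G.stay t₀ (s + 1)).card
        ≤ (G.present (t₀ + s) \ G.stay t₀ s).card
          + (G.present (t₀ + s + 1) \ G.present (t₀ + s)).card := by
      refine le_trans (Finset.card_le_card fun p hp => ?_) (Finset.card_union_le _ _)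
      rw [Finset.mem_sdiff, stay_succ, Finset.mem_inter] at hp
      rw [Finset.mem_union, Finset.mem_sdiff, Finset.mem_sdiff]
      by_cases h : p ∈ G.present (t₀ + s)
      · exact Or.inl ⟨h, fun h' => hp.2 ⟨h', hp.1⟩⟩
      · exact Or.inr ⟨hp.1, h⟩
    unfold movesAt at ih ⊢
    omega

variable {G}

section Epoch

variable {e : ℕ}

lemma fromStart_iff {s : ℕ} (hs : s < G.epochLen) (p : ι) :
    G.FromStart p (e * G.epochLen + s) ↔ p ∈ G.stay (e * G.epochLen) s := by
  rw [mem_stay, FromStart]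
  have hmod : (e * G.epochLen + s) % G.epochLen = s := by
    rw [add_comm, Nat.add_mul_mod_self_right, Nat.mod_eq_of_lt hs]
  rw [hmod, Nat.add_sub_cancel]
  constructor
  · intro h i hi
    exact h _ (Finset.mem_Icc.2 ⟨by omega, by omega⟩)
  · intro h t ht
    rw [Finset.mem_Icc] at ht
    have := h (t - e * G.epochLen) (by omega)
    rwa [Nat.add_sub_cancel' ht.1] at this

lemma state_start : G.state (e * G.epochLen) = fun _ => PlayerState.init K := by
  rcases h : e * G.epochLen with _ | t
  · rfl
  · funext p
    have : (t + 1) % G.epochLen = 0 := by rw [← h]; exact Nat.mul_mod_left _ _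
    simp [state, this]

lemma state_succ {s : ℕ} (hs : s + 1 < G.epochLen) (p : ι) :
    G.state (e * G.epochLen + (s + 1)) p = (G.state (e * G.epochLen + s) p).update G.learnLen s
      (G.arm (e * G.epochLen + s) p) (G.collides (e * G.epochLen + s) p)
      (G.reward p (e * G.epochLen + s) (G.arm (e * G.epochLen + s) p)) := by
  have h1 : (e * G.epochLen + s + 1) % G.epochLen ≠ 0 := by
    rw [add_assoc, add_comm, Nat.add_mul_mod_self_right, Nat.mod_eq_of_lt hs]; omega
  have h2 : (e * G.epochLen + s) % G.epochLen = s := by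
    rw [add_comm, Nat.add_mul_mod_self_right, Nat.mod_eq_of_lt (by omega)]
  rw [← add_assoc]
  simp only [state, h1, if_false, h2]
  rfl

lemma arm_of_stay {s : ℕ} (hs : s < G.epochLen) {p : ι} (hp : p ∈ G.stay (e * G.epochLen) s) :
    G.arm (e * G.epochLen + s) p
      = (G.state (e * G.epochLen + s) p).choose (G.draw p (e * G.epochLen + s)) := by
  rw [arm, armOf, if_pos ((fromStart_iff hs p).2 hp)]

lemma collides_iff (t : ℕ) (p : ι) :
    G.collides t p = true ↔ ∃ q ∈ G.present t, q ≠ p ∧ G.arm t q = G.arm t p := by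
  simp [collides, collidesOf, arm]

/-- The remaining players, as elements of the set of those who were there at the beginning. -/
def stayers (G : Run ι K) (t₀ s : ℕ) : Finset (G.present t₀) :=
  Finset.univ.filter fun q => (q : ι) ∈ G.stay t₀ s

lemma mem_stayers {t₀ s : ℕ} {q : G.present t₀} : q ∈ G.stayers t₀ s ↔ (q : ι) ∈ G.stay t₀ s := by
  simp [stayers]

lemma stayers_anti (G : Run ι K) (t₀ : ℕ) : Antitone (G.stayers t₀) := by
  intro s s' h q hq
  rw [mem_stayers] at hq ⊢
  exact G.stay_anti t₀ h hq

lemma card_stayers_zero_le (G : Run ι K) (t₀ : ℕ) :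
    (G.stayers t₀ 0).card ≤ (G.present t₀).card :=
  (Finset.card_le_univ _).trans (Fintype.card_coe _).le

/-- The draws of the players after round `t₀`. -/
def drawsFrom (G : Run ι K) (t₀ s : ℕ) (q : G.present t₀) : Fin K := G.draw q (t₀ + s)

/-- There are no entries in the rounds `1, …, b - 1` after round `t₀`. -/
def NoEntry (G : Run ι K) (t₀ b : ℕ) : Prop :=
  ∀ i, 0 < i → i < b → G.present (t₀ + i) ⊆ G.present (t₀ + i - 1)

lemma NoEntry.present_eq {t₀ b s : ℕ} (h : G.NoEntry t₀ b) (hs : s < b) :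
    G.present (t₀ + s) = G.stay t₀ s :=
  G.present_eq_stay fun i h1 h2 => h i h1 (by omega)

/-- The memory of a player in the learning phase, in terms of the hopping process. -/
def learnMemory (G : Run ι K) (t₀ s : ℕ) (p : G.present t₀) : LearnState K where
  last := hop (G.stayers t₀) (G.drawsFrom t₀) s p
  V := fun k => hopSum (G.stayers t₀) (G.drawsFrom t₀) p (fun s => G.reward p (t₀ + s)) k s
  S := fun k => hopCount (G.stayers t₀) (G.drawsFrom t₀) p k s

lemma choose_learnMemory (t₀ s : ℕ) (p : G.present t₀) :
    (PlayerState.learn (G.learnMemory t₀ s p)).choose (G.draw p (t₀ + s))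
      = hopPlay (G.stayers t₀) (G.drawsFrom t₀) p s := by
  simp only [PlayerState.choose, LearnState.choose, learnMemory, hopPlay, hopArm, drawsFrom]
  rcases hop (G.stayers t₀) (G.drawsFrom t₀) s p with _ | j <;> rfl

/-- Matches one learning round of the algorithm with one step of the hopping process. -/
lemma update_learnMemory (t₀ s : ℕ) (p : G.present t₀) {c : Bool}
    (hc : c = true ↔ hopColl (G.stayers t₀ s) (hop (G.stayers t₀) (G.drawsFrom t₀) s)
      (G.drawsFrom t₀ s) p) :
    (G.learnMemory t₀ s p).update (hopPlay (G.stayers t₀) (G.drawsFrom t₀) p s) c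
      (G.reward p (t₀ + s) (hopPlay (G.stayers t₀) (G.drawsFrom t₀) p s))
      = G.learnMemory t₀ (s + 1) p := by
  classical
  simp only [LearnState.update, learnMemory, LearnState.mk.injEq]
  refine ⟨?_, ?_, ?_⟩
  · exact if_congr (and_congr_left' hc) rfl rfl
  · funext k
    unfold hopSum
    rw [Finset.sum_range_succ, ← hc]
    rcases c with _ | _
    · by_cases hk : hopPlay (G.stayers t₀) (G.drawsFrom t₀) p s = k
      · subst hk
        simp
      · simp [hk, Function.update_of_ne (Ne.symm hk)]
    · simp
  · funext k
    unfold hopCount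
    rw [Finset.range_add_one, Finset.filter_insert]
    by_cases hk : hopPlay (G.stayers t₀) (G.drawsFrom t₀) p s = k
    · subst hk
      rw [if_pos rfl, Finset.card_insert_of_notMem (by simp)]
      simp
    · simp [hk, Function.update_of_ne (Ne.symm hk)]

/-- Without entries everybody present has followed the algorithm since the restart, so collisions in
the game are collisions of the hopping process. The latter is indexed by the finite type of initial
players, which makes averages over draws possible. -/
lemma arm_coll_of_learn {s b : ℕ} (hs : s < G.epochLen) (hne : G.NoEntry (e * G.epochLen) b)
    (hsb : s < b)
    (hst : ∀ p ∈ G.stayers (e * G.epochLen) s,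
      G.state (e * G.epochLen + s) p = .learn (G.learnMemory (e * G.epochLen) s p)) :
    (∀ p ∈ G.stayers (e * G.epochLen) s, G.arm (e * G.epochLen + s) p
      = hopPlay (G.stayers (e * G.epochLen)) (G.drawsFrom (e * G.epochLen)) p s) ∧
    ∀ p ∈ G.stayers (e * G.epochLen) s, (G.collides (e * G.epochLen + s) p = true ↔
      hopColl (G.stayers (e * G.epochLen) s)
        (hop (G.stayers (e * G.epochLen)) (G.drawsFrom (e * G.epochLen)) s)
        (G.drawsFrom (e * G.epochLen) s) p) := by
  have harm : ∀ p ∈ G.stayers (e * G.epochLen) s, G.arm (e * G.epochLen + s) p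
      = hopPlay (G.stayers (e * G.epochLen)) (G.drawsFrom (e * G.epochLen)) p s := by
    intro p hp
    rw [arm_of_stay hs (mem_stayers.1 hp), hst p hp, choose_learnMemory]
  refine ⟨harm, fun p hp => ?_⟩
  rw [collides_iff, hne.present_eq hsb]
  constructor
  · rintro ⟨q, hq, hqp, he⟩
    have hq0 : q ∈ G.present (e * G.epochLen) := by
      have := G.stay_anti _ (Nat.zero_le s) hq
      rwa [stay_zero] at this
    have hq' : (⟨q, hq0⟩ : G.present (e * G.epochLen)) ∈ G.stayers (e * G.epochLen) s :=
      mem_stayers.2 hq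
    refine ⟨⟨q, hq0⟩, hq', fun h => hqp (congrArg Subtype.val h), ?_⟩
    have h1 := harm _ hq'
    rw [harm p hp] at he
    exact h1.symm.trans he
  · rintro ⟨q, hq, hqp, he⟩
    refine ⟨q, mem_stayers.1 hq, fun h => hqp (Subtype.ext h), ?_⟩
    rw [harm p hp, harm q hq]
    exact he

/-- The learning phase of a run is the hopping process. -/
theorem state_learn {b : ℕ} (hne : G.NoEntry (e * G.epochLen) b) {s : ℕ} (hs : s < G.epochLen)
    (hsn : s < G.learnLen) (hsb : s < b) :
    ∀ p ∈ G.stayers (e * G.epochLen) s,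
      G.state (e * G.epochLen + s) p = .learn (G.learnMemory (e * G.epochLen) s p) := by
  induction s with
  | zero =>
    intro p _
    rw [add_zero, state_start]
    simp [PlayerState.init, learnMemory, hop, hopSum, hopCount]
  | succ s ih =>
    intro p hp
    have hp' := G.stayers_anti _ (Nat.le_succ s) hp
    have ih' := ih (by omega) (by omega) (by omega)
    obtain ⟨harm, hcoll⟩ := arm_coll_of_learn (by omega) hne (by omega) ih'
    rw [state_succ hs, ih' p hp', harm p hp']
    simp only [PlayerState.update, if_pos hsn]
    rw [update_learnMemory _ _ _ (hcoll p hp')]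

/-- The memory of the remaining players at the beginning of the trekking phase. -/
theorem state_trek_start {b : ℕ} (hne : G.NoEntry (e * G.epochLen) b)
    (hnL : G.learnLen < G.epochLen) (hn : 0 < G.learnLen) (hnb : G.learnLen ≤ b)
    {p : G.present (e * G.epochLen)} (hp : p ∈ G.stayers (e * G.epochLen) (G.learnLen - 1)) :
    G.state (e * G.epochLen + G.learnLen) p = .trek (TrekState.start
      (ranking (G.learnMemory (e * G.epochLen) G.learnLen p).estimate)
      (hopPlay (G.stayers (e * G.epochLen)) (G.drawsFrom (e * G.epochLen)) p
        (G.learnLen - 1))) := by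
  obtain ⟨s, hs⟩ : ∃ s, G.learnLen = s + 1 := ⟨G.learnLen - 1, by omega⟩
  have hs1 : G.learnLen - 1 = s := by omega
  rw [hs1] at hp ⊢
  have hst := state_learn hne (s := s) (by omega) (by omega) (by omega)
  obtain ⟨harm, hcoll⟩ := arm_coll_of_learn (by omega) hne (by omega) hst
  have h1 := state_succ (e := e) (G := G) (s := s) (by omega) p
  rw [hst p hp, harm p hp] at h1
  simp only [PlayerState.update, if_neg (show ¬ s + 1 < G.learnLen by omega)] at h1
  rw [update_learnMemory _ _ _ (hcoll p hp)] at h1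
  rw [hs]
  exact h1

/-- Memories are updated for all names, present or not, so the phase depends on the round alone. -/
lemma exists_learn {s : ℕ} (hs : s < G.epochLen) (hsn : s < G.learnLen) (p : ι) :
    ∃ ℓ, G.state (e * G.epochLen + s) p = .learn ℓ := by
  induction s with
  | zero => rw [add_zero, state_start]; exact ⟨_, rfl⟩
  | succ s ih =>
    obtain ⟨ℓ, hℓ⟩ := ih (by omega) (by omega)
    rw [state_succ hs, hℓ]
    simp only [PlayerState.update, if_pos hsn]
    exact ⟨_, rfl⟩

lemma exists_trek (hn : 0 < G.learnLen) {r : ℕ} (hr : G.learnLen + r < G.epochLen) (p : ι) :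
    ∃ τ, G.state (e * G.epochLen + (G.learnLen + r)) p = .trek τ := by
  induction r with
  | zero =>
    obtain ⟨ℓ, hℓ⟩ := exists_learn (G := G) (e := e) (s := G.learnLen - 1) (by omega) (by omega) p
    have h1 := state_succ (e := e) (G := G) (s := G.learnLen - 1) (by omega) p
    rw [hℓ] at h1
    simp only [PlayerState.update, if_neg (show ¬ G.learnLen - 1 + 1 < G.learnLen by omega)] at h1
    rw [Nat.sub_add_cancel hn] at h1
    exact ⟨_, h1⟩
  | succ r ih =>
    obtain ⟨τ, hτ⟩ := ih (by omega)
    rw [← add_assoc G.learnLen, state_succ (by omega), hτ]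
    exact ⟨_, rfl⟩

end Epoch

end Run
end DynTrek
end

/-! ### Good epochs: their collisions and regret. -/

noncomputable section
namespace DynTrek
namespace Run

variable {ι : Type*} {K : ℕ} [DecidableEq ι] {G : Run ι K} {e : ℕ} {μ : Fin K → ℝ} {H b : ℕ}

/-- An epoch in which random hopping is over after `H` rounds and all estimates give the right
ranking. -/
structure GoodEpoch (G : Run ι K) (e : ℕ) (μ : Fin K → ℝ) (H : ℕ) : Prop where
  settled : ∀ q ∈ G.stayers (e * G.epochLen) H,
    hop (G.stayers (e * G.epochLen)) (G.drawsFrom (e * G.epochLen)) H q ≠ none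
  ranked : ∀ p ∈ G.stayers (e * G.epochLen) (G.learnLen - 1),
    ranking (G.learnMemory (e * G.epochLen) G.learnLen p).estimate = ranking μ

/-- The phases fit into an epoch; there are no entries in its first `b` rounds. -/
structure EpochLengths (G : Run ι K) (e H b : ℕ) : Prop where
  hop_lt : H < G.learnLen
  trek_le : 2 * G.learnLen + K * (K - 1) ≤ 2 * min b G.epochLen
  learn_lt : G.learnLen < G.epochLen
  noEntry : G.NoEntry (e * G.epochLen) b
  card_le : ∀ t, (G.present t).card ≤ K

/-- Number of collisions in round `t`. -/
def collCount (G : Run ι K) (t : ℕ) : ℕ := ((G.present t).filter fun p => G.collides t p = true).card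

/-- Regret of round `t`. -/
def roundRegret (G : Run ι K) (μ : Fin K → ℝ) (t : ℕ) : ℝ :=
  ∑ k ∈ topArms μ (G.present t).card, μ k
    - ∑ p ∈ G.present t, μ (G.arm t p) * (1 - if G.collides t p then 1 else 0)

lemma regret_eq (G : Run ι K) (μ : Fin K → ℝ) (T : ℕ) :
    G.regret μ T = ∑ t ∈ Finset.range T, G.roundRegret μ t := by
  simp only [regret, roundRegret, Finset.sum_sub_distrib]

lemma collisions_eq (G : Run ι K) (T : ℕ) :
    G.collisions T = ∑ t ∈ Finset.range T, G.collCount t := by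
  simp only [collisions, collCount, Finset.card_filter]

omit [DecidableEq ι] in
lemma EpochLengths.le_entry (h : G.EpochLengths e H b) : G.learnLen ≤ b := by
  have := h.trek_le
  omega

lemma GoodEpoch.not_hopColl (hg : G.GoodEpoch e μ H) {s : ℕ} (hs : H ≤ s)
    {p : G.present (e * G.epochLen)} (hp : p ∈ G.stayers (e * G.epochLen) s) :
    ¬ hopColl (G.stayers (e * G.epochLen) s)
      (hop (G.stayers (e * G.epochLen)) (G.drawsFrom (e * G.epochLen)) s)
      (G.drawsFrom (e * G.epochLen) s) p :=
  DynTrek.not_hopColl (G.stayers_anti _) _ s (fun q hq => hop_ne_none_of_le _ _ hs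
    (hg.settled q (G.stayers_anti _ hs hq))) hp _

lemma stayers_of_stay {t₀ s : ℕ} {p : ι} (hp : p ∈ G.stay t₀ s) :
    ∃ h : p ∈ G.present t₀, (⟨p, h⟩ : G.present t₀) ∈ G.stayers t₀ s := by
  have h0 := G.stay_anti t₀ (Nat.zero_le s) hp
  rw [stay_zero] at h0
  exact ⟨h0, mem_stayers.2 hp⟩

/-- Nobody collides while everybody hops sequentially. -/
lemma collCount_eq_zero (hl : G.EpochLengths e H b) (hg : G.GoodEpoch e μ H) {s : ℕ}
    (hs : H ≤ s) (hsn : s < G.learnLen) : G.collCount (e * G.epochLen + s) = 0 := by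
  have hsb : s < b := hsn.trans_le hl.le_entry
  have hsL := hsn.trans hl.learn_lt
  obtain ⟨-, hcoll⟩ := arm_coll_of_learn hsL hl.noEntry hsb
    (state_learn hl.noEntry hsL hsn hsb)
  rw [collCount, Finset.card_eq_zero, Finset.filter_eq_empty_iff]
  intro p hp
  rw [hl.noEntry.present_eq hsb] at hp
  obtain ⟨h0, hp'⟩ := stayers_of_stay hp
  rw [hcoll _ hp']
  exact hg.not_hopColl hs hp'

/-- After a good learning phase, the players are in a trekking phase. -/
theorem exists_trekPhase (hl : G.EpochLengths e H b) (hg : G.GoodEpoch e μ H) :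
    ∃ σ : ℕ → ι → TrekState K,
      (∀ r, G.learnLen + r < G.epochLen → ∀ p,
        G.state (e * G.epochLen + (G.learnLen + r)) p = .trek (σ r p)) ∧
      TrekPhase (ranking μ) (fun r => G.stay (e * G.epochLen) (G.learnLen + r))
        (fun r p => G.collides (e * G.epochLen + (G.learnLen + r)) p) σ
        (min b G.epochLen - G.learnLen) G.epochLen := by
  have hn : 0 < G.learnLen := by have := hl.hop_lt; omega
  have hex : ∀ p, ∃ τ, G.state (e * G.epochLen + G.learnLen) p = .trek τ := fun p =>
    exists_trek (r := 0) hn hl.learn_lt p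
  choose τ hτ using hex
  -- The recursion goes on after the end of the epoch, where the actual memory is reset; agreement
  -- is claimed only within the epoch.
  let σ : ℕ → ι → TrekState K := fun r => Nat.rec τ (fun r τ' p =>
    (τ' p).update (G.collides (e * G.epochLen + (G.learnLen + r)) p)) r
  have hσ : ∀ r, G.learnLen + r < G.epochLen → ∀ p,
      G.state (e * G.epochLen + (G.learnLen + r)) p = .trek (σ r p) := by
    intro r hr p
    induction r with
    | zero => exact hτ p
    | succ r ih =>
      rw [← add_assoc G.learnLen, state_succ (by omega), ih (by omega)]
      rfl
  refine ⟨σ, hσ, ?_, ?_, ?_, ?_, ?_⟩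
  · intro r r' h
    exact G.stay_anti _ (by omega)
  · set s := G.learnLen - 1 with hs
    have hsL : s < G.epochLen := by have := hl.learn_lt; omega
    have hsb : s < b := by have := hl.le_entry; omega
    obtain ⟨harm, -⟩ := arm_coll_of_learn hsL hl.noEntry hsb
      (state_learn hl.noEntry hsL (by omega) hsb)
    have hstay : ∀ p ∈ G.stay (e * G.epochLen) (G.learnLen + 0), p ∈ G.stay (e * G.epochLen) s :=
      fun p hp => G.stay_anti _ (by omega) hp
    refine ⟨fun p => G.arm (e * G.epochLen + s) p, ?_, ?_⟩
    · intro p hp q hq he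
      obtain ⟨hp0, hp'⟩ := stayers_of_stay (hstay p hp)
      obtain ⟨hq0, hq'⟩ := stayers_of_stay (hstay q hq)
      by_contra hne
      -- The last learning round comes no earlier than `H`, hence has no collision: the reserved
      -- arms are distinct.
      refine hg.not_hopColl (s := s) (by have := hl.hop_lt; omega) hp'
        ⟨_, hq', fun h => hne (congrArg Subtype.val h).symm, ?_⟩
      have h1 := harm _ hp'
      have h2 := harm _ hq'
      exact h2.symm.trans (he.symm.trans h1)
    · intro p hp
      obtain ⟨hp0, hp'⟩ := stayers_of_stay (hstay p hp)
      have h1 := state_trek_start hl.noEntry hl.learn_lt hn hl.le_entry hp'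
      rw [hg.ranked _ hp', ← harm _ hp'] at h1
      have h2 := hσ 0 hl.learn_lt p
      rw [add_zero, h1] at h2
      exact (PlayerState.trek.inj h2).symm
  · intro r hr p
    rfl
  · intro r hr p hp
    have hrL : G.learnLen + r < G.epochLen := by
      have := min_le_right b G.epochLen; omega
    have hrb : G.learnLen + r < b := by
      have := min_le_left b G.epochLen; omega
    have harm : ∀ p ∈ G.stay (e * G.epochLen) (G.learnLen + r),
        G.arm (e * G.epochLen + (G.learnLen + r)) p = (σ r p).choose := by
      intro p hp
      rw [arm_of_stay hrL hp, hσ r hrL p]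
      rfl
    rw [collides_iff, hl.noEntry.present_eq hrb]
    refine exists_congr fun q => and_congr_right fun hq => and_congr_right fun _ => ?_
    rw [harm q hq, harm p hp]
  · have := hl.trek_le
    omega

/-- The collisions in the learning and trekking phases of a good epoch. -/
theorem sum_collCount_le (hl : G.EpochLengths e H b) (hg : G.GoodEpoch e μ H) {N : ℕ}
    (hN : N ≤ G.epochLen) :
    ∑ s ∈ (Finset.range N).filter (· < b), G.collCount (e * G.epochLen + s) ≤ K * H + 2 * K := by
  obtain ⟨σ, -, ht⟩ := exists_trekPhase hl hg
  set M := min b G.epochLen - G.learnLen with hM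
  have hnM : G.learnLen ≤ min b G.epochLen := le_min hl.le_entry hl.learn_lt.le
  have hcle : ∀ t, G.collCount t ≤ K := fun t =>
    (Finset.card_filter_le _ _).trans (hl.card_le t)
  have hsub : (Finset.range N).filter (· < b)
      ⊆ Finset.range G.learnLen ∪ (Finset.range M).image (G.learnLen + ·) := by
    intro s hs
    rw [Finset.mem_filter, Finset.mem_range] at hs
    rw [Finset.mem_union, Finset.mem_range, Finset.mem_image]
    rcases Nat.lt_or_ge s G.learnLen with h | h
    · exact Or.inl h
    · refine Or.inr ⟨s - G.learnLen, ?_, by omega⟩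
      have : s < min b G.epochLen := lt_min hs.2 (by omega)
      rw [Finset.mem_range]; omega
  have hlearn : ∑ s ∈ Finset.range G.learnLen, G.collCount (e * G.epochLen + s) ≤ K * H := by
    rw [← Finset.sum_range_add_sum_Ico _ hl.hop_lt.le]
    have h1 : ∑ s ∈ Finset.range H, G.collCount (e * G.epochLen + s) ≤ H * K := by
      refine (Finset.sum_le_card_nsmul _ _ K fun s _ => hcle _).trans ?_
      rw [Finset.card_range, smul_eq_mul]
    have h2 : ∑ s ∈ Finset.Ico H G.learnLen, G.collCount (e * G.epochLen + s) = 0 := by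
      refine Finset.sum_eq_zero fun s hs => ?_
      rw [Finset.mem_Ico] at hs
      exact collCount_eq_zero hl hg hs.1 hs.2
    rw [h2, mul_comm K H]; omega
  have htrek : ∑ s ∈ (Finset.range M).image (G.learnLen + ·), G.collCount (e * G.epochLen + s)
      ≤ 2 * K := by
    rw [Finset.sum_image fun i _ j _ h => Nat.add_left_cancel h]
    have hlast : ∀ r < M, G.learnLen + r < min b G.epochLen := fun r hr => by omega
    have hcc : ∀ r < M, G.collCount (e * G.epochLen + (G.learnLen + r))
        = ((G.stay (e * G.epochLen) (G.learnLen + r)).filter fun p =>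
            G.collides (e * G.epochLen + (G.learnLen + r)) p = true).card := by
      intro r hr
      rw [collCount, hl.noEntry.present_eq ((hlast r hr).trans_le (min_le_left _ _))]
    rw [Finset.sum_congr rfl fun r hr => hcc r (Finset.mem_range.1 hr)]
    have hA0 : (G.stay (e * G.epochLen) (G.learnLen + 0)).card ≤ K :=
      (Finset.card_le_card (G.stay_subset _ _)).trans (hl.card_le _)
    exact (ht.sum_card_coll_le le_rfl (by omega)).trans (by omega)
  have hunion := Finset.sum_union_inter (s₁ := Finset.range G.learnLen)
    (s₂ := (Finset.range M).image (G.learnLen + ·))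
    (f := fun s => G.collCount (e * G.epochLen + s))
  have hle := Finset.sum_le_sum_of_subset (f := fun s => G.collCount (e * G.epochLen + s)) hsub
  omega

/-- In the later rounds of a good epoch, collisions and regret are due to entries and departures
since its beginning. -/
theorem late_round_le (hμ : ∀ k, μ k ∈ Set.Icc (0 : ℝ) 1) (hl : G.EpochLengths e H b)
    (hg : G.GoodEpoch e μ H) {s : ℕ} (hbs : b ≤ s) (hsL : s < G.epochLen) :
    G.collCount (e * G.epochLen + s)
        ≤ 2 * ∑ i ∈ Finset.range s, movesAt G.present (e * G.epochLen + i) ∧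
    G.roundRegret μ (e * G.epochLen + s)
        ≤ 2 * (∑ i ∈ Finset.range s, movesAt G.present (e * G.epochLen + i) : ℕ) := by
  obtain ⟨σ, hσ, ht⟩ := exists_trekPhase hl hg
  obtain ⟨r, rfl⟩ : ∃ r, s = G.learnLen + r :=
    ⟨s - G.learnLen, by have := hl.le_entry; omega⟩
  set t := e * G.epochLen + (G.learnLen + r) with htdef
  set F := G.stay (e * G.epochLen) (G.learnLen + r) with hF
  have hrR : r ≤ G.epochLen := by omega
  -- `b` leaves at least `K (K - 1) / 2` rounds after learning, so everybody who stayed is locked by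
  -- now.
  have hKr : K * (K - 1) ≤ 2 * r := by
    have := hl.trek_le
    have := min_le_left b G.epochLen
    omega
  have hlock : ∀ p ∈ F, (σ r p).locked = true := fun p hp => ht.locked hrR hKr hp
  have hinv := ht.inv hrR
  have harm : ∀ p ∈ F, G.arm t p = ranking μ (σ r p).J := by
    intro p hp
    rw [htdef, arm_of_stay hsL hp, hσ r hsL p]
    change (σ r p).choose = _
    rw [TrekState.choose_of_locked (hlock p hp), hinv.list p hp]
  have hinj : Set.InjOn (G.arm t) F := by
    intro p hp q hq he
    rw [harm p hp, harm q hq] at he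
    exact hinv.inj p hp q hq (congrArg Fin.val ((ranking μ).injective he))
  have hsub : F ⊆ G.present t := G.stay_subset _ _
  have hc : ∀ p ∈ G.present t, (G.collides t p = true ↔
      ∃ q ∈ G.present t, q ≠ p ∧ G.arm t q = G.arm t p) := fun p _ => collides_iff t p
  have htop : ∀ p ∈ F, G.arm t p ∈ topArms μ (G.present (e * G.epochLen)).card := by
    intro p hp
    rw [harm p hp, topArms, Finset.mem_filter, Equiv.symm_apply_apply]
    refine ⟨Finset.mem_univ _, (ht.J_lt_card hrR hp (hlock p hp)).trans_le ?_⟩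
    rw [← stay_zero]
    exact Finset.card_le_card (G.stay_anti _ (Nat.zero_le _))
  have hmoves : ((G.present (e * G.epochLen)).card - F.card) + (G.present t \ F).card
      ≤ ∑ i ∈ Finset.range (G.learnLen + r), movesAt G.present (e * G.epochLen + i) :=
    G.departed_add_entered_le (e * G.epochLen) (G.learnLen + r)
  constructor
  · exact (round_coll_le hsub hc hinj).trans (by omega)
  · refine (round_regret_le_of_topArms hμ hsub hc hinj htop).trans ?_
    have : ((((G.present (e * G.epochLen)).card - F.card : ℕ) : ℝ) + (G.present t \ F).card)
        ≤ ((∑ i ∈ Finset.range (G.learnLen + r), movesAt G.present (e * G.epochLen + i) : ℕ) : ℝ) := by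
      exact_mod_cast hmoves
    linarith

lemma card_range_filter_not_lt (N b : ℕ) :
    ((Finset.range N).filter fun s => ¬ s < b).card = N - b := by
  have : (Finset.range N).filter (fun s => ¬ s < b) = Finset.Ico b N := by
    ext s; simp only [Finset.mem_filter, Finset.mem_range, Finset.mem_Ico]; omega
  rw [this, Nat.card_Ico]

lemma sum_movesAt_mono (present : ℕ → Finset ι) (t₀ : ℕ) {s N : ℕ} (hs : s < N) :
    ∑ i ∈ Finset.range s, movesAt present (t₀ + i)
      ≤ ∑ i ∈ Finset.range (N - 1), movesAt present (t₀ + i) :=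
  Finset.sum_le_sum_of_subset (Finset.range_subset_range.2 (by omega))

/-- Collisions in the first `N` rounds of a good epoch. -/
theorem epoch_collisions_le (hμ : ∀ k, μ k ∈ Set.Icc (0 : ℝ) 1) (hl : G.EpochLengths e H b)
    (hg : G.GoodEpoch e μ H) {N : ℕ} (hN : N ≤ G.epochLen) :
    ∑ s ∈ Finset.range N, G.collCount (e * G.epochLen + s) ≤ K * H + 2 * K
      + 2 * (∑ i ∈ Finset.range (N - 1), movesAt G.present (e * G.epochLen + i)) * (N - b) := by
  rw [← Finset.sum_filter_add_sum_filter_not _ (· < b)]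
  refine add_le_add (sum_collCount_le hl hg hN) ?_
  refine (Finset.sum_le_card_nsmul _ _ (2 * (∑ i ∈ Finset.range (N - 1),
    movesAt G.present (e * G.epochLen + i))) fun s hs => ?_).trans (le_of_eq ?_)
  · rw [Finset.mem_filter, Finset.mem_range] at hs
    refine (late_round_le hμ hl hg (not_lt.1 hs.2) (by omega)).1.trans ?_
    exact Nat.mul_le_mul_left _ (sum_movesAt_mono _ _ hs.1)
  · rw [card_range_filter_not_lt, smul_eq_mul, mul_comm]

/-- Regret in the first `N` rounds of a good epoch. -/
theorem epoch_regret_le (hμ : ∀ k, μ k ∈ Set.Icc (0 : ℝ) 1) (hl : G.EpochLengths e H b)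
    (hg : G.GoodEpoch e μ H) {N : ℕ} (hN : N ≤ G.epochLen) :
    ∑ s ∈ Finset.range N, G.roundRegret μ (e * G.epochLen + s)
      ≤ ((K : ℝ) * min N b + K * H + 2 * K) / 2
      + 2 * (∑ i ∈ Finset.range (N - 1), movesAt G.present (e * G.epochLen + i) : ℕ)
        * (N - b : ℕ) := by
  rw [← Finset.sum_filter_add_sum_filter_not _ (· < b)]
  refine add_le_add ?_ ?_
  -- Learning and trekking are charged only half of `K` plus the collisions of the round.
  · have h1 : ∀ s ∈ (Finset.range N).filter (· < b), G.roundRegret μ (e * G.epochLen + s)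
        ≤ ((K : ℝ) + G.collCount (e * G.epochLen + s)) / 2 := fun s _ =>
      round_regret_le hμ fun p _ => collides_iff _ p
    refine (Finset.sum_le_sum h1).trans ?_
    have h2 : ((Finset.range N).filter (· < b)).card = min N b := by
      have : (Finset.range N).filter (· < b) = Finset.range (min N b) := by
        ext s; simp only [Finset.mem_filter, Finset.mem_range]; omega
      rw [this, Finset.card_range]
    have h3 : ((∑ s ∈ (Finset.range N).filter (· < b), G.collCount (e * G.epochLen + s) : ℕ) : ℝ)
        ≤ K * H + 2 * K := by exact_mod_cast sum_collCount_le hl hg hN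
    rw [← Finset.sum_div, Finset.sum_add_distrib, Finset.sum_const, nsmul_eq_mul, h2,
      ← Nat.cast_sum]
    push_cast at h3 ⊢
    nlinarith
  · refine (Finset.sum_le_card_nsmul _ _ (2 * ((∑ i ∈ Finset.range (N - 1),
      movesAt G.present (e * G.epochLen + i) : ℕ) : ℝ)) fun s hs => ?_).trans (le_of_eq ?_)
    · rw [Finset.mem_filter, Finset.mem_range] at hs
      refine (late_round_le hμ hl hg (not_lt.1 hs.2) (by omega)).2.trans ?_
      have := sum_movesAt_mono G.present (e * G.epochLen) hs.1
      have h2 : ((∑ i ∈ Finset.range s, movesAt G.present (e * G.epochLen + i) : ℕ) : ℝ)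
        ≤ ((∑ i ∈ Finset.range (N - 1), movesAt G.present (e * G.epochLen + i) : ℕ) : ℝ) := by
        exact_mod_cast this
      linarith
    · rw [card_range_filter_not_lt, nsmul_eq_mul, mul_comm]

end Run
end DynTrek
end

noncomputable section
namespace DynTrek

/-! ### Numerical estimates -/

section Numeric

/-- Bounds on the lengths: `B` is the length of learning and trekking, `τ` the length of random
hopping, `H` a quarter of it, and `l` the logarithm in the length of the learning phase. -/
structure LengthBounds (K τ H : ℕ) (l B : ℝ) : Prop where
  two_le : 2 ≤ K
  five_le : 5 ≤ l
  four_mul_le : 4 * H ≤ τ + 3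
  le_four_mul : (τ : ℝ) ≤ 4 * K * l + 1
  le_total : (τ : ℝ) + 2 * K * (K - 1) ^ 2 * l + K ^ 2 / 2 + 1 ≤ B

variable {K τ H : ℕ} {l B : ℝ}

/-- The constant `13` is what three epochs (`E = 2`) need in `EpochSplit.cost_lt`. -/
lemma LengthBounds.three_mul_add_lt (h : LengthBounds K τ H l B) : 3 * (H : ℝ) + 13 < B := by
  have hK : (2 : ℝ) ≤ K := by exact_mod_cast h.two_le
  have h1 : 4 * (H : ℝ) ≤ τ + 3 := by exact_mod_cast h.four_mul_le
  have h2 : 4 ≤ 2 * (K : ℝ) * (K - 1) ^ 2 := by nlinarith [sq_nonneg ((K : ℝ) - 2)]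
  have h3 := h.five_le
  have h4 : 4 * l ≤ 2 * (K : ℝ) * (K - 1) ^ 2 * l :=
    mul_le_mul_of_nonneg_right h2 (by linarith)
  have h5 := h.le_total
  have h6 : (0 : ℝ) ≤ τ := Nat.cast_nonneg _
  nlinarith

/-- `H` is at most about `K l`, so the leading term on the left is `6 K² l`, which is below the part
`16 K (K - 1)² l` of `8 B`. -/
lemma LengthBounds.mul_lt (h : LengthBounds K τ H l B) : 3 * (K : ℝ) * (2 * H + 7) < 8 * B := by
  have hK : (2 : ℝ) ≤ K := by exact_mod_cast h.two_le
  have h1 : 4 * (H : ℝ) ≤ τ + 3 := by exact_mod_cast h.four_mul_le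
  have h2 := h.le_four_mul
  have h3 := h.five_le
  have h5 := h.le_total
  have h6 : (0 : ℝ) ≤ τ := Nat.cast_nonneg _
  have h7 : (K : ℝ) * (4 * H) ≤ K * (4 * K * l + 4) :=
    mul_le_mul_of_nonneg_left (by linarith) (by linarith)
  have h8 : 4 ≤ 16 * ((K : ℝ) - 1) ^ 2 - 6 * K := by nlinarith
  have h9 : (K : ℝ) * 5 * 4 ≤ K * l * (16 * ((K : ℝ) - 1) ^ 2 - 6 * K) := by
    have : (K : ℝ) * 5 ≤ K * l := mul_le_mul_of_nonneg_left h3 (by linarith)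
    exact mul_le_mul this h8 (by norm_num) (by nlinarith)
  nlinarith [sq_nonneg ((K : ℝ) - 1)]

/-- Ensures that an epoch has length at least `2 (K + 1)`, hence that there are at most `T / (K +
1)` epochs. -/
lemma LengthBounds.add_lt (h : LengthBounds K τ H l B) : 4 * (K : ℝ) + 6 ≤ B := by
  have hK : (2 : ℝ) ≤ K := by exact_mod_cast h.two_le
  have h3 := h.five_le
  have h5 := h.le_total
  have h6 : (0 : ℝ) ≤ τ := Nat.cast_nonneg _
  have h2 : 2 * (K : ℝ) ≤ 2 * (K : ℝ) * (K - 1) ^ 2 := by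
    have : (1 : ℝ) ≤ (K - 1) ^ 2 := by nlinarith
    nlinarith
  have h4 : 2 * (K : ℝ) * 5 ≤ 2 * (K : ℝ) * (K - 1) ^ 2 * l :=
    mul_le_mul h2 h3 (by norm_num) (by positivity)
  nlinarith

/-- The horizon `T` consists of `E` epochs of length `L = ⌊D⌋` and another one of length `N`. -/
structure EpochSplit (K T E L N b : ℕ) (B D : ℝ) : Prop where
  eq : T = E * L + N
  pos : 1 ≤ N
  le : N ≤ L
  le_epoch : (L : ℝ) ≤ D
  epoch_lt : D < L + 1
  le_horizon : D ≤ T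
  phases_le : B ≤ D
  lt_phases : (b : ℝ) < B + 1
  sq_le : 2 * D ^ 2 ≤ T * K * B

variable {T E L N b : ℕ} {D : ℝ}

/-- There are at most `2 T / D` epochs. -/
lemma EpochSplit.epochs_le (h : EpochSplit K T E L N b B D) (hD : 0 < D) :
    ((E : ℝ) + 1) ≤ 2 * (T / D) := by
  have h1 : (T : ℝ) = E * L + N := by exact_mod_cast h.eq
  have h2 : (1 : ℝ) ≤ N := by exact_mod_cast h.pos
  have h3 := h.le_horizon
  have h4 := h.epoch_lt
  have h5 : (1 : ℝ) ≤ L := by exact_mod_cast h.pos.trans h.le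
  rw [← mul_div_assoc, le_div_iff₀ hD]
  rcases Nat.eq_zero_or_pos E with hE | hE
  · subst hE; simp; linarith
  · have hE1 : (1 : ℝ) ≤ E := by exact_mod_cast hE
    have : ((E : ℝ) + 1) * D ≤ (E + 1) * (L + 1) := by gcongr
    -- `2 (E L + 1) - (E + 1) (L + 1) = (E - 1) (L - 1)`.
    nlinarith [mul_nonneg (sub_nonneg.2 hE1) (sub_nonneg.2 h5)]

/-- If `β = B / D` is small, the square-root choice of the epoch length forces a long horizon: `2 D
≤ T K β` and `2 B² ≤ (2 H + 7) D` give `4 B² ≤ K (2 H + 7) β T`, and `hf` removes a factor `B`. -/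
lemma two_epochs_cost_le {B D K H T β : ℝ} (hBe : β * D = B) (hB : 0 < B) (hβ : 0 < β)
    (hK : 0 < K) (hH : 0 ≤ H) (hq : 2 * B * β ≤ 2 * H + 7) (hf : 3 * K * (2 * H + 7) < 8 * B)
    (hsq : 2 * D ^ 2 ≤ T * K * B) : 3 * B ≤ 2 * (β * T) := by
  have hD : 0 < D := by
    by_contra h
    have := mul_nonpos_of_nonneg_of_nonpos hβ.le (not_lt.1 h)
    linarith
  have e2 : 2 * D * B ≤ T * K * β * B := by
    have := mul_le_mul_of_nonneg_right hsq hβ.le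
    calc 2 * D * B = 2 * D ^ 2 * β := by rw [← hBe]; ring
      _ ≤ T * K * B * β := this
      _ = _ := by ring
  have e3 : 2 * D ≤ T * K * β := le_of_mul_le_mul_right e2 hB
  have e4 : 2 * B * B ≤ (2 * H + 7) * D := by
    have := mul_le_mul_of_nonneg_right hq hD.le
    calc 2 * B * B = 2 * B * β * D := by rw [mul_assoc (2 * B) β D, hBe]
      _ ≤ _ := this
  have hc : 0 < 2 * H + 7 := by linarith
  have e5 := mul_le_mul_of_nonneg_left e3 hc.le
  by_contra hlt
  have hlt := not_le.1 hlt
  have e6 := mul_lt_mul_of_pos_left hlt (mul_pos hc hK)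
  have e7 := mul_lt_mul_of_pos_right hf hB
  linarith

/-- The cost of the learning and trekking phases of all epochs. -/
lemma EpochSplit.cost_lt (h : EpochSplit K T E L N b B D) (hl : LengthBounds K τ H l B) :
    (E : ℝ) * (min L b : ℕ) + (min N b : ℕ) + (E + 1) * (H + 2) < 2 * B * (T / D) := by
  have f1 := hl.three_mul_add_lt
  have f3 := hl.mul_lt
  have hK : (2 : ℝ) ≤ K := by exact_mod_cast hl.two_le
  have hH : (0 : ℝ) ≤ H := Nat.cast_nonneg _
  have hB : 13 < B := by linarith
  have h1 : (T : ℝ) = E * L + N := by exact_mod_cast h.eq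
  have h2 : (1 : ℝ) ≤ N := by exact_mod_cast h.pos
  have hTD := h.le_horizon
  have hDL := h.epoch_lt
  have hLD := h.le_epoch
  have hBD := h.phases_le
  have hb := h.lt_phases
  have hD : 0 < D := by linarith
  have hLb : ((min L b : ℕ) : ℝ) ≤ b := by exact_mod_cast min_le_right L b
  set m : ℝ := ((min N b : ℕ) : ℝ) with hm
  have hmb : m ≤ b := by rw [hm]; exact_mod_cast min_le_right N b
  have hmN : m ≤ N := by rw [hm]; exact_mod_cast min_le_left N b
  have hm0 : 0 ≤ m := by rw [hm]; exact Nat.cast_nonneg _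
  have hBD1 : B / D ≤ 1 := (div_le_one hD).2 hBD
  have hBD0 : 0 < B / D := by positivity
  rw [show 2 * B * (T / D) = 2 * (B / D) * T by ring]
  have hBe : B / D * D = B := by field_simp
  set β := B / D with hβ
  -- With few epochs the rounding losses matter most. For `E = 0` the bounds on `D` force `T = D`.
  rcases Nat.lt_or_ge E 2 with hE | hE
  · interval_cases E
    · -- one epoch
      simp only [Nat.cast_zero, zero_mul, zero_add, one_mul] at h1 ⊢
      nlinarith
    · -- two epochs
      simp only [Nat.cast_one, one_mul] at h1 ⊢
      have hT : D - 1 + m ≤ T := by linarith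
      have hrhs : 2 * β * (D - 1 + m) ≤ 2 * β * T := by gcongr
      suffices hgoal : B + m + 2 * H + 5 < 2 * β * T by linarith
      -- The goal is affine in `m`, the part of learning and trekking in the second epoch: the worst
      -- case is `m = 0` if `2 β ≥ 1`, and `m = B + 1` otherwise.
      rcases le_total 1 (2 * β) with hc | hc
      · nlinarith
      · by_cases hq : 2 * H + 7 < 2 * B * β
        · have hmB : m ≤ B + 1 := by linarith
          have := mul_le_mul_of_nonneg_right hmB (sub_nonneg.2 hc)
          nlinarith
        · have := two_epochs_cost_le hBe (by linarith) hBD0 (by linarith) hH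
            (not_lt.1 hq) f3 h.sq_le
          linarith
  · have hE2 : (2 : ℝ) ≤ E := by exact_mod_cast hE
    have hT : (E : ℝ) * (D - 1) ≤ T := by nlinarith
    have hrhs : 2 * β * (E * (D - 1)) ≤ 2 * β * T := by gcongr
    have hlow : (E : ℝ) * (2 * B - 2) ≤ 2 * β * (E * (D - 1)) := by
      have : 2 * B - 2 ≤ 2 * β * (D - 1) := by nlinarith
      nlinarith
    have hL2 : (E : ℝ) * (min L b : ℕ) ≤ E * (B + 1) :=
      mul_le_mul_of_nonneg_left (by linarith) (by linarith)
    -- The surplus is at least `(E - 2) (B - H - 5) + (B - 3 H - 13)`.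
    nlinarith [mul_nonneg (sub_nonneg.2 hE2) (show 0 ≤ B - H - 5 by linarith)]

end Numeric

/-! ### The lengths of the phases -/

section Lengths

variable {K : ℕ} {T : ℕ} {δ ε : ℝ}

lemma log_one_sub_neg (hK : 2 ≤ K) : Real.log (1 - 1 / (4 * K)) < 0 := by
  have hK' : (2 : ℝ) ≤ K := by exact_mod_cast hK
  refine Real.log_neg ?_ ?_
  · rw [sub_pos, div_lt_one (by linarith)]; linarith
  · have : (0 : ℝ) < 1 / (4 * K) := by positivity
    linarith

/-- After a quarter of the random hopping sub-phase, the probability that somebody hops randomly is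
small. -/
lemma mul_pow_le_of_Trh (hK : 2 ≤ K) (hδ : 0 < δ) {H : ℕ} (hH : Trh K δ ≤ 4 * H) :
    (K : ℝ) * (1 - 1 / K) ^ H ≤ δ := by
  have hK' : (2 : ℝ) ≤ K := by exact_mod_cast hK
  have hlog := log_one_sub_neg hK
  have h0 : (0 : ℝ) < 1 - 1 / (4 * K) := by
    rw [sub_pos, div_lt_one (by linarith)]; linarith
  have h1 : Real.log (δ / K) / Real.log (1 - 1 / (4 * K)) ≤ (4 * H : ℕ) :=
    (Nat.le_ceil _).trans (Nat.cast_le.2 hH)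
  rw [div_le_iff_of_neg hlog, ← Real.log_pow, Real.log_le_log_iff (by positivity) (by positivity),
    pow_mul, le_div_iff₀ (by linarith)] at h1
  -- Bernoulli's inequality; this is why a quarter of the rounds suffices.
  have hb : (1 : ℝ) - 1 / K ≤ (1 - 1 / (4 * K)) ^ 4 := by
    have := one_add_mul_le_pow (a := -(1 / (4 * (K : ℝ)))) (by
      have : 1 / (4 * (K : ℝ)) ≤ 1 := by rw [div_le_one (by linarith)]; linarith
      linarith) 4
    refine le_trans (le_of_eq ?_) (this.trans (le_of_eq (by ring)))
    push_cast
    field_simp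
    ring
  have hν : (0 : ℝ) ≤ 1 - 1 / K := by
    rw [sub_nonneg, div_le_one (by linarith)]; linarith
  have := pow_le_pow_left₀ hν hb H
  nlinarith

/-- From `log (1 - y) ≤ -y`. -/
lemma Trh_le (hK : 2 ≤ K) (hδ0 : 0 < δ) (hδ : δ ≤ 1) :
    (Trh K δ : ℝ) ≤ 4 * K * Real.log (K / δ) + 1 := by
  have hK' : (2 : ℝ) ≤ K := by exact_mod_cast hK
  have hlog := log_one_sub_neg hK
  have h0 : (0 : ℝ) < 1 - 1 / (4 * K) := by
    rw [sub_pos, div_lt_one (by linarith)]; linarith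
  have h1 : Real.log (1 - 1 / (4 * K)) ≤ -(1 / (4 * K)) := by
    have := Real.log_le_sub_one_of_pos h0
    linarith
  have hKδ : 0 ≤ Real.log (K / δ) := Real.log_nonneg (by rw [le_div_iff₀ hδ0]; linarith)
  have h2 : Real.log (δ / K) = -Real.log (K / δ) := by rw [← Real.log_inv, inv_div]
  have h3 : Real.log (δ / K) / Real.log (1 - 1 / (4 * K)) ≤ 4 * K * Real.log (K / δ) := by
    rw [div_le_iff_of_neg hlog, h2]
    have h4 := mul_le_mul_of_nonneg_left h1 (show 0 ≤ 4 * K * Real.log (K / δ) by positivity)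
    refine h4.trans (le_of_eq ?_)
    field_simp
  have h5 : 0 ≤ Real.log (δ / K) / Real.log (1 - 1 / (4 * K)) := by
    rw [h2]
    exact div_nonneg_of_nonpos (by linarith) hlog.le
  have := Nat.ceil_lt_add_one h5
  unfold Trh
  linarith

lemma T0_eq (K T : ℕ) (ε δ : ℝ) : T0 K ε (δ / T) = Trh K (δ / (2 * T))
    + 2 * K / ε ^ 2 * Real.log (4 * K ^ 2 * T / δ) := by
  rw [T0, div_div_eq_mul_div, div_div, mul_comm (T : ℝ) 2]

/-- The lengths satisfy the bounds that are needed. -/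
lemma lengthBounds (hK : 2 ≤ K) (hδ : δ ∈ Set.Ioo (0 : ℝ) 1) (hε0 : 0 < ε)
    (hεK : ε * (K - 1) ≤ 1) (hT : T0 K ε (δ / T) + Ttr K ≤ T) :
    LengthBounds K (Trh K (δ / (2 * T))) ((Trh K (δ / (2 * T)) + 3) / 4)
      (Real.log (4 * K ^ 2 * T / δ)) (T0 K ε (δ / T) + Ttr K) := by
  have hK' : (2 : ℝ) ≤ K := by exact_mod_cast hK
  obtain ⟨hδ0, hδ1⟩ := hδ
  -- At `T = 0` the quotients and logarithms take the value `0`, and `Ttr` alone exceeds the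
  -- horizon.
  have hTpos : 1 ≤ T := by
    by_contra h
    have h0 : T = 0 := by omega
    subst h0
    rw [T0_eq] at hT
    simp only [Nat.cast_zero, mul_zero, zero_div, Real.log_zero, add_zero, Ttr] at hT
    have : (0 : ℝ) ≤ Trh K (δ / 0) := Nat.cast_nonneg _
    nlinarith
  have hT1 : (1 : ℝ) ≤ T := by exact_mod_cast hTpos
  set l := Real.log (4 * K ^ 2 * T / δ) with hl
  have harg : ∀ y : ℝ, y ≤ T → 1 ≤ y → 16 * y ≤ 4 * K ^ 2 * T / δ := by
    intro y hy hy1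
    rw [le_div_iff₀ hδ0]
    have : 16 * y ≤ 4 * (K : ℝ) ^ 2 * T := by
      have : (4 : ℝ) ≤ K ^ 2 := by nlinarith
      nlinarith
    nlinarith
  have hl2 : 2 ≤ l := by
    rw [hl, Real.le_log_iff_exp_le (by positivity)]
    refine le_trans ?_ (harg 1 hT1 le_rfl)
    have h1 := Real.exp_one_lt_d9
    have h2 : Real.exp 2 = Real.exp 1 ^ 2 := by rw [← Real.exp_nat_mul]; norm_num
    rw [h2]
    nlinarith [Real.exp_pos 1]
  have hmain : (Trh K (δ / (2 * T)) : ℝ) + 2 * K * (K - 1) ^ 2 * l + K ^ 2 / 2 + 1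
      ≤ T0 K ε (δ / T) + Ttr K := by
    rw [T0_eq, Ttr, ← hl]
    have h1 : ((K : ℝ) - 1) ^ 2 ≤ 1 / ε ^ 2 := by
      rw [le_div_iff₀ (by positivity), ← mul_pow]
      have : 0 ≤ ((K : ℝ) - 1) * ε := mul_nonneg (by linarith) hε0.le
      nlinarith
    have h2 : 2 * (K : ℝ) * (K - 1) ^ 2 * l ≤ 2 * K / ε ^ 2 * l := by
      refine mul_le_mul_of_nonneg_right ?_ (by linarith)
      calc 2 * (K : ℝ) * (K - 1) ^ 2 ≤ 2 * K * (1 / ε ^ 2) := by gcongr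
        _ = _ := by ring
    linarith
  -- Bootstrap: `2 ≤ l` makes learning and trekking, hence `T`, at least `11` rounds long, and `exp
  -- 5 ≤ 16 * 11`.
  have hl5 : 5 ≤ l := by
    have h1 : 4 ≤ 2 * (K : ℝ) * (K - 1) ^ 2 := by nlinarith [sq_nonneg ((K : ℝ) - 2)]
    have h2 : 4 * 2 ≤ 2 * (K : ℝ) * (K - 1) ^ 2 * l :=
      mul_le_mul h1 hl2 (by norm_num) (by linarith)
    have h3 : (0 : ℝ) ≤ Trh K (δ / (2 * T)) := Nat.cast_nonneg _
    have h4 : (11 : ℝ) ≤ T := by nlinarith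
    rw [hl, Real.le_log_iff_exp_le (by positivity)]
    refine le_trans ?_ (harg 11 h4 (by norm_num))
    have h5 := Real.exp_one_lt_d9
    have h6 : Real.exp 5 = Real.exp 1 ^ 5 := by rw [← Real.exp_nat_mul]; norm_num
    rw [h6]
    calc Real.exp 1 ^ 5 ≤ 2.7182818286 ^ 5 := by gcongr
      _ ≤ _ := by norm_num
  refine ⟨hK, hl5, by omega, ?_, hmain⟩
  have h1 : δ / (2 * T) ≤ 1 := by rw [div_le_one (by linarith)]; linarith
  refine (Trh_le hK (by positivity) h1).trans ?_
  have h2 : Real.log (K / (δ / (2 * T))) ≤ l := by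
    rw [hl]
    refine Real.log_le_log (by positivity) ?_
    rw [div_div_eq_mul_div]
    exact div_le_div_of_nonneg_right (by nlinarith) hδ0.le
  have := mul_le_mul_of_nonneg_left h2 (show (0 : ℝ) ≤ 4 * K by linarith)
  linarith

end Lengths
end DynTrek
end

noncomputable section
namespace DynTrek

/-! ### Rankings and gaps -/

section Ranking

variable {K : ℕ} {μ : Fin K → ℝ}

/-- Strict inequalities between consecutive positions determine the sorted list; ties play no role.
-/
lemma ranking_eq_of_lt {v : Fin K → ℝ} {π : Equiv.Perm (Fin K)}
    (h : ∀ i j : Fin K, (i : ℕ) + 1 = j → v (π j) < v (π i)) : ranking v = π := by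
  have hmono : StrictMono ((fun k => - v k) ∘ π) := by
    cases K with
    | zero => exact fun i => i.elim0
    | succ m =>
      rw [Fin.strictMono_iff_lt_succ]
      intro i
      exact neg_lt_neg (h _ _ (by simp))
  refine (Tuple.eq_sort_iff.2 ⟨hmono.monotone, fun i j hij he => ?_⟩).symm
  exact absurd he (hmono hij).ne

lemma lt_sub_of_lt_minGap {ε : ℝ} (hε : ε < minGap μ) {i j : Fin K} (hij : (i : ℕ) + 1 = j) :
    ε < μ (ranking μ i) - μ (ranking μ j) := by
  have hj := j.2
  have := ciInf_le (Set.finite_range fun i : Fin (K - 1) =>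
    μ (ranking μ ⟨i, by have := i.2; omega⟩) - μ (ranking μ ⟨i + 1, by have := i.2; omega⟩)).bddBelow
    (⟨i, by omega⟩ : Fin (K - 1))
  refine hε.trans_le (this.trans (le_of_eq ?_))
  congr 3
  exact Fin.ext hij

/-- The best and the worst mean are `K - 1` gaps apart and both lie in `[0, 1]`. -/
lemma mul_sub_one_le_one (hK : 2 ≤ K) (hμ : ∀ k, μ k ∈ Set.Icc (0 : ℝ) 1) {ε : ℝ}
    (hε : ε < minGap μ) : ε * ((K : ℝ) - 1) ≤ 1 := by
  have key : ∀ i (hi : i < K), ε * i ≤ μ (ranking μ ⟨0, by omega⟩) - μ (ranking μ ⟨i, hi⟩) := by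
    intro i
    induction i with
    | zero => intro hi; simp
    | succ i ih =>
      intro hi
      have h1 := ih (by omega)
      have h2 := lt_sub_of_lt_minGap hε (i := ⟨i, by omega⟩) (j := ⟨i + 1, hi⟩) rfl
      push_cast
      linarith
  have h := key (K - 1) (by omega)
  rw [Nat.cast_sub (by omega), Nat.cast_one] at h
  have h1 := (hμ (ranking μ ⟨0, by omega⟩)).2
  have h2 := (hμ (ranking μ ⟨K - 1, by omega⟩)).1
  linarith

lemma mean_mem_Icc {ν : Fin K → Measure ℝ} [∀ k, IsProbabilityMeasure (ν k)]
    (hν : ∀ k, ∀ᵐ r ∂(ν k), r ∈ Set.Icc (0 : ℝ) 1) (hμ : ∀ k, μ k = ∫ r, r ∂(ν k)) (k : Fin K) :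
    μ k ∈ Set.Icc (0 : ℝ) 1 := by
  have hint : Integrable (fun r : ℝ => r) (ν k) :=
    Integrable.of_mem_Icc 0 1 aemeasurable_id (hν k)
  rw [hμ]
  refine ⟨integral_nonneg_of_ae ((hν k).mono fun r hr => hr.1), ?_⟩
  have := integral_mono_ae hint (integrable_const (1 : ℝ)) ((hν k).mono fun r hr => hr.2)
  simpa using this

end Ranking

/-! ### Probability of a good epoch -/

section Probability

variable {Ω : Type*} [MeasurableSpace Ω] {P : Measure Ω} [IsProbabilityMeasure P]
  {ι : Type*} [DecidableEq ι] {K : ℕ} {ν : Fin K → Measure ℝ} [∀ k, IsProbabilityMeasure (ν k)]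
  {μ : Fin K → ℝ} {ξ : ι → ℕ → Ω → Fin K × (Fin K → ℝ)}

lemma Run.exists_of_not_goodEpoch {G : Run ι K} {e H : ℕ} (h : ¬ G.GoodEpoch e μ H) :
    (∃ q ∈ G.stayers (e * G.epochLen) H,
      hop (G.stayers (e * G.epochLen)) (G.drawsFrom (e * G.epochLen)) H q = none) ∨
    ∃ p ∈ G.stayers (e * G.epochLen) (G.learnLen - 1), ∃ i j : Fin K, (i : ℕ) + 1 = j ∧
      (∀ q ∈ G.stayers (e * G.epochLen) H,
        hop (G.stayers (e * G.epochLen)) (G.drawsFrom (e * G.epochLen)) H q ≠ none) ∧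
      (G.learnMemory (e * G.epochLen) G.learnLen p).estimate (ranking μ i)
        ≤ (G.learnMemory (e * G.epochLen) G.learnLen p).estimate (ranking μ j) := by
  by_contra! hc
  obtain ⟨h1, h2⟩ := hc
  exact h ⟨h1, fun p hp => ranking_eq_of_lt fun i j hij => h2 p hp i j hij h1⟩

/-- Probability that an epoch is not good. -/
theorem measure_not_goodEpoch_le (hK : 2 ≤ K) (hν : ∀ k, ∀ᵐ r ∂(ν k), r ∈ Set.Icc (0 : ℝ) 1)
    (hμ : ∀ k, μ k = ∫ r, r ∂(ν k)) (hξm : ∀ p t, Measurable (ξ p t))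
    (hξlaw : ∀ p t, P.map (ξ p t) = roundLaw ν)
    (hξind : iIndepFun (fun i : ι × ℕ => ξ i.1 i.2) P)
    (n L : ℕ) (present : ℕ → Finset ι) (hN : ∀ t, (present t).card ≤ K)
    (free : ι → ℕ → Ω → Fin K) {H : ℕ} (hHn : H < n) (hm : 0 < (n - H) / K) {ε : ℝ} (hε0 : 0 < ε)
    (hε : ε < minGap μ) (e : ℕ) :
    P {ω | ¬ (Run.mk n L present (fun p t => (ξ p t ω).1) (fun p t => (ξ p t ω).2)
        (fun p t => free p t ω)).GoodEpoch e μ H}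
      ≤ ENNReal.ofReal (K * (1 - 1 / K) ^ H + K * (K *
        (Real.exp (-(8 / 13) * ((n - H) / K : ℕ) * ε ^ 2) * (2 * (1 + 2 * K))))) := by
  set G : Ω → Run ι K := fun ω => Run.mk n L present (fun p t => (ξ p t ω).1)
    (fun p t => (ξ p t ω).2) (fun p t => free p t ω) with hG
  -- Who stays is not random, so the sets `A` may be read off from any sample point.
  obtain ⟨ω₀⟩ : Nonempty Ω := nonempty_of_isProbabilityMeasure P
  set t₀ := e * L with ht₀
  set A : ℕ → Finset (present t₀) := (G ω₀).stayers t₀ with hA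
  have hAanti : Antitone A := (G ω₀).stayers_anti t₀
  have hAK : (A 0).card ≤ K := ((G ω₀).card_stayers_zero_le t₀).trans (hN t₀)
  set f : present t₀ → ι := Subtype.val with hf
  have hfinj : f.Injective := Subtype.val_injective
  set c := Real.exp (-(8 / 13) * ((n - H) / K : ℕ) * ε ^ 2) * (2 * (1 + 2 * K)) with hc
  have hc0 : 0 ≤ c := by positivity
  have hK' : (2 : ℝ) ≤ K := by exact_mod_cast hK
  have hν0 : (0 : ℝ) ≤ 1 - 1 / K := by
    rw [sub_nonneg, div_le_one (by linarith)]; linarith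
  let X : Set Ω := {ω | ∃ q ∈ A H, hop A (fun s q => (ξ (f q) (t₀ + s) ω).1) H q = none}
  let Y : present t₀ → Fin K → Set Ω := fun p i => {ω | ∃ j : Fin K, (i : ℕ) + 1 = j ∧
      (∀ q ∈ A H, hop A (fun s q => (ξ (f q) (t₀ + s) ω).1) H q ≠ none) ∧
      ((G ω).learnMemory t₀ n p).estimate (ranking μ i)
        ≤ ((G ω).learnMemory t₀ n p).estimate (ranking μ j)}
  have hY : ∀ p ∈ A (n - 1), ∀ i, P (Y p i) ≤ ENNReal.ofReal c := by
    intro p hp i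
    by_cases hi : (i : ℕ) + 1 < K
    · refine (measure_mono ?_).trans (measure_misranked_le (p := p) hK hν hμ hξm hξlaw hξind f hfinj
        t₀ hAanti hAK hHn hm (fun s hs => hAanti (by omega) hp) hε0
        (lt_sub_of_lt_minGap hε (i := i) (j := ⟨i + 1, hi⟩) rfl).le)
      rintro ω ⟨j, hij, h1, h2⟩
      obtain rfl : j = ⟨i + 1, hi⟩ := Fin.ext hij.symm
      exact ⟨h1, h2⟩
    · refine (measure_mono (t := ∅) ?_).trans (by simp)
      rintro ω ⟨j, hij, -⟩
      have := j.2
      omega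
  have hsub : {ω | ¬ (G ω).GoodEpoch e μ H} ⊆ X ∪ ⋃ p ∈ A (n - 1), ⋃ i ∈ Finset.univ, Y p i := by
    intro ω hω
    rcases Run.exists_of_not_goodEpoch hω with h | ⟨p, hp, i, j, hij, h1, h2⟩
    · exact Or.inl h
    · refine Or.inr ?_
      simp only [Set.mem_iUnion]
      exact ⟨p, hp, i, Finset.mem_univ _, j, hij, h1, h2⟩
  have hcard : (A (n - 1)).card ≤ K := (Finset.card_le_card (hAanti (Nat.zero_le _))).trans hAK
  have hsum : P (⋃ p ∈ A (n - 1), ⋃ i ∈ Finset.univ, Y p i) ≤ ENNReal.ofReal (K * (K * c)) := by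
    have h1 : ∀ p ∈ A (n - 1), P (⋃ i ∈ Finset.univ, Y p i) ≤ ENNReal.ofReal (K * c) := by
      intro p hp
      refine (measure_biUnion_finset_le _ _).trans
        ((Finset.sum_le_card_nsmul _ _ _ fun i _ => hY p hp i).trans (le_of_eq ?_))
      rw [Finset.card_univ, Fintype.card_fin, nsmul_eq_mul,
        ENNReal.ofReal_mul (p := (K : ℝ)) (by linarith), ENNReal.ofReal_natCast]
    refine (measure_biUnion_finset_le _ _).trans
      ((Finset.sum_le_card_nsmul _ _ _ fun p hp => h1 p hp).trans ?_)
    rw [nsmul_eq_mul, ENNReal.ofReal_mul (p := (K : ℝ)) (q := K * c) (by linarith),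
      ENNReal.ofReal_natCast]
    exact mul_le_mul_left (Nat.cast_le.2 hcard) _
  refine (measure_mono hsub).trans ((measure_union_le _ _).trans ?_)
  rw [ENNReal.ofReal_add (by positivity) (by positivity)]
  exact add_le_add (measure_exists_random_le (by omega) hξm hξlaw hξind f hfinj t₀ H hAanti hAK) hsum

end Probability

end DynTrek
end

noncomputable section
namespace DynTrek

/-! ### The sum over the epochs -/

lemma sum_range_mul_add {M : Type*} [AddCommMonoid M] (f : ℕ → M) (E L N : ℕ) :
    ∑ t ∈ Finset.range (E * L + N), f t
      = ∑ e ∈ Finset.range E, ∑ s ∈ Finset.range L, f (e * L + s)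
        + ∑ s ∈ Finset.range N, f (E * L + s) := by
  rw [Finset.sum_range_add]
  congr 1
  induction E with
  | zero => simp
  | succ E ih => rw [Finset.sum_range_succ, ← ih, Nat.succ_mul, Finset.sum_range_add]

namespace Run

variable {ι : Type*} {K : ℕ} [DecidableEq ι] {G : Run ι K} {μ : Fin K → ℝ} {T E N H b x : ℕ}

lemma moves_eq (hT : T = E * G.epochLen + N) (hN : 1 ≤ N) :
    moves G.present T = ∑ e ∈ Finset.range E, ∑ i ∈ Finset.range G.epochLen,
        movesAt G.present (e * G.epochLen + i)
      + ∑ i ∈ Finset.range (N - 1), movesAt G.present (E * G.epochLen + i) := by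
  rw [← sum_range_mul_add (movesAt G.present), ← Nat.add_sub_assoc hN, ← hT]
  rfl

/-- Moves at a restart do no damage and are dropped: hence `epochLen - 1`. -/
lemma sum_movesAt_le (hT : T = E * G.epochLen + N) (hN : 1 ≤ N) :
    ∑ e ∈ Finset.range E, ∑ i ∈ Finset.range (G.epochLen - 1),
        movesAt G.present (e * G.epochLen + i)
      + ∑ i ∈ Finset.range (N - 1), movesAt G.present (E * G.epochLen + i) ≤ moves G.present T := by
  rw [moves_eq hT hN]
  exact Nat.add_le_add_right (Finset.sum_le_sum fun e _ => Finset.sum_le_sum_of_subset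
    (Finset.range_mono (Nat.sub_le _ _))) _

/-- Number of collisions when all epochs are good. -/
theorem collisions_le (hμ : ∀ k, μ k ∈ Set.Icc (0 : ℝ) 1)
    (hl : ∀ e ≤ E, G.EpochLengths e H b) (hg : ∀ e ≤ E, G.GoodEpoch e μ H)
    (hT : T = E * G.epochLen + N) (hN : 1 ≤ N) (hNL : N ≤ G.epochLen)
    (hx : moves G.present T ≤ x) :
    G.collisions T ≤ (E + 1) * (K * H + 2 * K) + 2 * x * (G.epochLen - b) := by
  have h1 := sum_movesAt_le hT hN
  have hb : N - b ≤ G.epochLen - b := Nat.sub_le_sub_right hNL _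
  rw [collisions_eq, hT, sum_range_mul_add]
  have h2 := Finset.sum_le_sum fun e (he : e ∈ Finset.range E) =>
    epoch_collisions_le hμ (hl e (Finset.mem_range.1 he).le) (hg e (Finset.mem_range.1 he).le) le_rfl
  have h3 := epoch_collisions_le hμ (hl E le_rfl) (hg E le_rfl) hNL
  rw [Finset.sum_add_distrib, Finset.sum_const, Finset.card_range, smul_eq_mul, ← Finset.sum_mul,
    ← Finset.mul_sum] at h2
  refine (Nat.add_le_add h2 h3).trans ?_
  set M := ∑ e ∈ Finset.range E, ∑ i ∈ Finset.range (G.epochLen - 1),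
    movesAt G.present (e * G.epochLen + i)
  set M' := ∑ i ∈ Finset.range (N - 1), movesAt G.present (E * G.epochLen + i)
  calc E * (K * H + 2 * K) + 2 * M * (G.epochLen - b) + (K * H + 2 * K + 2 * M' * (N - b))
      ≤ E * (K * H + 2 * K) + 2 * M * (G.epochLen - b)
        + (K * H + 2 * K + 2 * M' * (G.epochLen - b)) := by gcongr
    _ = (E + 1) * (K * H + 2 * K) + 2 * (M + M') * (G.epochLen - b) := by ring
    _ ≤ _ := by
      have := h1.trans hx
      gcongr

/-- Regret when all epochs are good. -/
theorem regret_le (hμ : ∀ k, μ k ∈ Set.Icc (0 : ℝ) 1)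
    (hl : ∀ e ≤ E, G.EpochLengths e H b) (hg : ∀ e ≤ E, G.GoodEpoch e μ H)
    (hT : T = E * G.epochLen + N) (hN : 1 ≤ N) (hNL : N ≤ G.epochLen)
    (hx : moves G.present T ≤ x) :
    G.regret μ T ≤ (K : ℝ) / 2 * (E * (min G.epochLen b : ℕ) + (min N b : ℕ) + (E + 1) * (H + 2))
      + 2 * x * (G.epochLen - b : ℕ) := by
  have h1 := sum_movesAt_le hT hN
  have hb : ((N - b : ℕ) : ℝ) ≤ (G.epochLen - b : ℕ) := by
    exact_mod_cast Nat.sub_le_sub_right hNL _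
  rw [regret_eq, hT, sum_range_mul_add]
  have h2 := Finset.sum_le_sum fun e (he : e ∈ Finset.range E) =>
    epoch_regret_le hμ (hl e (Finset.mem_range.1 he).le) (hg e (Finset.mem_range.1 he).le) le_rfl
  have h3 := epoch_regret_le hμ (hl E le_rfl) (hg E le_rfl) hNL
  rw [Finset.sum_add_distrib, Finset.sum_const, Finset.card_range, nsmul_eq_mul, ← Finset.sum_mul,
    ← Finset.mul_sum, ← Nat.cast_sum] at h2
  refine (add_le_add h2 h3).trans ?_
  set M := ∑ e ∈ Finset.range E, ∑ i ∈ Finset.range (G.epochLen - 1),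
    movesAt G.present (e * G.epochLen + i)
  set M' := ∑ i ∈ Finset.range (N - 1), movesAt G.present (E * G.epochLen + i)
  have hM : (M : ℝ) + M' ≤ x := by exact_mod_cast h1.trans hx
  have h4 : 2 * (M' : ℝ) * (N - b : ℕ) ≤ 2 * (M' : ℝ) * (G.epochLen - b : ℕ) := by gcongr
  have h5 : 2 * ((M : ℝ) + M') * (G.epochLen - b : ℕ) ≤ 2 * x * (G.epochLen - b : ℕ) := by gcongr
  push_cast at h4 h5 ⊢
  linarith

/-! ### The rounds after the horizon do not matter -/

/-- Round `t` sees the present players only up to `t`, so they may be altered from `T` on. -/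
lemma state_congr {f : ℕ → Finset ι} (hf : ∀ t < T, f t = G.present t) {t : ℕ} (ht : t ≤ T) :
    { G with present := f }.state t = G.state t ∧ (t < T → ∀ p,
      { G with present := f }.arm t p = G.arm t p ∧
      { G with present := f }.collides t p = G.collides t p) := by
  have step : ∀ t, { G with present := f }.state t = G.state t → t < T → ∀ p,
      { G with present := f }.arm t p = G.arm t p ∧
      { G with present := f }.collides t p = G.collides t p := by
    intro t hs ht
    have hstart : ∀ p, { G with present := f }.FromStart p t ↔ G.FromStart p t := by
      intro p
      refine forall₂_congr fun s hs => ?_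
      exact iff_of_eq (congrArg (p ∈ ·) (hf s ((Finset.mem_Icc.1 hs).2.trans_lt ht)))
    have harm : ∀ p, { G with present := f }.arm t p = G.arm t p := by
      intro p
      unfold arm armOf
      rw [hs]
      exact if_congr (hstart p) rfl rfl
    refine fun p => ⟨harm p, ?_⟩
    unfold collides collidesOf
    refine decide_eq_decide.2 (exists_congr fun q => ?_)
    have hp := harm p
    have hq := harm q
    unfold arm at hp hq
    rw [hp, hq, ← hf t ht]
  have key : { G with present := f }.state t = G.state t := by
    induction t with
    | zero => rfl
    | succ t ih =>
      have ih' := ih (by omega)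
      funext p
      have h := step t ih' (by omega) p
      unfold arm collides at h
      simp only [state]
      rw [h.1, h.2, ih']
  exact ⟨key, step t key⟩

lemma regret_congr {f : ℕ → Finset ι} (hf : ∀ t < T, f t = G.present t) :
    { G with present := f }.regret μ T = G.regret μ T := by
  unfold regret
  congr 1
  · exact Finset.sum_congr rfl fun t ht => by rw [← hf t (Finset.mem_range.1 ht)]
  · refine Finset.sum_congr rfl fun t ht => ?_
    have ht' := Finset.mem_range.1 ht
    rw [← hf t ht']
    refine Finset.sum_congr rfl fun p _ => ?_
    obtain ⟨h1, h2⟩ := (state_congr hf ht'.le).2 ht' p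
    rw [h1, h2]

lemma collisions_congr {f : ℕ → Finset ι} (hf : ∀ t < T, f t = G.present t) :
    { G with present := f }.collisions T = G.collisions T := by
  refine Finset.sum_congr rfl fun t ht => ?_
  have ht' := Finset.mem_range.1 ht
  rw [← hf t ht']
  refine Finset.sum_congr rfl fun p _ => ?_
  rw [((state_congr hf ht'.le).2 ht' p).2]

end Run

/-! ### Lengths and probabilities -/

section Lengths

variable {K T : ℕ} {ε δ : ℝ}

/-- Needed for `2 * ((τ + 3) / 4) ≤ τ`, which fails for `τ = 1`. -/
lemma two_le_Trh (hK : 2 ≤ K) (hδ0 : 0 < δ) (hδ : δ ≤ 1 / 2) : 2 ≤ Trh K δ := by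
  have hK' : (2 : ℝ) ≤ K := by exact_mod_cast hK
  have hlog := log_one_sub_neg hK
  have h0 : (1 : ℝ) / 2 < 1 - 1 / (4 * K) := by
    have : 1 / (4 * (K : ℝ)) ≤ 1 / 8 := by gcongr; linarith
    linarith
  have h1 : 1 < Real.log (δ / K) / Real.log (1 - 1 / (4 * K)) := by
    rw [lt_div_iff_of_neg hlog, one_mul]
    refine Real.log_lt_log (by positivity) (lt_of_le_of_lt ?_ h0)
    rw [div_le_iff₀ (by linarith)]
    linarith
  have h2 : (1 : ℝ) < Trh K δ := h1.trans_le (Nat.le_ceil _)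
  exact_mod_cast h2

/-- The learning phase is long enough to rank two arms. -/
lemma learning_bounds {H n τ : ℕ} {l : ℝ} (hK : 2 ≤ K) (hε0 : 0 < ε) (hε1 : ε ≤ 1) (hl : 5 ≤ l)
    (hH : H ≤ τ) (hn : τ + 2 * K / ε ^ 2 * l ≤ n) :
    H < n ∧ 0 < (n - H) / K ∧ Real.exp (-(8 / 13) * ((n - H) / K : ℕ) * ε ^ 2) ≤ Real.exp (-l) := by
  have hK' : (2 : ℝ) ≤ K := by exact_mod_cast hK
  have hε2 : 0 < ε ^ 2 := by positivity
  have hε3 : ε ^ 2 ≤ 1 := pow_le_one₀ hε0.le hε1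
  have hH' : (H : ℝ) ≤ τ := by exact_mod_cast hH
  have h1 : (K : ℝ) * (2 * l / ε ^ 2) ≤ n - H := by
    have : (2 : ℝ) * K / ε ^ 2 * l = K * (2 * l / ε ^ 2) := by ring
    linarith
  have h2 : (10 : ℝ) ≤ 2 * l / ε ^ 2 := by
    rw [le_div_iff₀ hε2]
    nlinarith
  have hlt : (H : ℝ) < n := by nlinarith
  have hltN : H < n := by exact_mod_cast hlt
  have h3 : 2 * l / ε ^ 2 < ((n - H) / K : ℕ) + 1 := by
    have h4 : n - H < K * ((n - H) / K + 1) := Nat.lt_mul_div_succ _ (by omega)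
    have h5 : ((n - H : ℕ) : ℝ) < K * (((n - H) / K : ℕ) + 1) := by exact_mod_cast h4
    rw [Nat.cast_sub hltN.le] at h5
    nlinarith
  refine ⟨hltN, ?_, ?_⟩
  · have : (0 : ℝ) < ((n - H) / K : ℕ) := by linarith
    exact_mod_cast this
  · refine Real.exp_le_exp.2 ?_
    -- The cycles satisfy `m ε² > 2 l - 1`, and `(8 / 13) (2 l - 1) ≥ l` once `3 l ≥ 8`.
    rw [div_lt_iff₀ hε2] at h3
    nlinarith

end Lengths

end DynTrek
end

/-! ### Rounded lengths, total failure probability, truncation at the horizon. -/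

noncomputable section
namespace DynTrek

section Lengths

variable {K T x : ℕ} {ε δ : ℝ}

/-- The only use of the formula for the epoch length; `x ≥ 1` is discarded here. -/
lemma two_mul_Tep_sq_le (hx : 1 ≤ x) (hB : 0 ≤ T0 K ε (δ / T) + Ttr K) :
    2 * Tep K T x ε δ ^ 2 ≤ T * K * (T0 K ε (δ / T) + Ttr K) := by
  have hx' : (1 : ℝ) ≤ x := by exact_mod_cast hx
  have h0 : (0 : ℝ) ≤ T * K * (T0 K ε (δ / T) + Ttr K) := by positivity
  rw [Tep, Real.sq_sqrt (by positivity), ← mul_div_assoc, div_le_iff₀ (by linarith)]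
  nlinarith

lemma sub_min_ceil_le {B D : ℝ} (hB : 0 ≤ B) (hBD : B ≤ D) :
    ((⌊D⌋₊ - min ⌈B⌉₊ ⌊D⌋₊ : ℕ) : ℝ) ≤ D - B := by
  have hD := Nat.floor_le (hB.trans hBD)
  have hB' := Nat.le_ceil B
  rcases le_total ⌈B⌉₊ ⌊D⌋₊ with h | h
  · rw [min_eq_left h, Nat.cast_sub h]
    linarith
  · rw [min_eq_right h, Nat.sub_self, Nat.cast_zero]
    linarith

/-- The slack `K + 2` in `2 * Ttr K - K (K - 1)` absorbs both the ceiling of the learning length and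
the floor of the epoch length, as `K ≥ 2`. -/
lemma two_mul_ceil_add_le (hK : 2 ≤ K) {t D : ℝ} (ht : 0 ≤ t) (hD : t + Ttr K ≤ D) :
    2 * ⌈t⌉₊ + K * (K - 1) ≤ 2 * min ⌈t + Ttr K⌉₊ ⌊D⌋₊ := by
  have hK' : (2 : ℝ) ≤ K := by exact_mod_cast hK
  have h1 := Nat.ceil_lt_add_one ht
  have h2 := Nat.le_ceil (t + Ttr K)
  have h3 := Nat.lt_floor_add_one D
  have h4 : 2 * (⌈t⌉₊ : ℝ) + K * (K - 1) < 2 * (t + Ttr K) - 2 := by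
    unfold Ttr
    linarith
  have h5 : ((2 * ⌈t⌉₊ + K * (K - 1) : ℕ) : ℝ) < (2 * ⌈t + Ttr K⌉₊ : ℕ) := by
    push_cast [Nat.cast_sub (show 1 ≤ K by omega)]
    linarith
  have h6 : ((2 * ⌈t⌉₊ + K * (K - 1) : ℕ) : ℝ) < (2 * ⌊D⌋₊ : ℕ) := by
    push_cast [Nat.cast_sub (show 1 ≤ K by omega)]
    linarith
  rw [Nat.cast_lt] at h5 h6
  omega

/-- The failure probability of all epochs. -/
lemma epochs_mul_failure_le {E : ℕ} {a q : ℝ} (hK : 2 ≤ K) (hT : 1 ≤ T) (hδ : 0 < δ)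
    (hE : ((E : ℝ) + 1) * (K + 1) ≤ T) (ha : a ≤ δ / (2 * T))
    (hq : q ≤ Real.exp (-Real.log (4 * K ^ 2 * T / δ))) :
    ((E : ℝ) + 1) * (a + K * (K * (q * (2 * (1 + 2 * K))))) ≤ δ := by
  have hK' : (2 : ℝ) ≤ K := by exact_mod_cast hK
  have hT' : (1 : ℝ) ≤ T := by exact_mod_cast hT
  rw [Real.exp_neg, Real.exp_log (by positivity), inv_div] at hq
  calc ((E : ℝ) + 1) * (a + K * (K * (q * (2 * (1 + 2 * K)))))
      ≤ (E + 1) * (δ / (2 * T) + K * (K * (δ / (4 * K ^ 2 * T) * (2 * (1 + 2 * K))))) := by gcongr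
    -- An epoch fails with probability `δ / (2 T) + (1 + 2 K) δ / (2 T) = (K + 1) δ / T`.
    _ = (E + 1) * (K + 1) * (δ / T) := by field_simp; ring
    _ ≤ T * (δ / T) := by gcongr
    _ = δ := by field_simp

end Lengths

lemma Run.noEntry_truncate {ι : Type*} {K T L b : ℕ} {B : ℝ} {present : ℕ → Finset ι}
    (hentry : ∀ t < T, t % L ≠ 0 → ((t % L : ℕ) : ℝ) < B → present t ⊆ present (t - 1))
    (hbL : b ≤ L) (hbB : b ≤ ⌈B⌉₊) {G : Run ι K}
    (hG : G.present = fun t => if t < T then present t else ∅) (e : ℕ) : G.NoEntry (e * L) b := by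
  intro i hi0 hib
  rw [hG]
  by_cases hT : e * L + i < T
  · have hmod : (e * L + i) % L = i := by
      rw [Nat.mul_add_mod', Nat.mod_eq_of_lt (by omega)]
    simp only [hT, if_true, show e * L + i - 1 < T by omega]
    refine hentry _ hT (by omega) ?_
    rw [hmod]
    exact Nat.lt_ceil.1 (hib.trans_le hbB)
  · simp [hT]

lemma moves_congr {ι : Type*} [DecidableEq ι] {T : ℕ} {f g : ℕ → Finset ι}
    (h : ∀ t < T, f t = g t) : moves f T = moves g T := by
  refine Finset.sum_congr rfl fun t ht => ?_
  have := Finset.mem_range.1 ht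
  rw [h t (by omega), h (t + 1) (by omega)]

/-- Subadditivity alone, so that no event has to be measurable. -/
lemma ofReal_one_sub_le_measure {Ω : Type*} [MeasurableSpace Ω] {P : Measure Ω}
    [IsProbabilityMeasure P] {δ : ℝ} (hδ : 0 ≤ δ) {S F : Set Ω} (hS : Sᶜ ⊆ F)
    (hF : P F ≤ ENNReal.ofReal δ) : ENNReal.ofReal (1 - δ) ≤ P S := by
  rw [ENNReal.ofReal_sub 1 hδ, ENNReal.ofReal_one, tsub_le_iff_right, ← measure_univ (μ := P),
    ← Set.union_compl_self S]
  exact (measure_union_le _ _).trans (by gcongr; exact (measure_mono hS).trans hF)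

end DynTrek
end

/-! ### All epochs together. -/

theorem proposition1
    {Ω : Type*} [MeasurableSpace Ω] (P : Measure Ω) [IsProbabilityMeasure P]
    {ι : Type*} [DecidableEq ι]
    (K T x : ℕ) (hK : 2 ≤ K) (hx : 1 ≤ x)
    (δ ε : ℝ) (hδ : δ ∈ Set.Ioo (0 : ℝ) 1)
    -- the reward laws of the arms, on `[0, 1]`, and their means
    (ν : Fin K → Measure ℝ) [∀ k, IsProbabilityMeasure (ν k)]
    (hν : ∀ k, ∀ᵐ r ∂(ν k), r ∈ Set.Icc (0 : ℝ) 1)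
    (μ : Fin K → ℝ) (hμ : ∀ k, μ k = ∫ r, r ∂(ν k))
    (hε0 : 0 < ε) (hε : ε < DynTrek.minGap μ)
    -- the learning and trekking phases fit into an epoch, and an epoch into the horizon
    (hep : DynTrek.T0 K ε (δ / T) + DynTrek.Ttr K ≤ DynTrek.Tep K T x ε δ)
    (hT : DynTrek.Tep K T x ε δ ≤ T)
    -- the players in the game: at most `K` at a time, at most `x` entries and departures,
    -- no entry during the learning and trekking phases of an epoch
    (present : ℕ → Finset ι)
    (hN : ∀ t < T, (present t).card ≤ K)
    (hmoves : DynTrek.moves present T ≤ x)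
    (hentry : ∀ t < T, t % ⌊DynTrek.Tep K T x ε δ⌋₊ ≠ 0 →
      ((t % ⌊DynTrek.Tep K T x ε δ⌋₊ : ℕ) : ℝ) < DynTrek.T0 K ε (δ / T) + DynTrek.Ttr K →
      present t ⊆ present (t - 1))
    -- independent uniform draws and rewards, for every player and round
    (ξ : ι → ℕ → Ω → Fin K × (Fin K → ℝ))
    (hξm : ∀ p t, Measurable (ξ p t))
    (hξlaw : ∀ p t, P.map (ξ p t) = DynTrek.roundLaw ν)
    (hξind : iIndepFun (fun i : ι × ℕ => ξ i.1 i.2) P)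
    -- whatever players do between their entry and the next restart
    (free : ι → ℕ → Ω → Fin K) :
    ENNReal.ofReal (1 - δ) ≤ P {ω |
      (DynTrek.dynamicTrekking K T x ε δ present
          (fun p t => ξ p t ω) (fun p t => free p t ω)).regret μ T
        < T * K * (DynTrek.T0 K ε (δ / T) + DynTrek.Ttr K) / DynTrek.Tep K T x ε δ
          + 2 * x * (DynTrek.Tep K T x ε δ - DynTrek.T0 K ε (δ / T) - DynTrek.Ttr K)
      ∧ ((DynTrek.dynamicTrekking K T x ε δ present
          (fun p t => ξ p t ω) (fun p t => free p t ω)).collisions T : ℝ)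
        ≤ T / DynTrek.Tep K T x ε δ * (K * DynTrek.Trh K (δ / (2 * T)) + 4 * K)
          + 2 * x * (DynTrek.Tep K T x ε δ - DynTrek.T0 K ε (δ / T) - DynTrek.Ttr K)} := by
  have hK' : (2 : ℝ) ≤ K := by exact_mod_cast hK
  obtain ⟨hδ0, hδ1⟩ := hδ
  have hμI : ∀ k, μ k ∈ Set.Icc (0 : ℝ) 1 := DynTrek.mean_mem_Icc hν hμ
  have hεK := DynTrek.mul_sub_one_le_one hK hμI hε
  have hε1 : ε ≤ 1 := by nlinarith
  have hlen := DynTrek.lengthBounds hK ⟨hδ0, hδ1⟩ hε0 hεK (hep.trans hT)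
  have hsq := DynTrek.two_mul_Tep_sq_le (K := K) (T := T) (ε := ε) (δ := δ) hx
    (by have := hlen.add_lt; linarith)
  set t := DynTrek.T0 K ε (δ / T) with ht
  set B := t + DynTrek.Ttr K with hBdef
  set D := DynTrek.Tep K T x ε δ with hDdef
  set τ := DynTrek.Trh K (δ / (2 * T)) with hτdef
  -- This is `τ / 4` rounded up.
  set H := (τ + 3) / 4 with hHdef
  set L := ⌊D⌋₊ with hLdef
  set n := ⌈t⌉₊ with hndef
  -- The ceiling of `B` may exceed `L`, the rounded-down epoch length.
  set b := min ⌈B⌉₊ L with hbdef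
  have hB := hlen.add_lt
  have hD0 : 0 < D := by linarith
  have hT1 : 1 ≤ T := by
    have : (0 : ℝ) < T := by linarith
    exact_mod_cast this
  have hT1' : (1 : ℝ) ≤ T := by exact_mod_cast hT1
  have hτ : 2 ≤ τ := DynTrek.two_le_Trh hK (by positivity) (by
    rw [div_le_div_iff₀ (by positivity) (by norm_num)]; linarith)
  have hLD : (L : ℝ) ≤ D := Nat.floor_le hD0.le
  have hL : 0 < L := Nat.floor_pos.2 (by linarith)
  have ht0 : τ + 2 * K / ε ^ 2 * Real.log (4 * K ^ 2 * T / δ) = t := (DynTrek.T0_eq K T ε δ).symm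
  have htn : t ≤ n := Nat.le_ceil t
  obtain ⟨hHn, hm, hexp⟩ := DynTrek.learning_bounds (H := H) (n := n) hK hε0 hε1 hlen.five_le
    (by omega : H ≤ τ) (ht0.le.trans htn)
  have htrek : 2 * n + K * (K - 1) ≤ 2 * b := DynTrek.two_mul_ceil_add_le hK (by
    rw [← ht0]
    have := hlen.five_le
    positivity) hep
  have hKK : 2 ≤ K * (K - 1) := Nat.mul_le_mul hK (by omega : 1 ≤ K - 1)
  have hbL : b ≤ L := min_le_right _ _
  -- Dividing `T - 1` makes the last epoch nonempty and possibly complete: `1 ≤ N ≤ L`.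
  set E := (T - 1) / L with hEdef
  set N := (T - 1) % L + 1 with hNdef
  have hTEN : T = E * L + N := by
    have : E * L + (T - 1) % L = T - 1 := Nat.div_add_mod' (T - 1) L
    omega
  have hNL : N ≤ L := Nat.mod_lt _ hL
  have hsplit : DynTrek.EpochSplit K T E L N b B D := {
    eq := hTEN
    pos := Nat.le_add_left _ _
    le := hNL
    le_epoch := hLD
    epoch_lt := Nat.lt_floor_add_one D
    le_horizon := hT
    phases_le := hep
    lt_phases := lt_of_le_of_lt (by exact_mod_cast min_le_left _ _)
      (Nat.ceil_lt_add_one (by linarith))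
    sq_le := hsq }
  have hcost := hsplit.cost_lt hlen
  have hE := hsplit.epochs_le hD0
  have hEK : ((E : ℝ) + 1) * (K + 1) ≤ T := by
    calc ((E : ℝ) + 1) * (K + 1) ≤ 2 * (T / D) * (D / 2) := by
          gcongr
          linarith
      _ = T := by field_simp
  have hLb : ((L - b : ℕ) : ℝ) ≤ D - t - DynTrek.Ttr K := by
    have := DynTrek.sub_min_ceil_le (B := B) (D := D) (by linarith) hep
    linarith
  -- The hypotheses stop at the horizon, but the last epoch may go beyond it; with nobody present
  -- from `T` on, they hold in all rounds.
  set present' : ℕ → Finset ι := fun t => if t < T then present t else ∅ with hpresent'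
  have hpres : ∀ t < T, present' t = present t := fun t ht => if_pos ht
  have hN' : ∀ t, (present' t).card ≤ K := by
    intro t
    by_cases h : t < T
    · rw [hpres t h]; exact hN t h
    · simp [hpresent', h]
  let G : Ω → DynTrek.Run ι K := fun ω => DynTrek.Run.mk n L present'
    (fun p t => (ξ p t ω).1) (fun p t => (ξ p t ω).2) (fun p t => free p t ω)
  have hlengths : ∀ ω e, (G ω).EpochLengths e H b := fun ω e => {
    hop_lt := hHn
    trek_le := by rw [min_eq_left (show b ≤ (G ω).epochLen from hbL)]; exact htrek
    learn_lt := by change n < L; omega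
    noEntry := DynTrek.Run.noEntry_truncate hentry hbL (min_le_left _ _) rfl e
    card_le := hN' }
  have hbad : P (⋃ e ∈ Finset.range (E + 1), {ω | ¬ (G ω).GoodEpoch e μ H})
      ≤ ENNReal.ofReal δ := by
    refine (measure_biUnion_finset_le _ _).trans ((Finset.sum_le_card_nsmul _ _ _ fun e _ =>
      DynTrek.measure_not_goodEpoch_le hK hν hμ hξm hξlaw hξind n L present' hN' free hHn hm hε0 hε
        e).trans ?_)
    rw [Finset.card_range, nsmul_eq_mul, ← ENNReal.ofReal_natCast,
      ← ENNReal.ofReal_mul (Nat.cast_nonneg _)]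
    refine ENNReal.ofReal_le_ofReal ?_
    push_cast
    exact DynTrek.epochs_mul_failure_le hK hT1 hδ0 hEK
      (DynTrek.mul_pow_le_of_Trh hK (by positivity) (by omega)) hexp
  refine DynTrek.ofReal_one_sub_le_measure hδ0.le (fun ω hω => ?_) hbad
  by_contra hgood
  simp only [Set.mem_iUnion, Set.mem_ofPred_eq, not_exists, not_not, Finset.mem_range] at hgood
  have hg : ∀ e ≤ E, (G ω).GoodEpoch e μ H := fun e he => hgood e (by omega)
  have hmoves' : DynTrek.moves (G ω).present T ≤ x := (DynTrek.moves_congr hpres).trans_le hmoves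
  have hR := DynTrek.Run.regret_le hμI (fun e _ => hlengths ω e) hg hTEN (Nat.le_add_left _ _) hNL
    hmoves'
  have hC := DynTrek.Run.collisions_le hμI (fun e _ => hlengths ω e) hg hTEN (Nat.le_add_left _ _)
    hNL hmoves'
  have hx0 : (0 : ℝ) ≤ 2 * x := by positivity
  have hslack := mul_le_mul_of_nonneg_left hLb hx0
  refine hω ⟨?_, ?_⟩
  · rw [← DynTrek.Run.regret_congr (G := DynTrek.dynamicTrekking K T x ε δ present
      (fun p t => ξ p t ω) (fun p t => free p t ω)) hpres]
    have h1 : (K : ℝ) / 2 * (E * (min L b : ℕ) + (min N b : ℕ) + (E + 1) * (H + 2))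
        < K / 2 * (2 * B * (T / D)) := mul_lt_mul_of_pos_left hcost (by linarith)
    have h2 : (K : ℝ) / 2 * (2 * B * (T / D)) = T * K * B / D := by ring
    exact hR.trans_lt (by linarith)
  · rw [← DynTrek.Run.collisions_congr (G := DynTrek.dynamicTrekking K T x ε δ present
      (fun p t => ξ p t ω) (fun p t => free p t ω)) hpres]
    have h1 : ((G ω).collisions T : ℝ) ≤ (E + 1) * (K * H + 2 * K) + 2 * x * (L - b : ℕ) := by
      exact_mod_cast hC
    -- The factor `2` in the number of epochs is paid for by `H` being at most half of `τ`.
    have hH : 2 * (H : ℝ) ≤ τ := by exact_mod_cast (by omega : 2 * H ≤ τ)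
    have h2 : ((E : ℝ) + 1) * (K * H + 2 * K) ≤ T / D * (K * τ + 4 * K) := by
      calc ((E : ℝ) + 1) * (K * H + 2 * K) ≤ 2 * (T / D) * (K * H + 2 * K) := by gcongr
        _ = T / D * (K * (2 * H) + 4 * K) := by ring
        _ ≤ _ := by gcongr
    exact h1.trans (by linarith)
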